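/- **Setting.** Let $\mathcal T\subset\mathbb R^2$ be a compact convex region with non-empty interior, with perimeter $\partial\mathcal T$ of length $L$ parametrized counter-clockwise (ccw) by arc length, $\boldsymbol\gamma(s)$, $s\in\mathbb R/L\mathbb Z$ (corners are allowed). Write $\ell(a,b)=(b-a)\bmod L\in[0,L)$ for the ccw arc length from $a$ to $b$, and $[a,b]=\{s:\ell(a,s)\le \ell(a,b)\}$ (similarly half-open segments). Let $0<\nu\le 1$. Two defenders move on the perimeter, $\dot s=\omega$, $|\omega|\le 1$; an intruder moves in the plane, $\dot{\mathbf x}=\mathbf u$, $\|\mathbf u\|\le\nu$, starting outside $\mathcal T$. The intruder scores if it reaches $\partial\mathcal T$ at some time without having coincided with a defender up to and including that time. The intruder *wins* from a state if it has a nonanticipative strategy that scores against all defender motions; the defenders *win* if they have a nonanticipative strategy under which no intruder motion scores. The *states* are the triples (two distinct defender positions, intruder position outside $\mathcal T$); the *barrier* is the set of states that lie both in the closure of the set of intruder-winning states and in the closure of the set of defender-winning states. **Geometry.** For $\mathbf x\notin\mathcal T$ let $\mathcal S_d(\mathbf x)$ be the set of perimeter points that can be reached from $\mathbf x$ on a straight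 segment that avoids $\mathcal T$ before its endpoint. Put $J_L(s_B;s_D,\mathbf x)=\ell(s_D,s_B)-\|\boldsymbol\gamma(s_B)-\mathbf x\|/\nu$ and $J_R(s_B;s_D,\mathbf x)=\ell(s_B,s_D)-\|\boldsymbol\gamma(s_B)-\mathbf x\|/\nu$. The breaching point $s_L(\mathbf x)$ (resp. $s_R(\mathbf x)$) is the maximizer of $J_L(\cdot;s_D,\mathbf x)$ (resp. $J_R$) over $\mathcal S_d(\mathbf x)$ for $s_D\notin\mathcal S_d(\mathbf x)$; it does not depend on $s_D$. Put $J_L^*(s_D,\mathbf x)=J_L(s_L;s_D,\mathbf x)$, $J_R^*(s_D,\mathbf x)=J_R(s_R;s_D,\mathbf x)$. *One defender.* With $s^{op}_D=s_D+L/2$, $\mathcal S_L=[s_D,s_D^{op}]$, $\mathcal S_R=[s_D^{op},s_D]$, let $\Omega_L(s_D)$ be the set of $\mathbf x$ with ($s_L\in\mathcal S_L$, $s_R\in\mathcal S_R$, $J_L^*>J_R^*$), or ($s_L\in\mathcal S_L$, $s_R\notin\mathcal S_R$), or ($s_L\notin\mathcal S_L$, $s_R\notin\mathcal S_R$, $J_L^*<J_R^*$).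 Let $V(s_D,\mathbf x)=J_L^*$ on $\Omega_L(s_D)$ and $V=J_R^*$ elsewhere. The one-vs-one barrier is $\{V=0\}$; the defender's region $\mathcal D(s_D)$ consists of $\boldsymbol\gamma(s_D)$ and the $\mathbf x\notin\mathcal T$ with $V\le 0$. The afferent surface is $\Gamma_{\rm aff}(s_D)=\{\mathbf x\notin\mathcal T: s_D\in[s_R,s_L],\ J_L^*=J_R^*\}$. For perimeter points $a,b$ let $\mathcal G(a,b)=\bigcup_{s\in[a,b]}\Gamma_{\rm aff}(s)$, the part of the exterior between $\Gamma_{\rm aff}(a)$ and $\Gamma_{\rm aff}(b)$. *Two defenders* $D_i$ at $s_i$ (cw side), $D_j$ at $s_j$ (ccw side). Let $s_{\rm mid}=s_i+\frac12 \ell(s_i,s_j)$, $J_{\rm mid}=\frac12 \ell(s_i,s_j)-\|\boldsymbol\gamma(s_{\rm mid})-\mathbf x\|/\nu$, and $$\mathcal R_i=\{\mathbf x: s_L\in[s_i,s_{\rm mid}),\ \mathbf x\in\mathcal G(s_i,s_L)\},\qquad \mathcal R_j=\{\mathbf x: s_R\in(s_{\rm mid},s_j],\ \mathbf x\in\mathcal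 G(s_R,s_j)\},$$ and $\mathcal R_{\rm mid}$ the remaining points. Let $V_{ij}=J_L^*(s_i,\mathbf x)$ on $\mathcal R_i$, $J_R^*(s_j,\mathbf x)$ on $\mathcal R_j$, $J_{\rm mid}$ on $\mathcal R_{\rm mid}$, with optimal breaching point $s_{\rm opt}=s_L,s_R,s_{\rm mid}$ respectively. The paired-defense region is $\mathcal R_{\rm pair}=\{\mathbf x: V(s_i,\mathbf x)>0,\ V(s_j,\mathbf x)>0,\ V_{ij}\le 0\}$. **Theorem.** For any two distinct defender positions $a,b$, every $\mathbf x\notin\mathcal T$ lies in $\mathcal G(a,b)\cup\mathcal G(b,a)$. Label the defenders so that $\mathbf x\in\mathcal G(s_i,s_j)$. Then: 1. $(s_i,s_j,\mathbf x)$ belongs to the barrier if and only if $V_{ij}=0$. 2. $V_{ij}=0$ if and only if ($\mathbf x\in\mathcal R_i$ and $V(s_i,\mathbf x)=0$), or ($\mathbf x\in\mathcal R_j$ and $V(s_j,\mathbf x)=0$), or ($\mathbf x\in\mathcal R_{\rm mid}$ and $\|\mathbf x-\boldsymbol\gamma(s_{\rm mid})\|=\frac12\nu\,\ell(s_i,s_j)$):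 two one-vs-one barriers joined by a circle centred at the midpoint. 3. The intruder wins if and only if $V_{ij}>0$, and the defenders win if and only if $V_{ij}\le 0$. If $V_{ij}>0$, running straight to $\boldsymbol\gamma(s_{\rm opt})$ at full speed (target fixed at the start) scores against all defender motions. 4. If $\mathbf x\in\mathcal R_{\rm pair}$ and the defenders play the pincer maneuver $[\omega_{D_i},\omega_{D_j}]=[1,-1]$, then for every intruder motion $\mathbf x(\cdot)$ there is a time $t\ge 0$, before which the intruder has not reached $\mathcal T$, such that either $\mathbf x(t)\in\mathcal D(s_i+t)$ and $D_i$ alone wins the one-vs-one game from there, or $\mathbf x(t)\in\mathcal D(s_j-t)$ and $D_j$ alone wins the one-vs-one game from there. -/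

import Mathlib

open Set

/-- The plane `ℝ²` with the Euclidean norm. -/
abbrev Plane : Type := EuclideanSpace ℝ (Fin 2)

/-- The planar cross product. -/
def cross (u v : Plane) : ℝ := u 0 * v 1 - u 1 * v 0

/-- A convex target region together with the counter-clockwise arc-length parametrization of its
perimeter, extended periodically to `ℝ`.  No smoothness is required: corners are allowed. -/
structure Perimeter where
  /-- the target region -/
  target : Set Plane
  convex : Convex ℝ target
  isCompact : IsCompact target
  interior_nonempty : (interior target).Nonempty
  /-- the length of the perimeter -/
  len : ℝ
  len_pos : 0 < len
  /-- the parametrization of the perimeter -/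
  γ : ℝ → Plane
  periodic : Function.Periodic γ len
  bijOn : BijOn γ (Ico 0 len) (frontier target)
  unitSpeed : HasUnitSpeedOn γ univ
  ccw : ∀ s s' s'' : ℝ, s < s' → s' < s'' → s'' < s + len →
    0 ≤ cross (γ s' - γ s) (γ s'' - γ s)

noncomputable section

namespace Perimeter

variable (P : Perimeter) (ν : ℝ)

/-! ### Geometry of the perimeter -/

/-- The counter-clockwise arc length from `a` to `b`, i.e. `(b - a) mod len`, in `[0, len)`. -/
def arc (a b : ℝ) : ℝ := toIcoMod P.len_pos 0 (b - a)

/-- The closed segment of the perimeter that starts at `a` and ends at `b` in ccw direction. -/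
def seg (a b : ℝ) : Set ℝ := {s | P.arc a s ≤ P.arc a b}

/-- The perimeter points that can be reached from `x` on a straight line outside the target. -/
def visible (x : Plane) : Set ℝ :=
  {s | ∀ t ∈ Ico (0 : ℝ) 1, AffineMap.lineMap x (P.γ s) t ∉ P.target}

/-- `J_L(s_B; s_D, x)`. -/
def JL (sB sD : ℝ) (x : Plane) : ℝ := P.arc sD sB - ‖P.γ sB - x‖ / ν

/-- `J_R(s_B; s_D, x)`. -/
def JR (sB sD : ℝ) (x : Plane) : ℝ := P.arc sB sD - ‖P.γ sB - x‖ / ν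

/-- `s` (normalized to `[0, len)`) maximizes `J_L(·; s_D, x)` over the visible part of the
perimeter, for the defender positions `s_D` outside the visible part. -/
def IsLeftBreach (x : Plane) (s : ℝ) : Prop :=
  s ∈ Ico 0 P.len ∧ s ∈ P.visible x ∧
    ∀ sD, sD ∉ P.visible x → ∀ sB ∈ P.visible x, P.JL ν sB sD x ≤ P.JL ν s sD x

/-- The same for `J_R`. -/
def IsRightBreach (x : Plane) (s : ℝ) : Prop :=
  s ∈ Ico 0 P.len ∧ s ∈ P.visible x ∧
    ∀ sD, sD ∉ P.visible x → ∀ sB ∈ P.visible x, P.JR ν sB sD x ≤ P.JR ν s sD x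

/-- The left breaching point `s_L(x)`. -/
def sL (x : Plane) : ℝ := Classical.epsilon (P.IsLeftBreach ν x)

/-- The right breaching point `s_R(x)`. -/
def sR (x : Plane) : ℝ := Classical.epsilon (P.IsRightBreach ν x)

/-- `J_L^*(s_D, x) = J_L(s_L(x); s_D, x)`. -/
def JLstar (sD : ℝ) (x : Plane) : ℝ := P.JL ν (P.sL ν x) sD x

/-- `J_R^*(s_D, x) = J_R(s_R(x); s_D, x)`. -/
def JRstar (sD : ℝ) (x : Plane) : ℝ := P.JR ν (P.sR ν x) sD x

/-! ### One defender -/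

/-- The point of the perimeter opposite to the defender. -/
def opp (sD : ℝ) : ℝ := sD + P.len / 2

/-- The left region `Ω_L(s_D)`, the union of its three parts. -/
def leftRegion (sD : ℝ) : Set Plane :=
  {x | P.sL ν x ∈ P.seg sD (P.opp sD) ∧ P.sR ν x ∈ P.seg (P.opp sD) sD ∧
      P.JRstar ν sD x < P.JLstar ν sD x} ∪
  {x | P.sL ν x ∈ P.seg sD (P.opp sD) ∧ P.sR ν x ∉ P.seg (P.opp sD) sD} ∪
  {x | P.sL ν x ∉ P.seg sD (P.opp sD) ∧ P.sR ν x ∉ P.seg (P.opp sD) sD ∧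
      P.JLstar ν sD x < P.JRstar ν sD x}

open Classical in
/-- The one vs. one value `V(s_D, x)`; its zero level set is the one vs. one barrier. -/
def V (sD : ℝ) (x : Plane) : ℝ :=
  if x ∈ P.leftRegion ν sD then P.JLstar ν sD x else P.JRstar ν sD x

/-- The winning region of a single defender: the complement of `{V > 0}` outside the target, and
the point of capture. -/
def defenderRegion (sD : ℝ) : Set Plane :=
  {x | x = P.γ sD ∨ (x ∉ P.target ∧ ¬ 0 < P.V ν sD x)}

/-- The afferent surface of `s_D`: the branch of `{J_L^* = J_R^*}` that extends from `s_D`, i.e.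
the one on which `s_D` lies between the two breaching points.  (On the other branch, which extends
from the point opposite to `s_D`, the defender is not between the breaching points.) -/
def afferent (sD : ℝ) : Set Plane :=
  {x | x ∉ P.target ∧ sD ∈ P.seg (P.sR ν x) (P.sL ν x) ∧ P.JLstar ν sD x = P.JRstar ν sD x}

/-- The part of the exterior of the target that lies, in ccw direction, between the afferent
surfaces of `a` and of `b` (both included): it is swept by the afferent surfaces of the points of
the segment from `a` to `b`. -/
def sector (a b : ℝ) : Set Plane := {x | ∃ s ∈ P.seg a b, x ∈ P.afferent ν s}

/-! ### Two defenders, `D_i` at `si` on the cw side and `D_j` at `sj` on the ccw side -/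

/-- The midpoint of the segment from `si` to `sj`. -/
def mid (si sj : ℝ) : ℝ := si + P.arc si sj / 2

/-- The region `R_i`: the left breaching point lies in `[si, mid)`, on the intruder's side. -/
def regionI (si sj : ℝ) : Set Plane :=
  {x | P.arc si (P.sL ν x) < P.arc si (P.mid si sj) ∧ x ∈ P.sector ν si (P.sL ν x)}

/-- The region `R_j`: the right breaching point lies in `(mid, sj]`, on the intruder's side. -/
def regionJ (si sj : ℝ) : Set Plane :=
  {x | P.arc (P.sR ν x) sj < P.arc (P.mid si sj) sj ∧ x ∈ P.sector ν (P.sR ν x) sj}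

/-- `J_mid`. -/
def Jmid (si sj : ℝ) (x : Plane) : ℝ :=
  P.arc si sj / 2 - ‖P.γ (P.mid si sj) - x‖ / ν

open Classical in
/-- The optimal breaching point `s_opt`. -/
def sOpt (si sj : ℝ) (x : Plane) : ℝ :=
  if x ∈ P.regionI ν si sj then P.sL ν x
  else if x ∈ P.regionJ ν si sj then P.sR ν x
  else P.mid si sj

open Classical in
/-- The two vs. one value `V_ij`. -/
def Vij (si sj : ℝ) (x : Plane) : ℝ :=
  if x ∈ P.regionI ν si sj then P.JLstar ν si x
  else if x ∈ P.regionJ ν si sj then P.JRstar ν sj x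
  else P.Jmid ν si sj x

/-- The paired-defense region: the intruder beats each defender in the one vs. one game, but
`V_ij` is not positive. -/
def pairedRegion (si sj : ℝ) : Set Plane :=
  {x | 0 < P.V ν si x ∧ 0 < P.V ν sj x ∧ ¬ 0 < P.Vij ν si sj x}

/-! ### The game of kind -/

/-- Motions of the intruder from `x₀`, for `t ≥ 0`: the solutions of `x' = u`, `‖u‖ ≤ ν`, are
exactly the `ν`-Lipschitz curves. -/
def IsIntruderMotion (x₀ : Plane) (x : ℝ → Plane) : Prop :=
  x 0 = x₀ ∧ ∀ t t' : ℝ, 0 ≤ t → 0 ≤ t' → ‖x t - x t'‖ ≤ ν * |t - t'|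

/-- Motions of a team of defenders from the positions `a`, for `t ≥ 0`: `s' = ω`, `|ω| ≤ 1`. -/
def IsDefenderMotion {ι : Type} (a : ι → ℝ) (s : ι → ℝ → ℝ) : Prop :=
  ∀ k, s k 0 = a k ∧ ∀ t t' : ℝ, 0 ≤ t → 0 ≤ t' → |s k t - s k t'| ≤ |t - t'|

/-- The intruder reaches the perimeter at some time without having been captured up to and
including that time. -/
def Scores {ι : Type} (x : ℝ → Plane) (s : ι → ℝ → ℝ) : Prop :=
  ∃ t : ℝ, 0 ≤ t ∧ x t ∈ frontier P.target ∧ ∀ τ ∈ Icc 0 t, ∀ k, x τ ≠ P.γ (s k τ)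

/-- The intruder has a nonanticipative strategy that scores against all motions of the
defenders. -/
def IntruderWins {ι : Type} (a : ι → ℝ) (x₀ : Plane) : Prop :=
  ∃ α : (ι → ℝ → ℝ) → ℝ → Plane,
    (∀ s, IsDefenderMotion a s → IsIntruderMotion ν x₀ (α s)) ∧
    (∀ s s', IsDefenderMotion a s → IsDefenderMotion a s' → ∀ t₁ : ℝ,
      (∀ t ∈ Icc 0 t₁, ∀ k, s k t = s' k t) → ∀ t ∈ Icc 0 t₁, α s t = α s' t) ∧
    ∀ s, IsDefenderMotion a s → P.Scores (α s) s

/-- The defenders have a nonanticipative strategy against which no motion of the intruder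
scores: the intruder is captured or kept from the perimeter forever. -/
def DefendersWin {ι : Type} (a : ι → ℝ) (x₀ : Plane) : Prop :=
  ∃ β : (ℝ → Plane) → ι → ℝ → ℝ,
    (∀ x, IsIntruderMotion ν x₀ x → IsDefenderMotion a (β x)) ∧
    (∀ x x', IsIntruderMotion ν x₀ x → IsIntruderMotion ν x₀ x' → ∀ t₁ : ℝ,
      (∀ t ∈ Icc 0 t₁, x t = x' t) → ∀ t ∈ Icc 0 t₁, ∀ k, β x k t = β x' k t) ∧
    ∀ x, IsIntruderMotion ν x₀ x → ¬ P.Scores x (β x)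

/-- The states of the two vs. one game: two defenders at different points of the perimeter and an
intruder outside the target. -/
def states : Set ((Fin 2 → ℝ) × Plane) :=
  {p | P.γ (p.1 0) ≠ P.γ (p.1 1) ∧ p.2 ∉ P.target}

/-- The barrier of the game of kind: the surface in the state space that separates the
configurations won by the intruder from those won by the defenders, i.e. the states that are
adherent to both winning sets. -/
def barrier : Set ((Fin 2 → ℝ) × Plane) :=
  P.states ∩ closure {p | p ∈ P.states ∧ P.IntruderWins ν p.1 p.2} ∩
    closure {p | p ∈ P.states ∧ P.DefendersWin ν p.1 p.2}

/-- The intruder runs from `x₀` straight to `y` at full speed, and stops there. -/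
def straightRun (x₀ y : Plane) (t : ℝ) : Plane :=
  AffineMap.lineMap x₀ y (min 1 (ν * t / ‖y - x₀‖))

end Perimeter

end

noncomputable section

/-! The game is moved to the universal cover of the perimeter. The nearest-point projection onto the
convex target is 1-Lipschitz, so while the intruder stays outside the interior, its foot runs along
the perimeter with speed at most `ν ≤ 1` and lifts to a path in `ℝ` (`exists_lift`,
`abs_sub_le_of_lipschitz`). Let `σ` be a lift of the foot of `x` and `d(s) = ‖x - γ s‖`. The visible
points lift to an interval around `σ` that is too short to contain two lifts of the same point
(`visibleLift`).

On this interval let `A` be the maximum of `s - d(s)/ν`, attained at `l`, and `B` the minimum of `s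
+ d(s)/ν`, attained at `r`. For suitably lifted defender positions `e` the values are `J_L^* = A -
e` and `J_R^* = e - B`; moreover `A < σ < B`, and the afferent surfaces through `x` are those of the
point `(A + B)/2`. In the right lift, `x` lies in the sector of the pair when `(A + B)/2` lies
between the defenders, `R_i` means `l < mid`, and `R_j` means `mid < r`.

Two geometric facts link `V_ij` to the outcome. First, a path through the exterior to the perimeter
is never shorter than a straight run to some visible point followed by a walk along the perimeter
(`IsLift.exists_visibleLift_of_path`). Second, `d` has a subgradient at inner points of the visible
interval (`exists_subgradient`), so `s + d/ν` does not decrease beyond `r`, and `s - d/ν` does not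
decrease up to `l`. Hence for `V_ij ≤ 0` every possible arrival point is reached in time by one of
the defenders (`PairLift.covered`, `Covered`), while for `V_ij > 0` the straight run to `s_opt`
beats both (`PairLift.sOpt_spec`).

From a covered state the defenders win by running to the lifted foot and following it
(`defendersWin_of_covered`). That the intruder then does not win needs a separate argument, because
two nonanticipative strategies need not have a common play: against a given intruder strategy a
defender motion is built by short steps that preserve coverage, and continued by Zorn's lemma
(`not_intruderWins`). Quantitative margins in both inequalities identify the barrier. Under the
pincer, the two defenders close in on the lifted foot, and one of them meets it before the intruder
can arrive uncaught. -/

/-- The nearest point of a closed convex set. -/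
def nearest (C : Set Plane) (x : Plane) : Plane :=
  Classical.epsilon fun y => y ∈ C ∧ ∀ z ∈ C, inner ℝ (x - y) (z - y) ≤ 0

/-! ### Projection onto a closed convex set -/

section nearest

variable {C : Set Plane}

theorem nearest_spec (hC : Convex ℝ C) (hcl : IsClosed C) (hne : C.Nonempty) (x : Plane) :
    nearest C x ∈ C ∧ ∀ z ∈ C, inner ℝ (x - nearest C x) (z - nearest C x) ≤ 0 := by
  obtain ⟨v, hv, hv'⟩ := exists_norm_eq_iInf_of_complete_convex hne hcl.isComplete hC x
  exact Classical.epsilon_spec (p := fun y => y ∈ C ∧ ∀ z ∈ C, inner ℝ (x - y) (z - y) ≤ 0)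
    ⟨v, hv, (norm_eq_iInf_iff_real_inner_le_zero hC hv).1 hv'⟩

/-- Adding the two obtuse-angle inequalities gives `‖p - q‖² ≤ ⟪x - y, p - q⟫`; then Cauchy–Schwarz.
-/
theorem norm_sub_le_of_inner {x y p q : Plane} (hp : inner ℝ (x - p) (q - p) ≤ 0)
    (hq : inner ℝ (y - q) (p - q) ≤ 0) : ‖p - q‖ ≤ ‖x - y‖ := by
  have h1 : inner ℝ (x - y) (p - q) ≥ ‖p - q‖ ^ 2 := by
    rw [← real_inner_self_eq_norm_sq]
    have e1 : inner ℝ (x - p) (q - p) = - inner ℝ (x - p) (p - q) := by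
      rw [← inner_neg_right, neg_sub]
    have e2 : inner ℝ (x - y) (p - q) =
      inner ℝ (x - p) (p - q) + inner ℝ (p - q) (p - q) - inner ℝ (y - q) (p - q) := by
      rw [← inner_add_left, ← inner_sub_left]; congr 1; abel
    rw [e2]; linarith
  have h2 := real_inner_le_norm (x - y) (p - q)
  by_contra! h
  nlinarith [norm_nonneg (x - y), norm_nonneg (p - q)]

theorem nearest_lipschitz (hC : Convex ℝ C) (hcl : IsClosed C) (hne : C.Nonempty) (x y : Plane) :
    ‖nearest C x - nearest C y‖ ≤ ‖x - y‖ :=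
  norm_sub_le_of_inner ((nearest_spec hC hcl hne x).2 _ (nearest_spec hC hcl hne y).1)
    ((nearest_spec hC hcl hne y).2 _ (nearest_spec hC hcl hne x).1)

theorem continuous_nearest (hC : Convex ℝ C) (hcl : IsClosed C) (hne : C.Nonempty) :
    Continuous (nearest C) :=
  (LipschitzWith.of_dist_le_mul (K := 1) fun x y => by
    simpa [dist_eq_norm] using nearest_lipschitz hC hcl hne x y).continuous

theorem nearest_eq (hC : Convex ℝ C) (hcl : IsClosed C) {x y : Plane} (hy : y ∈ C)
    (h : ∀ z ∈ C, inner ℝ (x - y) (z - y) ≤ 0) : nearest C x = y := by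
  have hs := nearest_spec hC hcl ⟨y, hy⟩ x
  have := norm_sub_le_of_inner (hs.2 _ hy) (h _ hs.1)
  rw [sub_self, norm_zero] at this
  exact sub_eq_zero.1 (norm_le_zero_iff.1 this)

theorem nearest_self (hC : Convex ℝ C) (hcl : IsClosed C) {x : Plane} (hx : x ∈ C) :
    nearest C x = x :=
  nearest_eq hC hcl hx fun z _ => by simp

theorem nearest_mem_frontier (hC : Convex ℝ C) (hcl : IsClosed C) (hne : C.Nonempty) {x : Plane}
    (hx : x ∉ interior C) : nearest C x ∈ frontier C := by
  have hs := nearest_spec hC hcl hne x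
  rw [hcl.frontier_eq]
  refine ⟨hs.1, fun hi => ?_⟩
  have hxp : x ≠ nearest C x := fun h => hx (h ▸ hi)
  have hcont : Filter.Tendsto (fun t : ℝ => nearest C x + t • (x - nearest C x))
      (nhdsWithin 0 (Ioi 0)) (nhds (nearest C x)) := by
    have : Continuous fun t : ℝ => nearest C x + t • (x - nearest C x) := by fun_prop
    simpa using (this.tendsto 0).mono_left nhdsWithin_le_nhds
  obtain ⟨t, ht, ht0⟩ := ((hcont.eventually (isOpen_interior.mem_nhds hi)).and
    self_mem_nhdsWithin).exists
  have := hs.2 _ (interior_subset ht)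
  rw [add_sub_cancel_left, inner_smul_right, real_inner_self_eq_norm_sq] at this
  have h3 : 0 < ‖x - nearest C x‖ := norm_pos_iff.2 (sub_ne_zero.2 hxp)
  have h4 : (0 : ℝ) < t := ht0
  nlinarith [mul_pos h4 (pow_pos h3 2)]

end nearest

namespace Perimeter

variable (P : Perimeter)

/-! ### The parametrization -/

theorem isClosed_target : IsClosed P.target := P.isCompact.isClosed

theorem target_nonempty : P.target.Nonempty := P.interior_nonempty.mono interior_subset

theorem norm_γ_sub_le (s s' : ℝ) : ‖P.γ s - P.γ s'‖ ≤ |s - s'| := by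
  wlog h : s' ≤ s generalizing s s'
  · rw [norm_sub_rev, abs_sub_comm]; exact this _ _ (le_of_not_ge h)
  have h1 := P.unitSpeed (mem_univ s') (mem_univ s)
  have h2 := eVariationOn.edist_le P.γ (s := univ ∩ Icc s' s) (x := s) (y := s')
    ⟨trivial, h, le_rfl⟩ ⟨trivial, le_rfl, h⟩
  rw [h1, edist_dist, dist_eq_norm] at h2
  have := (ENNReal.ofReal_le_ofReal_iff (by simpa using h)).1 h2
  rw [abs_of_nonneg (by linarith)]
  simpa using this

theorem continuous_γ : Continuous P.γ :=
  (LipschitzWith.of_dist_le_mul (K := 1) fun x y => by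
    simpa [dist_eq_norm] using P.norm_γ_sub_le x y).continuous

theorem γ_add_int (s : ℝ) (n : ℤ) : P.γ (s + n * P.len) = P.γ s := by
  simpa using P.periodic.int_mul n s

theorem exists_add_int_mem_Ico (s e : ℝ) : ∃ n : ℤ, s + n * P.len ∈ Ico e (e + P.len) := by
  refine ⟨-toIcoDiv P.len_pos e s, ?_⟩
  have := sub_toIcoDiv_zsmul_mem_Ico P.len_pos e s
  simpa [sub_eq_add_neg] using this

theorem γ_mem_frontier (s : ℝ) : P.γ s ∈ frontier P.target := by
  obtain ⟨n, hn⟩ := P.exists_add_int_mem_Ico s 0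
  rw [zero_add] at hn
  rw [← P.γ_add_int s n]
  exact P.bijOn.mapsTo hn

theorem γ_mem_target (s : ℝ) : P.γ s ∈ P.target :=
  P.isClosed_target.frontier_subset (P.γ_mem_frontier s)

theorem γ_notMem_interior (s : ℝ) : P.γ s ∉ interior P.target :=
  (P.γ_mem_frontier s).2

theorem exists_γ_eq {y : Plane} (hy : y ∈ frontier P.target) : ∃ s, P.γ s = y := by
  obtain ⟨s, -, h⟩ := P.bijOn.surjOn hy
  exact ⟨s, h⟩

theorem mem_frontier_of {y : Plane} (h1 : y ∈ P.target) (h2 : y ∉ interior P.target) :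
    y ∈ frontier P.target := by
  rw [P.isClosed_target.frontier_eq]; exact ⟨h1, h2⟩

theorem notMem_interior_of_notMem {x : Plane} (hx : x ∉ P.target) : x ∉ interior P.target :=
  fun h => hx (interior_subset h)

theorem γ_eq_iff {s s' : ℝ} : P.γ s = P.γ s' ↔ ∃ n : ℤ, s' = s + n * P.len := by
  constructor
  · intro h
    obtain ⟨n, hn⟩ := P.exists_add_int_mem_Ico s 0
    obtain ⟨m, hm⟩ := P.exists_add_int_mem_Ico s' 0
    rw [zero_add] at hn hm
    have := P.bijOn.injOn hn hm (by rw [P.γ_add_int, P.γ_add_int, h])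
    exact ⟨n - m, by push_cast; linarith⟩
  · rintro ⟨n, rfl⟩; rw [P.γ_add_int]

theorem eq_of_γ_eq {s s' : ℝ} (h : P.γ s = P.γ s') (h' : |s - s'| < P.len) : s = s' := by
  obtain ⟨n, rfl⟩ := P.γ_eq_iff.1 h
  have hL := P.len_pos
  have h1 : |(n : ℝ)| * P.len < 1 * P.len := by
    rw [one_mul]
    calc |(n : ℝ)| * P.len = |s - (s + n * P.len)| := by
          rw [show s - (s + n * P.len) = -(n * P.len) by ring, abs_neg, abs_mul, abs_of_pos hL]
      _ < P.len := h'
  have h2 : |(n : ℝ)| < 1 := lt_of_mul_lt_mul_right h1 hL.le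
  have h3 : n = 0 := by
    have : |n| < 1 := by exact_mod_cast h2
    exact Int.abs_lt_one_iff.1 this
  simp [h3]

/-- Along a curve on the perimeter, the arc length parameter moves at most as fast as the
curve. -/
theorem abs_sub_le_of_lipschitz {g : ℝ → ℝ} {a b K : ℝ} (hab : a ≤ b)
    (hg : ContinuousOn g (Icc a b))
    (hK : ∀ t ∈ Icc a b, ∀ t' ∈ Icc a b, ‖P.γ (g t) - P.γ (g t')‖ ≤ K * |t - t'|) :
    |g b - g a| ≤ K * (b - a) := by
  wlog hgab : g a ≤ g b generalizing g a b
  · have h := this (g := fun t => g (-t)) (a := -b) (b := -a) (by linarith)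
      (hg.comp continuous_neg.continuousOn fun t ht => ⟨by linarith [ht.2], by linarith [ht.1]⟩)
      (fun t ht t' ht' => by
        have := hK (-t) ⟨by linarith [ht.2], by linarith [ht.1]⟩ (-t')
          ⟨by linarith [ht'.2], by linarith [ht'.1]⟩
        rwa [show -t - -t' = -(t - t') by ring, abs_neg] at this)
      (by simpa using (le_of_not_ge hgab))
    simp only [neg_neg] at h
    rw [abs_sub_comm]; linarith
  rcases hab.eq_or_lt with rfl | hab'
  · simp
  have hK0 : 0 ≤ K := by
    have := (norm_nonneg _).trans (hK a ⟨le_rfl, hab⟩ b ⟨hab, le_rfl⟩)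
    rw [abs_sub_comm, abs_of_pos (by linarith)] at this
    exact nonneg_of_mul_nonneg_left this (by linarith)
  let S : ℝ → Set ℝ := fun v => {t | t ∈ Icc a b ∧ v ≤ g t}
  -- `φ v` is the first time at which `g` reaches the level `v`. It is a monotone right inverse of
  -- `g`, so on `[g a, g b]` the curve `γ` equals `(γ ∘ g) ∘ φ`. Its variation is `g b - g a` by
  -- unit speed, and at most the variation of `γ ∘ g`, which is at most `K (b - a)`.
  let φ : ℝ → ℝ := fun v => sInf (S v)
  have hcl : ∀ v, IsClosed (S v) := fun v => by
    have : S v = Icc a b ∩ g ⁻¹' Ici v := by ext; simp [S]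
    rw [this]; exact hg.preimage_isClosed_of_isClosed isClosed_Icc isClosed_Ici
  have hbdd : ∀ v, BddBelow (S v) := fun v => ⟨a, fun t ht => ht.1.1⟩
  have hne : ∀ v ∈ Icc (g a) (g b), (S v).Nonempty := fun v hv => ⟨b, ⟨hab, le_rfl⟩, hv.2⟩
  have hmem : ∀ v ∈ Icc (g a) (g b), φ v ∈ S v := fun v hv =>
    (hcl v).csInf_mem (hne v hv) (hbdd v)
  have hgφ : ∀ v ∈ Icc (g a) (g b), g (φ v) = v := by
    intro v hv
    refine le_antisymm ?_ (hmem v hv).2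
    by_contra! hlt
    have hsub : Icc a (φ v) ⊆ Icc a b := Icc_subset_Icc le_rfl (hmem v hv).1.2
    obtain ⟨t, ht, hgt⟩ := intermediate_value_Icc (hmem v hv).1.1 (hg.mono hsub) ⟨hv.1, hlt.le⟩
    have h1 : φ v ≤ t := csInf_le (hbdd v) ⟨hsub ht, hgt.ge⟩
    have h2 : t = φ v := le_antisymm ht.2 h1
    rw [h2] at hgt; linarith
  have hmono : MonotoneOn φ (Icc (g a) (g b)) := fun v hv w hw hvw =>
    csInf_le_csInf (hbdd v) (hne w hw) fun t ht => ⟨ht.1, hvw.trans ht.2⟩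
  have h1 : eVariationOn P.γ (Icc (g a) (g b)) = ENNReal.ofReal (g b - g a) := by
    have := P.unitSpeed (mem_univ (g a)) (mem_univ (g b))
    simpa using this
  have h2 : eVariationOn P.γ (Icc (g a) (g b)) = eVariationOn ((P.γ ∘ g) ∘ φ) (Icc (g a) (g b)) :=
    eVariationOn.congr fun v hv => by simp [hgφ v hv]
  have h3 := eVariationOn.comp_le_of_monotoneOn (P.γ ∘ g) (s := Icc a b) φ hmono
    fun v hv => (hmem v hv).1
  have hL : LipschitzOnWith K.toNNReal (P.γ ∘ g) (Icc a b) :=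
    LipschitzOnWith.of_dist_le_mul fun t ht t' ht' => by
      rw [dist_eq_norm, Real.dist_eq, Real.coe_toNNReal _ hK0]; exact hK t ht t' ht'
  have h4 := hL.comp_eVariationOn_le (g := id) (s := Icc a b) (mapsTo_id _)
  have h5 : eVariationOn (id : ℝ → ℝ) (Icc a b) ≤ ENNReal.ofReal (b - a) := by simp
  rw [← h2, h1] at h3
  have h6 : ENNReal.ofReal (g b - g a) ≤ ENNReal.ofReal (K * (b - a)) := by
    rw [ENNReal.ofReal_mul hK0]
    exact h3.trans (h4.trans (by gcongr; exact le_rfl))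
  rw [abs_of_nonneg (by linarith)]
  exact (ENNReal.ofReal_le_ofReal_iff (mul_nonneg hK0 (by linarith))).1 h6

/-! ### The nearest point of the target and its lift to the line -/

/-- The nearest point of the target. -/
def foot (x : Plane) : Plane := nearest P.target x

theorem foot_mem (x : Plane) : P.foot x ∈ P.target :=
  (nearest_spec P.convex P.isClosed_target P.target_nonempty x).1

theorem inner_foot_le (x : Plane) {z : Plane} (hz : z ∈ P.target) :
    inner ℝ (x - P.foot x) (z - P.foot x) ≤ 0 :=
  (nearest_spec P.convex P.isClosed_target P.target_nonempty x).2 z hz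

theorem norm_foot_sub_le (x y : Plane) : ‖P.foot x - P.foot y‖ ≤ ‖x - y‖ :=
  nearest_lipschitz P.convex P.isClosed_target P.target_nonempty x y

theorem continuous_foot : Continuous P.foot :=
  continuous_nearest P.convex P.isClosed_target P.target_nonempty

theorem foot_eq_self {x : Plane} (hx : x ∈ P.target) : P.foot x = x :=
  nearest_self P.convex P.isClosed_target hx

@[simp] theorem foot_γ (s : ℝ) : P.foot (P.γ s) = P.γ s := P.foot_eq_self (P.γ_mem_target s)

theorem foot_mem_frontier {x : Plane} (hx : x ∉ interior P.target) :
    P.foot x ∈ frontier P.target :=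
  nearest_mem_frontier P.convex P.isClosed_target P.target_nonempty hx

theorem exists_γ_eq_foot {x : Plane} (hx : x ∉ interior P.target) : ∃ σ, P.γ σ = P.foot x :=
  P.exists_γ_eq (P.foot_mem_frontier hx)

/-- Maps of simply connected spaces into the exterior of the target lift to the line. -/
theorem exists_lift {A : Type*} [TopologicalSpace A] [SimplyConnectedSpace A]
    [LocallyPathConnectedSpace A] {h : A → Plane} (hc : Continuous h)
    (hX : ∀ a, h a ∉ interior P.target) (a₀ : A) {σ : ℝ} (hσ : P.γ σ = P.foot (h a₀)) :
    ∃ g : A → ℝ, Continuous g ∧ g a₀ = σ ∧ ∀ a, P.γ (g a) = P.foot (h a) := by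
  have : Fact (0 < P.len) := ⟨P.len_pos⟩
  -- `γ` descends to a continuous injection of the compact circle, hence to an embedding. The foot
  -- therefore gives a continuous map into the circle, which lifts through the covering `ℝ →
  -- AddCircle`.
  let Γ : AddCircle P.len → Plane := P.periodic.lift
  have hΓ : ∀ s : ℝ, Γ (s : AddCircle P.len) = P.γ s := fun s => P.periodic.lift_coe s
  have hΓc : Continuous Γ := by
    refine continuous_quot_lift _ P.continuous_γ
  have hinj : Function.Injective Γ := by
    intro u v
    induction u using QuotientAddGroup.induction_on with | H s => ?_
    induction v using QuotientAddGroup.induction_on with | H s' => ?_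
    intro huv
    have huv' : P.γ s = P.γ s' := by rw [← hΓ, ← hΓ]; exact huv
    obtain ⟨n, rfl⟩ := P.γ_eq_iff.1 huv'
    have : (n : ℝ) * P.len = n • P.len := by simp
    change (s : AddCircle P.len) = ((s + n * P.len : ℝ) : AddCircle P.len)
    rw [this]
    simp
  have hemb := (hΓc.isClosedEmbedding hinj).isEmbedding
  have hex : ∀ a, ∃ u, Γ u = P.foot (h a) := fun a => by
    obtain ⟨s, hs⟩ := P.exists_γ_eq_foot (hX a)
    exact ⟨s, by rw [hΓ, hs]⟩
  choose κ hκ using hex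
  have hκc : Continuous κ := by
    rw [hemb.continuous_iff]
    have : Γ ∘ κ = fun a => P.foot (h a) := funext hκ
    rw [this]; exact P.continuous_foot.comp hc
  obtain ⟨F, ⟨hF0, hF⟩, -⟩ := (AddCircle.isCoveringMap_coe P.len).existsUnique_continuousMap_lifts
    ⟨κ, hκc⟩ a₀ σ (hinj (show Γ σ = Γ (κ a₀) by rw [hΓ, hκ, hσ]))
  refine ⟨F, F.continuous, hF0, fun a => ?_⟩
  rw [← hΓ, ← hκ a]
  exact congrArg Γ (congrFun hF a)

/-- Two lifts of the same path differ pointwise by a multiple of the perimeter length. If they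
agreed at one point and differed at another, the difference would take a value strictly between `0`
and `len` in absolute value on the connected set. -/
theorem lift_unique {A : Type*} [TopologicalSpace A] {S : Set A} (hS : IsPreconnected S)
    {g g' : A → ℝ} (hg : ContinuousOn g S) (hg' : ContinuousOn g' S)
    (h : ∀ a ∈ S, P.γ (g a) = P.γ (g' a)) {a₀ : A} (ha₀ : a₀ ∈ S) (h₀ : g a₀ = g' a₀) :
    EqOn g g' S := by
  intro a ha
  by_contra hne
  have hc : ContinuousOn (fun a => |g a - g' a|) S := (hg.sub hg').abs
  have hconn := (hS.image _ hc).ordConnected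
  have h0 : (0 : ℝ) ∈ (fun a => |g a - g' a|) '' S := ⟨a₀, ha₀, by simp [h₀]⟩
  have h1 : |g a - g' a| ∈ (fun a => |g a - g' a|) '' S := ⟨a, ha, rfl⟩
  have hpos : 0 < |g a - g' a| := abs_pos.2 (sub_ne_zero.2 hne)
  have hL := P.len_pos
  obtain ⟨b, hb, hb'⟩ := hconn.out h0 h1
    (show min (|g a - g' a|) (P.len / 2) ∈ Icc 0 (|g a - g' a|) from
      ⟨le_min hpos.le (by linarith), min_le_left _ _⟩)
  have h2 : g b = g' b := P.eq_of_γ_eq (h b hb) (by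
    have : |g b - g' b| ≤ P.len / 2 := hb'.le.trans (min_le_right _ _)
    linarith)
  have h3 : (0 : ℝ) < min (|g a - g' a|) (P.len / 2) := lt_min hpos (by linarith)
  have h4 : |g b - g' b| = min (|g a - g' a|) (P.len / 2) := hb'
  rw [h2, sub_self, abs_zero] at h4
  linarith

end Perimeter
end

noncomputable section

namespace Perimeter

/-! ### Lifted paths of nearest points -/

variable (P : Perimeter)

/-- `g` is a lift to the line of the path of the nearest points of `y` on `[0, t]`. -/
def IsLift (y : ℝ → Plane) (t : ℝ) (g : ℝ → ℝ) : Prop :=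
  ContinuousOn g (Icc 0 t) ∧ ∀ τ ∈ Icc 0 t, P.γ (g τ) = P.foot (y τ)

variable {P}

theorem exists_isLift {y : ℝ → Plane} {t σ : ℝ} (ht : 0 ≤ t) (hy : ContinuousOn y (Icc 0 t))
    (hX : ∀ τ ∈ Icc 0 t, y τ ∉ interior P.target) (hσ : P.γ σ = P.foot (y 0)) :
    ∃ g, P.IsLift y t g ∧ g 0 = σ := by
  obtain ⟨g, hgc, hg0, hg⟩ := P.exists_lift (A := ℝ) (h := IccExtend ht (domRestrict (Icc 0 t) y))
    (hy.domRestrict.Icc_extend') (fun a => hX _ (projIcc 0 t ht a).2) 0 (σ := σ)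
    (by rw [IccExtend_of_mem ht _ ⟨le_rfl, ht⟩]; exact hσ)
  refine ⟨g, ⟨hgc.continuousOn, fun τ hτ => ?_⟩, hg0⟩
  rw [hg, IccExtend_of_mem ht _ hτ]; rfl

theorem IsLift.eqOn {y : ℝ → Plane} {t : ℝ} {g g' : ℝ → ℝ} (h : P.IsLift y t g)
    (h' : P.IsLift y t g') (ht : 0 ≤ t) (h0 : g 0 = g' 0) : EqOn g g' (Icc 0 t) :=
  P.lift_unique isPreconnected_Icc h.1 h'.1 (fun τ hτ => by rw [h.2 τ hτ, h'.2 τ hτ])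
    ⟨le_rfl, ht⟩ h0

theorem IsLift.mono {y : ℝ → Plane} {t t' : ℝ} {g : ℝ → ℝ} (h : P.IsLift y t g) (ht : t' ≤ t) :
    P.IsLift y t' g :=
  ⟨h.1.mono (Icc_subset_Icc le_rfl ht), fun τ hτ => h.2 τ ⟨hτ.1, hτ.2.trans ht⟩⟩

theorem IsLift.congr {y y' : ℝ → Plane} {t : ℝ} {g : ℝ → ℝ} (h : P.IsLift y t g)
    (hy : EqOn y y' (Icc 0 t)) : P.IsLift y' t g :=
  ⟨h.1, fun τ hτ => by rw [h.2 τ hτ, hy hτ]⟩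

/-- The foot is 1-Lipschitz, so `γ ∘ g` is as slow as `y`, and on the perimeter arc length is no
faster than the curve itself. -/
theorem IsLift.abs_sub_le {y : ℝ → Plane} {t K : ℝ} {g : ℝ → ℝ} (h : P.IsLift y t g)
    (hK : ∀ a ∈ Icc 0 t, ∀ b ∈ Icc 0 t, ‖y a - y b‖ ≤ K * |a - b|) {a b : ℝ} (ha : a ∈ Icc 0 t)
    (hb : b ∈ Icc 0 t) : |g a - g b| ≤ K * |a - b| := by
  wlog hab : b ≤ a generalizing a b
  · rw [abs_sub_comm, abs_sub_comm a b]; exact this hb ha (le_of_not_ge hab)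
  have hsub : Icc b a ⊆ Icc 0 t := Icc_subset_Icc hb.1 ha.2
  rw [abs_of_nonneg (sub_nonneg.2 hab)]
  refine P.abs_sub_le_of_lipschitz hab (h.1.mono hsub) fun τ hτ τ' hτ' => ?_
  rw [h.2 _ (hsub hτ), h.2 _ (hsub hτ')]
  exact (P.norm_foot_sub_le _ _).trans (hK _ (hsub hτ) _ (hsub hτ'))

theorem norm_lineMap_sub_lineMap (x z : Plane) (a b : ℝ) :
    ‖AffineMap.lineMap x z a - AffineMap.lineMap x z b‖ = ‖x - z‖ * |a - b| := by
  rw [← dist_eq_norm, dist_lineMap_lineMap, Real.dist_eq, mul_comm, dist_eq_norm]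

theorem continuous_lineMap_right (x z : Plane) :
    Continuous fun u : ℝ => (AffineMap.lineMap x z u : Plane) :=
  AffineMap.lineMap_continuous

theorem IsLift.abs_sub_le_segment {x z : Plane} {g : ℝ → ℝ}
    (h : P.IsLift (fun u => AffineMap.lineMap x z u) 1 g) {a b : ℝ} (ha : a ∈ Icc (0 : ℝ) 1)
    (hb : b ∈ Icc (0 : ℝ) 1) : |g a - g b| ≤ ‖x - z‖ * |a - b| :=
  h.abs_sub_le (fun a _ b _ => (norm_lineMap_sub_lineMap x z a b).le) ha hb

/-! ### The visible part of the perimeter -/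

theorem notMem_of_mem_visible {x : Plane} {s : ℝ} (h : s ∈ P.visible x) : x ∉ P.target := by
  simpa using h 0 ⟨le_rfl, one_pos⟩

theorem visible_congr {x : Plane} {s s' : ℝ} (h : P.γ s = P.γ s') :
    s ∈ P.visible x ↔ s' ∈ P.visible x := by
  simp only [visible, mem_ofPred_eq, h]

theorem notMem_interior_of_visible {x : Plane} {s : ℝ} (h : s ∈ P.visible x) {u : ℝ}
    (hu : u ∈ Icc (0 : ℝ) 1) : (AffineMap.lineMap x (P.γ s) u : Plane) ∉ interior P.target := by
  rcases hu.2.eq_or_lt with rfl | h1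
  · simpa using P.γ_notMem_interior s
  · exact P.notMem_interior_of_notMem (h u ⟨hu.1, h1⟩)

/-- Let `z` be the point of the sight segment and `p` its foot. If the view of `p` were blocked,
then `⟪z - p, x - p⟫ ≤ 0`. Also `⟪z - p, γ s - p⟫ ≤ 0`, and `z` is a convex combination of `x` and
`γ s`, so `z = p`. Thus `z` lies in the target, `z = γ s`, and `γ s` is visible. -/
theorem visible_of_foot {x : Plane} {s s' u : ℝ} (h : s ∈ P.visible x) (hu : u ∈ Icc (0 : ℝ) 1)
    (h' : P.γ s' = P.foot (AffineMap.lineMap x (P.γ s) u)) : s' ∈ P.visible x := by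
  intro v hv hw
  set z : Plane := AffineMap.lineMap x (P.γ s) u with hz
  have h1 := P.inner_foot_le z hw
  have h2 := P.inner_foot_le z (P.γ_mem_target s)
  rw [h'] at h1
  set p := P.foot z
  have e1 : (AffineMap.lineMap x p v : Plane) - p = (1 - v) • (x - p) := by
    rw [AffineMap.lineMap_apply_module]; module
  rw [e1, inner_smul_right] at h1
  have h3 : inner ℝ (z - p) (x - p) ≤ 0 := by
    by_contra! hc
    exact absurd h1 (not_le.2 (mul_pos (by linarith [hv.2]) hc))
  have e2 : z - p = (1 - u) • (x - p) + u • (P.γ s - p) := by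
    rw [hz, AffineMap.lineMap_apply_module]; module
  have h4 : inner ℝ (z - p) (z - p) ≤ 0 := by
    have e3 : inner ℝ (z - p) (z - p) =
        (1 - u) * inner ℝ (z - p) (x - p) + u * inner ℝ (z - p) (P.γ s - p) := by
      rw [← inner_smul_right, ← inner_smul_right, ← inner_add_right, ← e2]
    rw [e3]
    nlinarith [mul_nonneg (sub_nonneg.2 hu.2) (neg_nonneg.2 h3), mul_nonneg hu.1 (neg_nonneg.2 h2)]
  have h5 : z = p := sub_eq_zero.1 (inner_self_eq_zero.1 (le_antisymm h4 real_inner_self_nonneg))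
  have hzT : z ∈ P.target := h5 ▸ P.foot_mem z
  have hu1 : u = 1 := by
    by_contra hne
    exact h u ⟨hu.1, lt_of_le_of_ne hu.2 hne⟩ hzT
  have : p = P.γ s := by rw [← h5, hz, hu1, AffineMap.lineMap_apply_one]
  rw [h', this] at hw
  exact h v hv hw

theorem visible_foot {x : Plane} (hx : x ∉ P.target) {σ : ℝ} (hσ : P.γ σ = P.foot x) :
    σ ∈ P.visible x := by
  intro v hv hw
  have h1 := P.inner_foot_le x hw
  rw [hσ] at h1
  have e1 : (AffineMap.lineMap x (P.foot x) v : Plane) - P.foot x = (1 - v) • (x - P.foot x) := by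
    rw [AffineMap.lineMap_apply_module]; module
  rw [e1, inner_smul_right, real_inner_self_eq_norm_sq] at h1
  have h2 : 0 < ‖x - P.foot x‖ :=
    norm_pos_iff.2 (sub_ne_zero.2 fun h => hx (h ▸ P.foot_mem x))
  have := mul_pos (show 0 < 1 - v by linarith [hv.2]) (pow_pos h2 2)
  linarith

/-- The ray from `x` through an interior point `o` leaves the target for the last time at a
perimeter point beyond `o`, and `o` hides it. -/
theorem exists_notMem_visible {x : Plane} (hx : x ∉ P.target) : ∃ e, e ∉ P.visible x := by
  obtain ⟨o, ho⟩ := P.interior_nonempty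
  have hxo : 0 < ‖x - o‖ := norm_pos_iff.2 (sub_ne_zero.2 fun h => hx (h ▸ interior_subset ho))
  let f : ℝ → Plane := fun u => AffineMap.lineMap x o u
  have hf : Continuous f := continuous_lineMap_right x o
  let K : Set ℝ := {u | 1 ≤ u ∧ f u ∈ P.target}
  have hK1 : (1 : ℝ) ∈ K := ⟨le_rfl, by simpa [f] using interior_subset ho⟩
  have hKc : IsClosed K := isClosed_Ici.inter (P.isClosed_target.preimage hf)
  have hKb : BddAbove K := by
    obtain ⟨R, hR⟩ := P.isCompact.isBounded.subset_closedBall x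
    refine ⟨R / ‖x - o‖, fun u hu => ?_⟩
    have h1 := hR hu.2
    rw [Metric.mem_closedBall, dist_eq_norm] at h1
    have h2 := norm_lineMap_sub_lineMap x o u 0
    rw [AffineMap.lineMap_apply_zero, sub_zero, abs_of_nonneg (by linarith [hu.1])] at h2
    rw [le_div_iff₀ hxo, mul_comm, ← h2]; exact h1
  set u₁ := sSup K
  have hu₁ : u₁ ∈ K := hKc.csSup_mem ⟨1, hK1⟩ hKb
  have hnot : ∀ u, 1 ≤ u → u₁ < u → f u ∉ P.target := fun u h1 h2 h3 =>
    absurd (le_csSup hKb (show u ∈ K from ⟨h1, h3⟩)) (not_le.2 h2)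
  have hint : f u₁ ∉ interior P.target := fun hi => by
    have h1 := (hf.tendsto u₁).eventually (isOpen_interior.mem_nhds hi)
    obtain ⟨u, hu, hu'⟩ := ((h1.filter_mono nhdsWithin_le_nhds).and
      (self_mem_nhdsWithin : Ioi u₁ ∈ nhdsWithin u₁ (Ioi u₁))).exists
    exact hnot u (hu₁.1.trans (le_of_lt hu')) hu' (interior_subset hu)
  have hlt : 1 < u₁ := by
    refine lt_of_le_of_ne hu₁.1 fun h => hint ?_
    rw [← h]; simpa [f] using ho
  obtain ⟨e, he⟩ := P.exists_γ_eq (P.mem_frontier_of hu₁.2 hint)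
  refine ⟨e, fun hv => hv (1 / u₁) ⟨by positivity, by rw [div_lt_one (by linarith)]; exact hlt⟩ ?_⟩
  have : (AffineMap.lineMap x (P.γ e) (1 / u₁) : Plane) = o := by
    rw [he]; simp only [f, AffineMap.lineMap_apply_module]
    have : u₁ ≠ 0 := by linarith
    rw [smul_add, smul_smul, smul_smul]
    rw [one_div_mul_cancel this, one_smul, ← add_assoc, ← add_smul]
    rw [show 1 - 1 / u₁ + 1 / u₁ * (1 - u₁) = 0 by field_simp; ring, zero_smul, zero_add]
  rw [this]; exact interior_subset ho

variable (P)

/-- The lift of the visible part of the perimeter that contains the lift `σ` of the nearest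
point. -/
def visibleLift (x : Plane) (σ : ℝ) : Set ℝ := {s | uIcc σ s ⊆ P.visible x}

variable {P}

theorem mem_visible_of_lift {x : Plane} {σ s : ℝ} (h : s ∈ P.visibleLift x σ) :
    s ∈ P.visible x := h right_mem_uIcc

theorem uIcc_subset_visibleLift {x : Plane} {σ s s' : ℝ} (h : s ∈ P.visibleLift x σ)
    (h' : s' ∈ P.visibleLift x σ) : uIcc s s' ⊆ P.visibleLift x σ := by
  intro r hr a ha
  have : a ∈ uIcc σ s ∨ a ∈ uIcc σ s' := by
    simp only [mem_uIcc] at hr ha ⊢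
    grind
  exact this.elim (fun h1 => h h1) fun h1 => h' h1

/-- An interval of length at least `len` contains a lift of every perimeter point, in particular of
an invisible one. -/
theorem abs_sub_lt_of_visibleLift {x : Plane} {σ s s' : ℝ} (h : s ∈ P.visibleLift x σ)
    (h' : s' ∈ P.visibleLift x σ) : |s - s'| < P.len := by
  by_contra! hc
  obtain ⟨e, he⟩ := exists_notMem_visible (notMem_of_mem_visible (mem_visible_of_lift h))
  obtain ⟨n, hn⟩ := P.exists_add_int_mem_Ico e (min s s')
  refine he ((visible_congr (P.γ_add_int e n)).1
    (mem_visible_of_lift (uIcc_subset_visibleLift h h' ?_)))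
  refine ⟨hn.1, hn.2.le.trans ?_⟩
  rcases le_total s s' with hle | hle
  · rw [abs_of_nonpos (by linarith)] at hc; simp [hle]; linarith
  · rw [abs_of_nonneg (by linarith)] at hc; simp [hle]; linarith

theorem self_mem_visibleLift {x : Plane} (hx : x ∉ P.target) {σ : ℝ} (hσ : P.γ σ = P.foot x) :
    σ ∈ P.visibleLift x σ := by
  simpa [visibleLift] using visible_foot hx hσ

/-- By the intermediate value theorem every point between `g 0` and `g 1` is the foot of some point
of the sight segment, and such feet are visible. -/
theorem IsLift.mem_visibleLift {x : Plane} {s : ℝ} {g : ℝ → ℝ} (hs : s ∈ P.visible x)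
    (h : P.IsLift (fun u => AffineMap.lineMap x (P.γ s) u) 1 g) : g 1 ∈ P.visibleLift x (g 0) := by
  intro r hr
  have hc : ContinuousOn g (uIcc 0 1) := by rw [uIcc_of_le zero_le_one]; exact h.1
  obtain ⟨u, hu, rfl⟩ := intermediate_value_uIcc hc hr
  rw [uIcc_of_le zero_le_one] at hu
  exact visible_of_foot hs hu (h.2 u hu)

theorem exists_straightLift {x : Plane} {s σ : ℝ} (hs : s ∈ P.visible x)
    (hσ : P.γ σ = P.foot x) :
    ∃ g, P.IsLift (fun u => AffineMap.lineMap x (P.γ s) u) 1 g ∧ g 0 = σ :=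
  exists_isLift zero_le_one (continuous_lineMap_right _ _).continuousOn
    (fun _ hτ => notMem_interior_of_visible hs hτ) (by simpa using hσ)

/-- The visible part of the perimeter is thus a single arc around the foot, and `visibleLift` is a
lift of all of it. -/
theorem exists_add_int_mem_visibleLift {x : Plane} {s σ : ℝ} (hs : s ∈ P.visible x)
    (hσ : P.γ σ = P.foot x) : ∃ n : ℤ, s + n * P.len ∈ P.visibleLift x σ := by
  obtain ⟨g, hg, rfl⟩ := exists_straightLift hs hσ
  have h1 := hg.2 1 ⟨zero_le_one, le_rfl⟩
  simp only [AffineMap.lineMap_apply_one, foot_γ] at h1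
  obtain ⟨n, hn⟩ := P.γ_eq_iff.1 h1.symm
  exact ⟨n, hn ▸ hg.mem_visibleLift hs⟩

theorem exists_straightLift_of_visibleLift {x : Plane} {s σ : ℝ} (hs : s ∈ P.visibleLift x σ)
    (hσ : P.γ σ = P.foot x) :
    ∃ g, P.IsLift (fun u => AffineMap.lineMap x (P.γ s) u) 1 g ∧ g 0 = σ ∧ g 1 = s := by
  obtain ⟨g, hg, rfl⟩ := exists_straightLift (mem_visible_of_lift hs) hσ
  refine ⟨g, hg, rfl, ?_⟩
  have h1 := hg.2 1 ⟨zero_le_one, le_rfl⟩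
  simp only [AffineMap.lineMap_apply_one, foot_γ] at h1
  exact P.eq_of_γ_eq h1 (abs_sub_lt_of_visibleLift
    (hg.mem_visibleLift (mem_visible_of_lift hs)) hs)

/-- A straight segment in the exterior that meets the target is at least as long as the straight
run to a visible point, followed by the perimeter. -/
theorem IsLift.exists_visibleLift {x z : Plane} {g : ℝ → ℝ} (hx : x ∉ P.target)
    (h : P.IsLift (fun u => AffineMap.lineMap x z u) 1 g)
    (hT : ∃ u ∈ Icc (0 : ℝ) 1, (AffineMap.lineMap x z u : Plane) ∈ P.target) :
    ∃ s ∈ P.visibleLift x (g 0), |g 1 - s| + ‖x - P.γ s‖ ≤ ‖x - z‖ := by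
  -- The first point of the segment in the target is visible from `x`; on the rest of the segment
  -- the lift moves by at most the remaining length.
  let S : Set ℝ := {u | u ∈ Icc (0 : ℝ) 1 ∧ (AffineMap.lineMap x z u : Plane) ∈ P.target}
  have hScl : IsClosed S :=
    isClosed_Icc.inter (P.isClosed_target.preimage (continuous_lineMap_right x z))
  have hSb : BddBelow S := ⟨0, fun u hu => hu.1.1⟩
  set u₀ := sInf S
  have hu₀ : u₀ ∈ S := hScl.csInf_mem (by obtain ⟨u, hu, hu'⟩ := hT; exact ⟨u, hu, hu'⟩) hSb
  have hγ : P.γ (g u₀) = AffineMap.lineMap x z u₀ := by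
    rw [h.2 _ hu₀.1, P.foot_eq_self hu₀.2]
  have hline : ∀ t : ℝ, (AffineMap.lineMap x (P.γ (g u₀)) t : Plane) =
      AffineMap.lineMap x z (u₀ * t) := fun t => by
    rw [hγ]; simp only [AffineMap.lineMap_apply_module]; module
  have hvis : g u₀ ∈ P.visible x := by
    intro t ht hmem
    rw [hline] at hmem
    have hu0 : 0 < u₀ := by
      rcases hu₀.1.1.eq_or_lt with h0 | h0
      · rw [← h0, zero_mul, AffineMap.lineMap_apply_zero] at hmem; exact absurd hmem hx
      · exact h0
    have h1 : u₀ ≤ u₀ * t := csInf_le hSb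
      ⟨⟨mul_nonneg hu0.le ht.1, by nlinarith [ht.2, hu₀.1.2]⟩, hmem⟩
    nlinarith [ht.2]
  refine ⟨g u₀, ?_, ?_⟩
  · have hl : P.IsLift (fun u => AffineMap.lineMap x (P.γ (g u₀)) u) 1 (fun t => g (u₀ * t)) := by
      have hmaps : MapsTo (fun t => u₀ * t) (Icc (0 : ℝ) 1) (Icc (0 : ℝ) 1) := fun t ht =>
        ⟨mul_nonneg hu₀.1.1 ht.1, by nlinarith [ht.1, ht.2, hu₀.1.1, hu₀.1.2]⟩
      refine ⟨h.1.comp (by fun_prop) hmaps, fun t ht => ?_⟩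
      simp only [hline]
      exact h.2 _ (hmaps ht)
    simpa using hl.mem_visibleLift hvis
  · have h1 := h.abs_sub_le_segment (a := 1) (b := u₀) (by simp) hu₀.1
    have h2 := norm_lineMap_sub_lineMap x z 0 u₀
    rw [AffineMap.lineMap_apply_zero, ← hγ] at h2
    rw [h2]
    rw [abs_of_nonneg (sub_nonneg.2 hu₀.1.2)] at h1
    rw [zero_sub, abs_neg, abs_of_nonneg hu₀.1.1]
    linarith

/-- Sweeping a family of straight segments from `x` through the exterior. -/
theorem IsLift.sweep {x : Plane} {y : ℝ → Plane} {t : ℝ} {gy g₀ : ℝ → ℝ} (ht : 0 ≤ t)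
    (hy : ContinuousOn y (Icc 0 t)) (h : P.IsLift y t gy)
    (hX : ∀ τ ∈ Icc 0 t, ∀ u ∈ Icc (0 : ℝ) 1,
      (AffineMap.lineMap x (y τ) u : Plane) ∉ interior P.target)
    (h₀ : P.IsLift (fun u => AffineMap.lineMap x (y 0) u) 1 g₀) (h₁ : g₀ 1 = gy 0) :
    ∃ g, P.IsLift (fun u => AffineMap.lineMap x (y t) u) 1 g ∧ g 0 = g₀ 0 ∧ g 1 = gy t := by
  let Y : ℝ → Plane := IccExtend ht (domRestrict (Icc 0 t) y)
  have hYc : Continuous Y := hy.domRestrict.Icc_extend'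
  have hY : ∀ τ ∈ Icc 0 t, Y τ = y τ := fun τ hτ => IccExtend_of_mem ht _ hτ
  let U : ℝ → ℝ := fun u => projIcc (0 : ℝ) 1 zero_le_one u
  have hUc : Continuous U := continuous_subtype_val.comp continuous_projIcc
  have hU : ∀ u ∈ Icc (0 : ℝ) 1, U u = u := fun u hu => by simp [U, projIcc_of_mem _ hu]
  have hF : Continuous fun p : ℝ × ℝ => (AffineMap.lineMap x (Y p.1) (U p.2) : Plane) := by
    simp only [AffineMap.lineMap_apply_module]; fun_prop
  have hz : (0 : ℝ) ∈ Icc (0 : ℝ) 1 := ⟨le_rfl, zero_le_one⟩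
  have ho : (1 : ℝ) ∈ Icc (0 : ℝ) 1 := ⟨zero_le_one, le_rfl⟩
  have h0t : (0 : ℝ) ∈ Icc 0 t := ⟨le_rfl, ht⟩
  have htt : t ∈ Icc 0 t := ⟨ht, le_rfl⟩
  have hg0 := h₀.2 0 hz
  simp only [AffineMap.lineMap_apply_zero] at hg0
  obtain ⟨G, hGc, hG0, hG⟩ := P.exists_lift hF
    (fun p => hX _ (projIcc 0 t ht p.1).2 _ (projIcc (0 : ℝ) 1 zero_le_one p.2).2)
    ((0, 0) : ℝ × ℝ) (σ := g₀ 0) (by simp [hU 0 hz, hg0])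
  have hcont1 : ∀ τ, Continuous fun u => G (τ, u) := fun τ => by fun_prop
  have hcont2 : ∀ u, Continuous fun τ => G (τ, u) := fun u => by fun_prop
  have hst : ∀ τ ∈ Icc 0 t, P.IsLift (fun u => AffineMap.lineMap x (y τ) u) 1
      fun u => G (τ, u) := fun τ hτ =>
    ⟨(hcont1 τ).continuousOn, fun u hu => by rw [hG]; simp only [hY τ hτ, hU u hu]⟩
  have e1 : G (0, 1) = gy 0 := by
    rw [← h₁]; exact (hst 0 h0t).eqOn h₀ zero_le_one hG0 ho
  have e2 : G (t, 1) = gy t := by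
    have hl : P.IsLift y t fun τ => G (τ, 1) :=
      ⟨(hcont2 1).continuousOn, fun τ hτ => by rw [hG]; simp [hY τ hτ, hU 1 ho]⟩
    exact hl.eqOn h ht e1 htt
  have e3 : G (t, 0) = g₀ 0 := by
    refine P.lift_unique (S := Icc 0 t) isPreconnected_Icc (hcont2 0).continuousOn
      (g' := fun _ => g₀ 0) continuousOn_const (fun τ _ => ?_) h0t hG0 htt
    rw [hG, hg0]; simp [hU 0 hz]
  exact ⟨fun u => G (t, u), hst t htt, e3, e2⟩

end Perimeter
end

noncomputable section

namespace Perimeter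

/-! ### Shortest ways to the perimeter and existence of maximizers -/

variable {P : Perimeter}

theorem notMem_interior_of_limit {x : Plane} {y : ℝ → Plane} {t : ℝ} (ht : 0 < t)
    (hy : ContinuousOn y (Icc 0 t)) {u : ℝ}
    (h : ∀ τ ∈ Ico 0 t, (AffineMap.lineMap x (y τ) u : Plane) ∉ interior P.target) :
    (AffineMap.lineMap x (y t) u : Plane) ∉ interior P.target := by
  intro hi
  have hc : ContinuousOn (fun τ => (AffineMap.lineMap x (y τ) u : Plane)) (Icc 0 t) := by
    simp only [AffineMap.lineMap_apply_module]; fun_prop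
  have h1 : Filter.Tendsto (fun τ => (AffineMap.lineMap x (y τ) u : Plane))
      (nhdsWithin t (Ico 0 t)) (nhds (AffineMap.lineMap x (y t) u)) :=
    (hc t ⟨ht.le, le_rfl⟩).mono_left (nhdsWithin_mono _ Ico_subset_Icc_self)
  have h2 : (nhdsWithin t (Ico 0 t)).NeBot := by
    rw [← mem_closure_iff_nhdsWithin_neBot, closure_Ico ht.ne]
    exact ⟨ht.le, le_rfl⟩
  obtain ⟨τ, hτ, hτ'⟩ := ((h1.eventually (isOpen_interior.mem_nhds hi)).and
    self_mem_nhdsWithin).exists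
  exact h τ hτ' hτ

/-- A path in the exterior that ends at the perimeter is at least as long as the straight run to a
visible point, followed by the perimeter. -/
theorem IsLift.exists_visibleLift_of_path {x : Plane} {y : ℝ → Plane} {t K : ℝ} {g : ℝ → ℝ}
    (hx : x ∉ P.target) (ht : 0 ≤ t) (hy0 : y 0 = x)
    (hK : ∀ a ∈ Icc 0 t, ∀ b ∈ Icc 0 t, ‖y a - y b‖ ≤ K * |a - b|)
    (hyt : y t ∈ P.target) (hg : P.IsLift y t g) :
    ∃ s ∈ P.visibleLift x (g 0), |g t - s| + ‖x - P.γ s‖ ≤ K * t := by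
  have hyc : ContinuousOn y (Icc 0 t) := by
    refine (LipschitzOnWith.of_dist_le_mul (K := K.toNNReal) fun a ha b hb => ?_).continuousOn
    rw [dist_eq_norm, Real.dist_eq]
    exact (hK a ha b hb).trans (mul_le_mul_of_nonneg_right (Real.le_coe_toNNReal K) (abs_nonneg _))
  -- The times `τ` at which the segment from `x` to `y τ` meets the target. Up to the first of them
  -- the segments sweep through the exterior, so the straight segment to `y t₁` has the same lifted
  -- endpoint as the path and replaces the path up to `t₁`; it touches the target, hence passes a
  -- visible point.
  let D : Set ℝ := Prod.fst '' {p : ℝ × ℝ | p ∈ Icc 0 t ×ˢ Icc (0 : ℝ) 1 ∧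
    (AffineMap.lineMap x (y p.1) p.2 : Plane) ∈ P.target}
  have hDc : IsCompact D := by
    refine IsCompact.image ?_ continuous_fst
    have hc : ContinuousOn (fun p : ℝ × ℝ => (AffineMap.lineMap x (y p.1) p.2 : Plane))
        (Icc 0 t ×ˢ Icc (0 : ℝ) 1) := by
      have : ContinuousOn (fun p : ℝ × ℝ => y p.1) (Icc 0 t ×ˢ Icc (0 : ℝ) 1) :=
        hyc.comp continuousOn_fst fun p hp => hp.1
      simp only [AffineMap.lineMap_apply_module]
      exact ((continuousOn_const.sub continuousOn_snd).smul continuousOn_const).add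
        (continuousOn_snd.smul this)
    have := hc.preimage_isClosed_of_isClosed (isClosed_Icc.prod isClosed_Icc) P.isClosed_target
    exact (isCompact_Icc.prod isCompact_Icc).of_isClosed_subset this fun p hp => hp.1
  have hDmem : ∀ {τ : ℝ}, τ ∈ D ↔
      τ ∈ Icc 0 t ∧ ∃ u ∈ Icc (0 : ℝ) 1, (AffineMap.lineMap x (y τ) u : Plane) ∈ P.target := by
    intro τ
    constructor
    · rintro ⟨⟨τ, u⟩, ⟨hp, hp'⟩, rfl⟩; exact ⟨hp.1, u, hp.2, hp'⟩
    · rintro ⟨h1, u, h2, h3⟩; exact ⟨(τ, u), ⟨⟨h1, h2⟩, h3⟩, rfl⟩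
  have htD : t ∈ D := hDmem.2 ⟨⟨ht, le_rfl⟩, 1, ⟨zero_le_one, le_rfl⟩, by simpa using hyt⟩
  have hbelow : BddBelow D := ⟨0, fun τ hτ => (hDmem.1 hτ).1.1⟩
  set t₁ := sInf D
  have ht₁ : t₁ ∈ D := hDc.isClosed.csInf_mem ⟨t, htD⟩ hbelow
  obtain ⟨ht₁I, hT⟩ := hDmem.1 ht₁
  have hpos : 0 < t₁ := by
    rcases ht₁I.1.eq_or_lt with h0 | h0
    · obtain ⟨u, -, hu⟩ := hT
      rw [← h0, hy0, AffineMap.lineMap_same] at hu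
      exact absurd hu hx
    · exact h0
  have hsub : Icc 0 t₁ ⊆ Icc 0 t := Icc_subset_Icc le_rfl ht₁I.2
  have hlt : ∀ τ ∈ Ico 0 t₁, ∀ u ∈ Icc (0 : ℝ) 1,
      (AffineMap.lineMap x (y τ) u : Plane) ∉ interior P.target := fun τ hτ u hu hmem =>
    absurd (csInf_le hbelow (hDmem.2 ⟨hsub ⟨hτ.1, hτ.2.le⟩, u, hu, interior_subset hmem⟩))
      (not_le.2 hτ.2)
  have hX : ∀ τ ∈ Icc 0 t₁, ∀ u ∈ Icc (0 : ℝ) 1,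
      (AffineMap.lineMap x (y τ) u : Plane) ∉ interior P.target := by
    intro τ hτ u hu
    rcases hτ.2.eq_or_lt with rfl | h
    · exact notMem_interior_of_limit hpos (hyc.mono hsub) fun τ hτ => hlt τ hτ u hu
    · exact hlt τ ⟨hτ.1, h⟩ u hu
  have hg0 : P.IsLift (fun u => AffineMap.lineMap x (y 0) u) 1 fun _ => g 0 :=
    ⟨continuousOn_const, fun u _ => by
      rw [hg.2 0 ⟨le_rfl, ht⟩, hy0, AffineMap.lineMap_same]; rfl⟩
  obtain ⟨gs, hgs, hgs0, hgs1⟩ := (hg.mono ht₁I.2).sweep ht₁I.1 (hyc.mono hsub) hX hg0 rfl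
  obtain ⟨s, hs, hs'⟩ := hgs.exists_visibleLift hx hT
  rw [hgs0] at hs
  refine ⟨s, hs, ?_⟩
  have h1 := hg.abs_sub_le hK (a := t) (b := t₁) ⟨ht, le_rfl⟩ ht₁I
  have h2 := hK 0 ⟨le_rfl, ht⟩ t₁ ht₁I
  rw [hy0, zero_sub, abs_neg, abs_of_pos hpos] at h2
  rw [abs_of_nonneg (sub_nonneg.2 ht₁I.2)] at h1
  have h3 := _root_.abs_sub_le (g t) (g t₁) s
  rw [hgs1] at hs'
  nlinarith

/-- Limits of visible points are dominated by visible points. -/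
theorem exists_visibleLift_of_closure {x : Plane} {σ s : ℝ} (hx : x ∉ P.target)
    (hσ : P.γ σ = P.foot x) (hs : s ∈ closure (P.visibleLift x σ)) :
    ∃ s' ∈ P.visibleLift x σ, |s - s'| + ‖x - P.γ s'‖ ≤ ‖x - P.γ s‖ := by
  have hσm := self_mem_visibleLift hx hσ
  -- Walk along the perimeter from the foot to `s`. All points before the end are visible, so the
  -- sight segments sweep through the exterior. The limiting segment may graze the target, and its
  -- first point of contact is the visible point wanted.
  let y : ℝ → Plane := fun τ => P.γ (σ + τ * (s - σ))
  have hyc : Continuous y := P.continuous_γ.comp (by fun_prop)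
  have hin : ∀ τ ∈ Ico (0 : ℝ) 1, σ + τ * (s - σ) ∈ P.visibleLift x σ := by
    intro τ hτ
    by_cases hne : s = σ
    · simpa [hne] using hσm
    have hpos : 0 < (1 - τ) * |s - σ| :=
      mul_pos (by linarith [hτ.2]) (abs_pos.2 (sub_ne_zero.2 hne))
    obtain ⟨r, hr, hrs⟩ := Metric.mem_closure_iff.1 hs _ hpos
    rw [Real.dist_eq] at hrs
    refine uIcc_subset_visibleLift hσm hr ?_
    rw [mem_uIcc]
    rcases lt_or_gt_of_ne hne with h | h
    · rw [abs_of_neg (by linarith : s - σ < 0)] at hrs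
      right
      constructor
      · nlinarith [neg_le_abs (s - r)]
      · nlinarith [hτ.1]
    · rw [abs_of_pos (by linarith : 0 < s - σ)] at hrs
      left
      constructor
      · nlinarith [hτ.1]
      · nlinarith [le_abs_self (s - r)]
  have hlt : ∀ τ ∈ Ico (0 : ℝ) 1, ∀ u ∈ Icc (0 : ℝ) 1,
      (AffineMap.lineMap x (y τ) u : Plane) ∉ interior P.target := fun τ hτ u hu =>
    notMem_interior_of_visible (mem_visible_of_lift (hin τ hτ)) hu
  have hX : ∀ τ ∈ Icc (0 : ℝ) 1, ∀ u ∈ Icc (0 : ℝ) 1,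
      (AffineMap.lineMap x (y τ) u : Plane) ∉ interior P.target := by
    intro τ hτ u hu
    rcases hτ.2.eq_or_lt with rfl | h
    · exact notMem_interior_of_limit one_pos hyc.continuousOn fun τ hτ => hlt τ hτ u hu
    · exact hlt τ ⟨hτ.1, h⟩ u hu
  have hl : P.IsLift y 1 fun τ => σ + τ * (s - σ) :=
    ⟨by fun_prop, fun τ _ => by simp [y]⟩
  obtain ⟨g₀, hg₀, h0, h1⟩ := exists_straightLift_of_visibleLift hσm hσ
  have hy0 : y 0 = P.γ σ := by simp [y]
  have hy1 : y 1 = P.γ s := by simp [y]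
  rw [← hy0] at hg₀
  obtain ⟨g, hg, hg0, hg1⟩ := hl.sweep zero_le_one hyc.continuousOn hX hg₀ (by simp [h1])
  obtain ⟨s', hs', h'⟩ := hg.exists_visibleLift hx
    ⟨1, ⟨zero_le_one, le_rfl⟩, by simpa [hy1] using P.γ_mem_target s⟩
  rw [hg0, h0] at hs'
  refine ⟨s', hs', ?_⟩
  rw [hg1, hy1] at h'
  simpa using h'

/-- The visible interval need not be closed. A maximizer on its compact closure can be exchanged for
a visible point that dominates it: `f` is 1-Lipschitz and `ν ≤ 1`, so the change of `f` is paid for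
by the gain in distance. -/
theorem exists_max_visibleLift {x : Plane} {σ ν : ℝ} (hν₀ : 0 < ν) (hν₁ : ν ≤ 1)
    (hx : x ∉ P.target) (hσ : P.γ σ = P.foot x) {f : ℝ → ℝ}
    (hf : ∀ a b, |f a - f b| ≤ |a - b|) :
    ∃ s ∈ P.visibleLift x σ, ∀ s' ∈ P.visibleLift x σ,
      f s' - ‖x - P.γ s'‖ / ν ≤ f s - ‖x - P.γ s‖ / ν := by
  have hσm := self_mem_visibleLift hx hσ
  have hfc : Continuous f := (LipschitzWith.of_dist_le_mul (K := 1) fun a b => by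
    simpa [Real.dist_eq] using hf a b).continuous
  have hb : Bornology.IsBounded (P.visibleLift x σ) :=
    Metric.isBounded_iff_subset_closedBall σ |>.2 ⟨P.len, fun s hs => by
      rw [Metric.mem_closedBall, Real.dist_eq]; exact (abs_sub_lt_of_visibleLift hs hσm).le⟩
  have hcpt : IsCompact (closure (P.visibleLift x σ)) := hb.isCompact_closure
  have hcont : Continuous fun s => f s - ‖x - P.γ s‖ / ν := by
    have := P.continuous_γ
    fun_prop
  obtain ⟨s, hs, hmax⟩ := hcpt.exists_isMaxOn ⟨σ, subset_closure hσm⟩ hcont.continuousOn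
  obtain ⟨s', hs', h'⟩ := exists_visibleLift_of_closure hx hσ hs
  refine ⟨s', hs', fun r hr => (hmax (subset_closure hr)).trans ?_⟩
  have h1 := (le_abs_self _).trans (hf s s')
  have h2 : |s - s'| ≤ |s - s'| / ν := by
    rw [le_div_iff₀ hν₀]; nlinarith [abs_nonneg (s - s')]
  have h3 : (|s - s'| + ‖x - P.γ s'‖) / ν ≤ ‖x - P.γ s‖ / ν := by gcongr
  rw [add_div] at h3
  simp only; linarith

/-! ### Lifts on convex sets and support lines -/

/-- Composing with the nearest point of `C` turns the problem into lifting a map on the whole plane.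
The lift is 1-Lipschitz on `C` because segments between points of `C` stay in `C`. -/
theorem exists_lift_convex {C : Set Plane} (hC : Convex ℝ C) (hcl : IsClosed C)
    (hCT : ∀ z ∈ C, z ∉ interior P.target) {x : Plane} (hx : x ∈ C) {σ : ℝ}
    (hσ : P.γ σ = P.foot x) :
    ∃ g : Plane → ℝ, Continuous g ∧ g x = σ ∧ (∀ z ∈ C, P.γ (g z) = P.foot z) ∧
      ∀ z ∈ C, ∀ z' ∈ C, |g z - g z'| ≤ ‖z - z'‖ := by
  have hne : C.Nonempty := ⟨x, hx⟩
  obtain ⟨g, hgc, hgx, hg⟩ := P.exists_lift (continuous_nearest hC hcl hne)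
    (fun a => hCT _ (nearest_spec hC hcl hne a).1) x (σ := σ)
    (by rw [nearest_self hC hcl hx]; exact hσ)
  have hgC : ∀ z ∈ C, P.γ (g z) = P.foot z := fun z hz => by rw [hg, nearest_self hC hcl hz]
  refine ⟨g, hgc, hgx, hgC, fun z hz z' hz' => ?_⟩
  have hl : P.IsLift (fun u => AffineMap.lineMap z z' u) 1 fun u => g (AffineMap.lineMap z z' u) :=
    ⟨(hgc.comp (continuous_lineMap_right z z')).continuousOn, fun u hu =>
      hgC _ (hC.lineMap_mem hz hz' hu)⟩
  simpa using hl.abs_sub_le_segment (a := 0) (b := 1) (by simp) (by simp)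

/-- The triangle inequality for a visible point and a convex part of the exterior. -/
theorem abs_sub_le_of_lift_convex {C : Set Plane} (hC : Convex ℝ C) {x : Plane} (hx : x ∈ C)
    {g : Plane → ℝ} (hgc : Continuous g) (hg : ∀ z ∈ C, P.γ (g z) = P.foot z)
    (hgl : ∀ z ∈ C, ∀ z' ∈ C, |g z - g z'| ≤ ‖z - z'‖) {s : ℝ} (hs : s ∈ P.visibleLift x (g x))
    {θ : ℝ} (hθ : θ ∈ Icc (0 : ℝ) 1) (hw : (AffineMap.lineMap x (P.γ s) θ : Plane) ∈ C)
    {p : Plane} (hp : p ∈ C) :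
    |s - g p| ≤ ‖(AffineMap.lineMap x (P.γ s) θ : Plane) - p‖ +
      ‖(AffineMap.lineMap x (P.γ s) θ : Plane) - P.γ s‖ := by
  obtain ⟨gs, hgs, h0, h1⟩ := exists_straightLift_of_visibleLift hs (hg x hx)
  -- Up to `θ` the sight segment stays in `C`, where its lift coincides with `g`; beyond `θ` the
  -- lift moves by at most the remaining length.
  have hseg : ∀ u ∈ Icc 0 θ, (AffineMap.lineMap x (P.γ s) u : Plane) ∈ C := by
    intro u hu
    rcases hθ.1.eq_or_lt with h | h
    · have : u = 0 := le_antisymm (h ▸ hu.2) hu.1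
      simpa [this] using hx
    · have h2 := hC.lineMap_mem hx hw (t := u / θ)
        ⟨div_nonneg hu.1 h.le, (div_le_one h).2 hu.2⟩
      have : (AffineMap.lineMap x (AffineMap.lineMap x (P.γ s) θ) (u / θ) : Plane) =
          AffineMap.lineMap x (P.γ s) u := by
        simp only [AffineMap.lineMap_apply_module, smul_add, smul_smul]
        have h3 : u / θ * θ = u := div_mul_cancel₀ u h.ne'
        rw [mul_sub, mul_one, h3]; module
      rwa [this] at h2
  have hl : P.IsLift (fun u => AffineMap.lineMap x (P.γ s) u) θ
      fun u => g (AffineMap.lineMap x (P.γ s) u) :=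
    ⟨(hgc.comp (continuous_lineMap_right x _)).continuousOn, fun u hu => hg _ (hseg u hu)⟩
  have h2 : gs θ = g (AffineMap.lineMap x (P.γ s) θ) :=
    (hgs.mono hθ.2).eqOn hl hθ.1 (by simp [h0]) ⟨hθ.1, le_rfl⟩
  have h3 := hgs.abs_sub_le_segment (a := 1) (b := θ) (by simp) hθ
  rw [← norm_lineMap_sub_lineMap, AffineMap.lineMap_apply_one, h1, h2, norm_sub_rev] at h3
  have h4 := _root_.abs_sub_le s (g (AffineMap.lineMap x (P.γ s) θ)) (g p)
  have h5 := hgl _ hw p hp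
  linarith

theorem inner_neg_of_mem_interior {n p : Plane} (hn : n ≠ 0)
    (h : ∀ z ∈ P.target, inner ℝ n (z - p) ≤ 0) {z : Plane} (hz : z ∈ interior P.target) :
    inner ℝ n (z - p) < 0 := by
  have hcont : Filter.Tendsto (fun t : ℝ => z + t • n) (nhdsWithin 0 (Ioi 0)) (nhds z) := by
    have : Continuous fun t : ℝ => z + t • n := by fun_prop
    simpa using (this.tendsto 0).mono_left nhdsWithin_le_nhds
  obtain ⟨t, ht, ht0⟩ := ((hcont.eventually (isOpen_interior.mem_nhds hz)).and
    self_mem_nhdsWithin).exists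
  have h1 := h _ (interior_subset ht)
  rw [add_sub_right_comm, inner_add_right, inner_smul_right, real_inner_self_eq_norm_sq] at h1
  have h2 : 0 < t * ‖n‖ ^ 2 := mul_pos ht0 (pow_pos (norm_pos_iff.2 hn) 2)
  linarith

theorem convex_halfPlane (n p : Plane) : Convex ℝ {z : Plane | 0 ≤ inner ℝ n (z - p)} := by
  intro a ha b hb α β hα hβ hαβ
  simp only [mem_ofPred_eq] at *
  have : α • a + β • b - p = α • (a - p) + β • (b - p) := by
    rw [smul_sub, smul_sub]
    have : p = α • p + β • p := by rw [← add_smul, hαβ, one_smul]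
    nth_rw 1 [this]; abel
  rw [this, inner_add_right, inner_smul_right, inner_smul_right]
  positivity

theorem isClosed_halfPlane (n p : Plane) : IsClosed {z : Plane | 0 ≤ inner ℝ n (z - p)} :=
  isClosed_le continuous_const (by fun_prop)

theorem inner_lineMap_sub (n p x z : Plane) (u : ℝ) :
    inner ℝ n ((AffineMap.lineMap x z u : Plane) - p) =
      (1 - u) * inner ℝ n (x - p) + u * inner ℝ n (z - p) := by
  rw [← inner_smul_right, ← inner_smul_right, ← inner_add_right]
  congr 1
  rw [AffineMap.lineMap_apply_module]; module

theorem norm_sub_lineMap_add (x z : Plane) {u : ℝ} (hu : u ∈ Icc (0 : ℝ) 1) :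
    ‖x - AffineMap.lineMap x z u‖ + ‖(AffineMap.lineMap x z u : Plane) - z‖ = ‖x - z‖ := by
  have h1 := norm_lineMap_sub_lineMap x z 0 u
  have h2 := norm_lineMap_sub_lineMap x z u 1
  rw [AffineMap.lineMap_apply_zero, zero_sub, abs_neg, abs_of_nonneg hu.1] at h1
  rw [AffineMap.lineMap_apply_one, abs_of_nonpos (by linarith [hu.2])] at h2
  rw [h1, h2]; ring

theorem foot_lineMap_foot (x : Plane) {v : ℝ} (hv : v ≤ 1) :
    P.foot (AffineMap.lineMap x (P.foot x) v) = P.foot x := by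
  refine nearest_eq P.convex P.isClosed_target (P.foot_mem x) fun z hz => ?_
  have e1 : (AffineMap.lineMap x (P.foot x) v : Plane) - P.foot x = (1 - v) • (x - P.foot x) := by
    rw [AffineMap.lineMap_apply_module]; module
  rw [e1, inner_smul_left]
  exact mul_nonpos_of_nonneg_of_nonpos (by simpa using hv) (P.inner_foot_le x hz)

/-- The line through the foot `p` orthogonal to `x - p` supports the target, so the sight segment
crosses it at some `w`. The lift moves by at most `‖w - p‖ + ‖w - γ s‖`, and `‖w - p‖ < ‖x - w‖` by
Pythagoras. The strictness is what separates `A`, `σ` and `B`. -/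
theorem abs_sub_lt_of_mem_visibleLift {x : Plane} {σ s : ℝ} (hs : s ∈ P.visibleLift x σ)
    (hσ : P.γ σ = P.foot x) : |s - σ| < ‖x - P.γ s‖ := by
  have hx := notMem_of_mem_visible (mem_visible_of_lift hs)
  set p := P.foot x with hp
  have hn : x - p ≠ 0 := sub_ne_zero.2 fun h => hx (h ▸ P.foot_mem x)
  have hnpos : 0 < inner ℝ (x - p) (x - p) := by
    rw [real_inner_self_eq_norm_sq]; exact pow_pos (norm_pos_iff.2 hn) 2
  let C : Set Plane := {z | 0 ≤ inner ℝ (x - p) (z - p)}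
  have hC : Convex ℝ C := convex_halfPlane _ _
  have hCT : ∀ z ∈ C, z ∉ interior P.target := fun z hz hi =>
    absurd (inner_neg_of_mem_interior hn (fun z hz => P.inner_foot_le x hz) hi) (not_lt.2 hz)
  have hxC : x ∈ C := hnpos.le
  have hpC : p ∈ C := by simp [C]
  obtain ⟨g, hgc, rfl, hg, hgl⟩ := exists_lift_convex hC (isClosed_halfPlane _ _) hCT hxC hσ
  have hgp : g p = g x := by
    have := P.lift_unique (S := Icc (0 : ℝ) 1) isPreconnected_Icc
      (g := fun u => g (AffineMap.lineMap x p u)) (g' := fun _ => g x)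
      (hgc.comp (continuous_lineMap_right x p)).continuousOn continuousOn_const
      (fun u hu => by
        rw [hg _ (hC.lineMap_mem hxC hpC hu), P.foot_lineMap_foot x hu.2, hg x hxC])
      (a₀ := 0) (by simp) (by simp) (show (1 : ℝ) ∈ Icc (0 : ℝ) 1 by simp)
    simpa using this
  have hb := P.inner_foot_le x (P.γ_mem_target s)
  set A := inner ℝ (x - p) (x - p)
  set B := inner ℝ (x - p) (P.γ s - p)
  have hAB : 0 < A - B := by linarith
  have hθ : A / (A - B) ∈ Icc (0 : ℝ) 1 :=
    ⟨div_nonneg hnpos.le hAB.le, (div_le_one hAB).2 (by linarith)⟩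
  set θ := A / (A - B) with hθd
  have hw0 : inner ℝ (x - p) ((AffineMap.lineMap x (P.γ s) θ : Plane) - p) = 0 := by
    rw [inner_lineMap_sub, hθd]; field_simp; ring
  have h1 := abs_sub_le_of_lift_convex hC hxC hgc hg hgl hs hθ (p := p) hw0.ge hpC
  rw [hgp] at h1
  have h2 := norm_sub_lineMap_add x (P.γ s) hθ
  set w : Plane := AffineMap.lineMap x (P.γ s) θ
  have h3 : ‖x - w‖ * ‖x - w‖ = ‖x - p‖ * ‖x - p‖ + ‖w - p‖ * ‖w - p‖ := by
    rw [show x - w = (x - p) - (w - p) by abel]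
    exact (norm_sub_sq_eq_norm_sq_add_norm_sq_iff_real_inner_eq_zero _ _).2 hw0
  have h4 : ‖w - p‖ < ‖x - w‖ := by
    have := norm_pos_iff.2 hn
    nlinarith [norm_nonneg (w - p), norm_nonneg (x - w)]
  linarith

end Perimeter
end

noncomputable section

/-! ### Order of the lines of sight and convexity of the distance -/

theorem Plane.inner_eq (u v : Plane) : inner ℝ u v = u 0 * v 0 + u 1 * v 1 := by
  simp [PiLp.inner_apply, Fin.sum_univ_two, mul_comm]

theorem Plane.norm_sq_eq (u : Plane) : ‖u‖ ^ 2 = u 0 ^ 2 + u 1 ^ 2 := by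
  rw [← real_inner_self_eq_norm_sq, Plane.inner_eq]; ring

theorem inner_sq_add_cross_sq (u v : Plane) :
    inner ℝ u v ^ 2 + cross u v ^ 2 = ‖u‖ ^ 2 * ‖v‖ ^ 2 := by
  rw [Plane.inner_eq, cross, Plane.norm_sq_eq, Plane.norm_sq_eq]; ring

theorem eq_smul_of_cross_eq_zero {u v : Plane} (hu : u ≠ 0) (h : cross u v = 0) :
    ∃ c : ℝ, v = c • u := by
  have hpos : 0 < u 0 ^ 2 + u 1 ^ 2 := by
    rw [← Plane.norm_sq_eq]; exact pow_pos (norm_pos_iff.2 hu) 2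
  refine ⟨(u 0 * v 0 + u 1 * v 1) / (u 0 ^ 2 + u 1 ^ 2), ?_⟩
  rw [cross] at h
  ext i
  fin_cases i
  · simp; field_simp; linear_combination (-u 1) * h
  · simp; field_simp; linear_combination (u 0) * h

namespace Perimeter

variable {P : Perimeter}

/-- If `x` and the two points were collinear, either `x` would lie between them, hence in the convex
target, or the nearer point would hide the farther one. -/
theorem cross_ne_zero_of_visible {x : Plane} {s s' : ℝ} (hs : s ∈ P.visible x)
    (hs' : s' ∈ P.visible x) (hne : P.γ s ≠ P.γ s') : cross (P.γ s - x) (P.γ s' - x) ≠ 0 := by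
  intro h
  have hx := notMem_of_mem_visible hs
  have hu : P.γ s - x ≠ 0 := sub_ne_zero.2 fun h => hx (h ▸ P.γ_mem_target s)
  obtain ⟨c, hc⟩ := eq_smul_of_cross_eq_zero hu h
  have e1 : P.γ s' = AffineMap.lineMap x (P.γ s) c := by
    rw [AffineMap.lineMap_apply_module', ← hc]; abel
  have hc0 : 0 < c := by
    by_contra! hle
    have h1 : (AffineMap.lineMap (P.γ s) (P.γ s') (1 / (1 - c)) : Plane) = x := by
      rw [e1]; simp only [AffineMap.lineMap_apply_module]
      have : 1 - c ≠ 0 := by linarith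
      rw [smul_add, smul_smul, smul_smul, one_div_mul_cancel this, one_smul, add_comm, add_assoc,
        ← add_smul, show 1 / (1 - c) * c + (1 - 1 / (1 - c)) = 0 by field_simp; ring, zero_smul,
        add_zero]
    refine hx (h1 ▸ P.convex.lineMap_mem (P.γ_mem_target s) (P.γ_mem_target s')
      ⟨div_nonneg zero_le_one (by linarith), (div_le_one (by linarith)).2 (by linarith)⟩)
  rcases lt_trichotomy c 1 with h1 | h1 | h1
  · exact hs c ⟨hc0.le, h1⟩ (e1 ▸ P.γ_mem_target s')
  · exact hne (by rw [e1, h1, AffineMap.lineMap_apply_one])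
  · refine hs' (1 / c) ⟨by positivity, (div_lt_one hc0).2 h1⟩ ?_
    have : (AffineMap.lineMap x (P.γ s') (1 / c) : Plane) = P.γ s := by
      rw [e1]; simp only [AffineMap.lineMap_apply_module, smul_add, smul_smul]
      rw [one_div_mul_cancel hc0.ne', one_smul, ← add_assoc, ← add_smul,
        show 1 - 1 / c + 1 / c * (1 - c) = 0 by field_simp; ring, zero_smul, zero_add]
    rw [this]; exact P.γ_mem_target s

/-- The line of sight turns monotonically along the visible part of the perimeter. -/
theorem cross_mul_cross_neg {x : Plane} {σ a m b : ℝ} (ha : a ∈ P.visibleLift x σ)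
    (hb : b ∈ P.visibleLift x σ) (ham : a < m) (hmb : m < b) :
    cross (P.γ m - x) (P.γ a - x) * cross (P.γ m - x) (P.γ b - x) < 0 := by
  have hvis : ∀ s ∈ Icc a b, s ∈ P.visibleLift x σ := fun s hs =>
    uIcc_subset_visibleLift ha hb (Icc_subset_uIcc hs)
  -- The pair of points moves from `(a, m)` to `(m, b)` without ever coinciding, so the cross
  -- product keeps its sign; at `τ = 0` it is the antisymmetric image of the product in the claim.
  let k : ℝ → ℝ := fun τ => cross (P.γ (a + τ * (m - a)) - x) (P.γ (m + τ * (b - m)) - x)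
  have hk : ∀ τ ∈ Icc (0 : ℝ) 1, k τ ≠ 0 := by
    intro τ hτ
    have h1 : a + τ * (m - a) ∈ Icc a b := ⟨by nlinarith [hτ.1], by nlinarith [hτ.2]⟩
    have h2 : m + τ * (b - m) ∈ Icc a b := ⟨by nlinarith [hτ.1], by nlinarith [hτ.2]⟩
    refine cross_ne_zero_of_visible (mem_visible_of_lift (hvis _ h1))
      (mem_visible_of_lift (hvis _ h2)) fun h => ?_
    have := P.eq_of_γ_eq h (abs_sub_lt_of_visibleLift (hvis _ h1) (hvis _ h2))
    have hδ : 0 < min (m - a) (b - m) := lt_min (by linarith) (by linarith)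
    have h3 := mul_le_mul_of_nonneg_left (min_le_left (m - a) (b - m)) (sub_nonneg.2 hτ.2)
    have h4 := mul_le_mul_of_nonneg_left (min_le_right (m - a) (b - m)) hτ.1
    linarith
  have hc : ContinuousOn k (Icc 0 1) := by
    have := P.continuous_γ
    have h1 : Continuous fun τ => P.γ (a + τ * (m - a)) := this.comp (by fun_prop)
    have h2 : Continuous fun τ => P.γ (m + τ * (b - m)) := this.comp (by fun_prop)
    simp only [k, cross, PiLp.sub_apply]
    fun_prop
  have h01 : 0 < k 0 * k 1 := by
    by_contra! hle
    have hne := mul_ne_zero (hk 0 (by simp)) (hk 1 (by simp))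
    have hmem : (0 : ℝ) ∈ uIcc (k 0) (k 1) := by
      rw [mem_uIcc]
      rcases mul_neg_iff.1 (lt_of_le_of_ne hle hne) with h | h
      · exact Or.inr ⟨h.2.le, h.1.le⟩
      · exact Or.inl ⟨h.1.le, h.2.le⟩
    have := intermediate_value_uIcc (f := k) (a := 0) (b := 1)
      (by rw [uIcc_of_le zero_le_one]; exact hc) hmem
    rw [uIcc_of_le zero_le_one] at this
    obtain ⟨τ, hτ, h0⟩ := this
    exact hk τ hτ h0
  have e0 : k 0 = - cross (P.γ m - x) (P.γ a - x) := by simp [k, cross]; ring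
  have e1 : k 1 = cross (P.γ m - x) (P.γ b - x) := by simp [k, cross]
  rw [e0, e1] at h01
  linarith

/-- Separate the interior of the target from the sight segment. Their closures meet at `γ m`, so the
separating line passes through it. -/
theorem exists_support {x : Plane} {m : ℝ} (hm : m ∈ P.visible x) :
    ∃ n : Plane, ‖n‖ = 1 ∧ (∀ z ∈ P.target, inner ℝ n (z - P.γ m) ≤ 0) ∧
      0 ≤ inner ℝ n (x - P.γ m) := by
  have hdisj : Disjoint (interior P.target) (segment ℝ x (P.γ m)) := by
    rw [Set.disjoint_left]
    intro z hz hz'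
    rw [segment_eq_image_lineMap] at hz'
    obtain ⟨u, hu, rfl⟩ := hz'
    exact notMem_interior_of_visible hm hu hz
  obtain ⟨f, u, h1, h2⟩ := geometric_hahn_banach_open P.convex.interior isOpen_interior
    (convex_segment x (P.γ m)) hdisj
  have h3 : ∀ z ∈ P.target, f z ≤ u := by
    have : P.target ⊆ closure (interior P.target) := by
      rw [P.convex.closure_interior_eq_closure_of_nonempty_interior P.interior_nonempty]
      exact subset_closure
    intro z hz
    have h4 : closure (interior P.target) ⊆ {z | f z ≤ u} :=
      closure_minimal (fun z hz => (h1 z hz).le) (isClosed_le f.continuous continuous_const)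
    exact h4 (this hz)
  have h4 : f (P.γ m) = u :=
    le_antisymm (h3 _ (P.γ_mem_target m)) (h2 _ (right_mem_segment ℝ x _))
  have h5 : u ≤ f x := h2 _ (left_mem_segment ℝ x _)
  set n₀ : Plane := (InnerProductSpace.toDual ℝ Plane).symm f
  have hn₀ : ∀ z, inner ℝ n₀ z = f z := fun z => InnerProductSpace.toDual_symm_apply
  have hne : n₀ ≠ 0 := by
    intro h0
    obtain ⟨o, ho⟩ := P.interior_nonempty
    have := h1 o ho
    rw [← h4, ← hn₀, ← hn₀, h0] at this
    simp at this
  have hpos : 0 < ‖n₀‖ := norm_pos_iff.2 hne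
  refine ⟨‖n₀‖⁻¹ • n₀, ?_, fun z hz => ?_, ?_⟩
  · rw [norm_smul, norm_inv, norm_norm, inv_mul_cancel₀ hpos.ne']
  · rw [real_inner_smul_left, hn₀, map_sub, h4]
    exact mul_nonpos_of_nonneg_of_nonpos (by positivity) (by linarith [h3 z hz])
  · rw [real_inner_smul_left, hn₀, map_sub, h4]
    exact mul_nonneg (by positivity) (by linarith)

/-- The distance to the perimeter has a subgradient at every inner point of the visible part. -/
theorem exists_subgradient {x : Plane} {σ a m b : ℝ} (hσ : P.γ σ = P.foot x)
    (ha : a ∈ P.visibleLift x σ) (hb : b ∈ P.visibleLift x σ) (ham : a < m) (hmb : m < b) :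
    ∃ μ : ℝ, ‖x - P.γ m‖ + μ * (b - m) ≤ ‖x - P.γ b‖ ∧
      ‖x - P.γ m‖ - μ * (m - a) ≤ ‖x - P.γ a‖ := by
  have hm : m ∈ P.visibleLift x σ :=
    uIcc_subset_visibleLift ha hb (Icc_subset_uIcc ⟨ham.le, hmb.le⟩)
  have hx := notMem_of_mem_visible (mem_visible_of_lift hm)
  have hcr := cross_mul_cross_neg ha hb ham hmb
  obtain ⟨n, hn1, hnT, hnx⟩ := exists_support (mem_visible_of_lift hm)
  have hn : n ≠ 0 := fun h => by simp [h] at hn1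
  set p := P.γ m with hp
  set v : Plane := p - x with hv
  have hvne : v ≠ 0 := sub_ne_zero.2 fun h => hx (h ▸ P.γ_mem_target m)
  have hvpos : 0 < ‖v‖ := norm_pos_iff.2 hvne
  have hnsq : n 0 ^ 2 + n 1 ^ 2 = 1 := by rw [← Plane.norm_sq_eq, hn1, one_pow]
  have hnv : inner ℝ n v = - inner ℝ n (x - p) := by rw [← inner_neg_right, neg_sub]
  -- the viewpoint lies strictly outside of the support line
  have hN : 0 < inner ℝ n (x - p) := by
    refine lt_of_le_of_ne hnx fun h0 => ?_
    rw [← h0, neg_zero] at hnv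
    -- If `x` were on the support line, that line would be the line of sight to `p`, with the whole
    -- target on one side of it. But `a` and `b` are seen strictly on opposite sides.
    have key : ∀ s, cross v n * cross v (P.γ s - x) ≤ 0 := by
      intro s
      have h1 := hnT _ (P.γ_mem_target s)
      have h2 : inner ℝ n (P.γ s - x) = inner ℝ n (P.γ s - p) := by
        rw [show P.γ s - x = (P.γ s - p) + v by rw [hv]; abel, inner_add_right, hnv, add_zero]
      rw [← h2, Plane.inner_eq] at h1
      have h3 : cross v n * cross v (P.γ s - x) =
          ‖v‖ ^ 2 * (n 0 * (P.γ s - x) 0 + n 1 * (P.γ s - x) 1) -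
            inner ℝ n v * inner ℝ v (P.γ s - x) := by
        rw [Plane.norm_sq_eq, Plane.inner_eq, Plane.inner_eq, cross, cross]; ring
      rw [h3, hnv, zero_mul, sub_zero]
      exact mul_nonpos_of_nonneg_of_nonpos (by positivity) h1
    have hc0 : cross v n = 0 := by
      by_contra hne
      have h1 := key a
      have h2 := key b
      have h3 := mul_nonneg_of_nonpos_of_nonpos h1 h2
      have h4 : 0 < cross v n ^ 2 := by positivity
      nlinarith
    have := inner_sq_add_cross_sq v n
    rw [hc0, real_inner_comm, hnv, hn1] at this
    nlinarith [pow_pos hvpos 2]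
  let C : Set Plane := {z | 0 ≤ inner ℝ n (z - p)}
  have hC : Convex ℝ C := convex_halfPlane _ _
  have hCT : ∀ z ∈ C, z ∉ interior P.target := fun z hz hi =>
    absurd (inner_neg_of_mem_interior hn hnT hi) (not_lt.2 hz)
  have hxC : x ∈ C := hN.le
  have hpC : p ∈ C := by simp [C]
  obtain ⟨g, hgc, rfl, hg, hgl⟩ := exists_lift_convex hC (isClosed_halfPlane _ _) hCT hxC hσ
  have hgp : g p = m := by
    have h1 := abs_sub_le_of_lift_convex hC hxC hgc hg hgl hm (θ := 1) (by simp)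
      (by simpa [← hp] using hpC) hpC
    simp only [AffineMap.lineMap_apply_one, ← hp, sub_self, norm_zero, add_zero] at h1
    have := abs_nonpos_iff.1 h1
    linarith
  let d : Plane := !₂[-n 1, n 0]
  have hd0 : d 0 = -n 1 := by simp [d]
  have hd1 : d 1 = n 0 := by simp [d]
  have hdn : ‖d‖ = 1 := by
    have := Plane.norm_sq_eq d
    rw [hd0, hd1] at this
    have h2 : ‖d‖ ^ 2 = 1 := by rw [this]; linarith
    nlinarith [norm_nonneg d]
  have hcvd : cross v d = inner ℝ n v := by rw [cross, hd0, hd1, Plane.inner_eq]; ring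
  have hcvd0 : cross v d < 0 := by rw [hcvd, hnv]; linarith
  -- The derivative at `p` of the distance to `x` in the direction `d` of the support line; up to
  -- orientation this is the subgradient.
  let μ : ℝ := inner ℝ v d / ‖v‖
  have hμ : |μ| ≤ 1 := by
    rw [abs_div, abs_norm, div_le_one hvpos]
    simpa [hdn] using abs_real_inner_le_norm v d
  -- Project `γ s` centrally from `x` onto the support line: `r` is the signed coordinate of the
  -- image `w` relative to `p`, and `e = ‖w - γ s‖`. Convexity of the distance along the line bounds
  -- `‖x - w‖` from below, and `|s - m|` differs from `|r|` by at most `e`.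
  have side : ∀ s ∈ P.visibleLift x (g x), ∃ r e θ : ℝ, 0 < θ ∧
      r * cross v d = θ * cross v (P.γ s - x) ∧ ‖v‖ + r * μ + e ≤ ‖x - P.γ s‖ ∧
      |s - m| ≤ |r| + e ∧ |r| - e ≤ |s - m| ∧ 0 ≤ e := by
    intro s hs
    have hB := hnT _ (P.γ_mem_target s)
    set A := inner ℝ n (x - p)
    set B := inner ℝ n (P.γ s - p)
    have hAB : 0 < A - B := by linarith
    have hθ : A / (A - B) ∈ Icc (0 : ℝ) 1 :=
      ⟨div_nonneg hN.le hAB.le, (div_le_one hAB).2 (by linarith)⟩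
    have hθ0 : 0 < A / (A - B) := div_pos hN hAB
    set θ := A / (A - B) with hθd
    have hw0 : inner ℝ n ((AffineMap.lineMap x (P.γ s) θ : Plane) - p) = 0 := by
      rw [inner_lineMap_sub, hθd]; field_simp; ring
    have h1 := abs_sub_le_of_lift_convex hC hxC hgc hg hgl hs hθ (p := p) hw0.ge hpC
    rw [hgp] at h1
    have h2 := norm_sub_lineMap_add x (P.γ s) hθ
    have hwx : (AffineMap.lineMap x (P.γ s) θ : Plane) - x = θ • (P.γ s - x) := by
      rw [AffineMap.lineMap_apply_module]; module
    set w : Plane := AffineMap.lineMap x (P.γ s) θ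
    set r : ℝ := inner ℝ d (w - p) with hr
    have hwr : w - p = r • d := by
      rw [Plane.inner_eq] at hw0
      rw [hr, Plane.inner_eq, hd0, hd1]
      ext i
      fin_cases i
      · simp [hd0] at hw0 ⊢; linear_combination (-(w 0 - p 0)) * hnsq + n 0 * hw0
      · simp [hd1] at hw0 ⊢; linear_combination (-(w 1 - p 1)) * hnsq + n 1 * hw0
    have hwn : ‖w - p‖ = |r| := by rw [hwr, norm_smul, hdn, mul_one, Real.norm_eq_abs]
    have hxw : ‖v‖ + r * μ ≤ ‖x - w‖ := by
      have h3 : inner ℝ v (w - x) ≤ ‖v‖ * ‖x - w‖ := by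
        rw [norm_sub_rev x w]; exact real_inner_le_norm _ _
      have h4 : inner ℝ v (w - x) = ‖v‖ ^ 2 + r * inner ℝ v d := by
        rw [show w - x = v + (w - p) by rw [hv]; abel, inner_add_right, hwr, inner_smul_right,
          real_inner_self_eq_norm_sq]
      have h5 : r * μ * ‖v‖ = r * inner ℝ v d := by
        simp only [μ]; field_simp
      by_contra! hlt
      nlinarith
    refine ⟨r, ‖w - P.γ s‖, θ, hθ0, ?_, by linarith, by rw [← hwn]; exact h1, ?_, norm_nonneg _⟩
    · have : cross v (w - x) = r * cross v d := by
        rw [show w - x = v + (w - p) by rw [hv]; abel, hwr]; simp [cross]; ring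
      rw [← this, hwx]; simp [cross]; ring
    · have h3 : ‖p - P.γ s‖ ≤ |s - m| := by
        rw [abs_sub_comm]; exact P.norm_γ_sub_le m s
      have h4 : ‖w - p‖ ≤ ‖w - P.γ s‖ + ‖P.γ s - p‖ := norm_sub_le_norm_sub_add_norm_sub _ _ _
      rw [norm_sub_rev (P.γ s) p] at h4
      linarith
  -- As the slope is at most `1` in absolute value, replacing the coordinate on the support line by
  -- arc length costs at most `e`, exactly the length of sight beyond the line.
  have arith : ∀ d₀ r e D l κ : ℝ, |κ| ≤ 1 → 0 ≤ e → d₀ + r * κ + e ≤ D → l ≤ r + e →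
      r - e ≤ l → d₀ + κ * l ≤ D := by
    intro d₀ r e D l κ hκ he h1 h2 h3
    obtain ⟨h4, h5⟩ := abs_le.1 hκ
    rcases le_total 0 κ with h | h <;> nlinarith
  have hdist : ‖v‖ = ‖x - p‖ := norm_sub_rev _ _
  obtain ⟨ra, ea, θa, hθa, hra, h1a, h2a, h3a, h4a⟩ := side a ha
  obtain ⟨rb, eb, θb, hθb, hrb, h1b, h2b, h3b, h4b⟩ := side b hb
  rw [abs_of_neg (by linarith : a - m < 0)] at h2a h3a
  rw [abs_of_pos (by linarith : 0 < b - m)] at h2b h3b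
  have hrab : ra * rb < 0 := by
    have h1 : (ra * rb) * cross v d ^ 2 =
        (θa * θb) * (cross v (P.γ a - x) * cross v (P.γ b - x)) := by
      rw [show (ra * rb) * cross v d ^ 2 = (ra * cross v d) * (rb * cross v d) by ring, hra, hrb]
      ring
    have h2 : (θa * θb) * (cross v (P.γ a - x) * cross v (P.γ b - x)) < 0 :=
      mul_neg_of_pos_of_neg (mul_pos hθa hθb) hcr
    rw [← h1] at h2
    exact neg_of_mul_neg_left h2 (sq_nonneg _)
  rw [hdist] at h1a h1b
  -- The projections of `a` and `b` lie on opposite sides of `p`; which one is positive depends on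
  -- whether `d` points in the direction of increasing arc length, and this fixes the sign of the
  -- subgradient.
  rcases mul_neg_iff.1 hrab with ⟨hra0, hrb0⟩ | ⟨hra0, hrb0⟩
  · refine ⟨-μ, ?_, ?_⟩
    · rw [abs_of_neg hrb0] at h2b h3b
      exact arith _ (-rb) eb _ _ (-μ) (by rwa [abs_neg]) h4b (by linarith) h2b h3b
    · rw [abs_of_pos hra0] at h2a h3a
      have := arith _ ra ea _ (m - a) μ hμ h4a h1a (by linarith) (by linarith)
      linarith
  · refine ⟨μ, ?_, ?_⟩
    · rw [abs_of_pos hrb0] at h2b h3b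
      exact arith _ rb eb _ _ μ hμ h4b h1b h2b h3b
    · rw [abs_of_neg hra0] at h2a h3a
      have := arith ‖x - p‖ (-ra) ea ‖x - P.γ a‖ (m - a) (-μ) (by rwa [abs_neg])
        h4a (by linarith) (by linarith)
        (by linarith)
      linarith

/-- Beyond its minimizer, `s + ‖x - γ s‖ / ν` increases on the visible part. -/
theorem add_div_le_of_min {x : Plane} {σ r m s ν : ℝ} (hν : 0 < ν) (hσ : P.γ σ = P.foot x)
    (hr : r ∈ P.visibleLift x σ) (hs : s ∈ P.visibleLift x σ)
    (hmin : ∀ s' ∈ P.visibleLift x σ, r + ‖x - P.γ r‖ / ν ≤ s' + ‖x - P.γ s'‖ / ν)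
    (hrm : r ≤ m) (hms : m ≤ s) : m + ‖x - P.γ m‖ / ν ≤ s + ‖x - P.γ s‖ / ν := by
  rcases hrm.eq_or_lt with rfl | hrm
  · exact hmin s hs
  rcases hms.eq_or_lt with rfl | hms
  · exact le_rfl
  have hm : m ∈ P.visibleLift x σ :=
    uIcc_subset_visibleLift hr hs (Icc_subset_uIcc ⟨hrm.le, hms.le⟩)
  obtain ⟨μ, h1, h2⟩ := exists_subgradient hσ hr hs hrm hms
  have h3 := hmin m hm
  have e : ∀ c : ℝ, c / ν * ν = c := fun c => div_mul_cancel₀ c hν.ne'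
  have h4 : r * ν + ‖x - P.γ r‖ ≤ m * ν + ‖x - P.γ m‖ := by
    have := mul_le_mul_of_nonneg_right h3 hν.le
    rwa [add_mul, add_mul, e, e] at this
  -- A steeper descent at `m` would contradict the minimality at `r`; the bound on the slope then
  -- carries over to the other side of `m`.
  have h5 : -ν ≤ μ := by
    by_contra! hc
    nlinarith
  have h6 : m * ν + ‖x - P.γ m‖ ≤ s * ν + ‖x - P.γ s‖ := by nlinarith
  have h7 : (m + ‖x - P.γ m‖ / ν) * ν ≤ (s + ‖x - P.γ s‖ / ν) * ν := by
    rwa [add_mul, add_mul, e, e]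
  exact le_of_mul_le_mul_right h7 hν

/-- Before its maximizer, `s - ‖x - γ s‖ / ν` increases on the visible part. -/
theorem sub_div_le_of_max {x : Plane} {σ l m s ν : ℝ} (hν : 0 < ν) (hσ : P.γ σ = P.foot x)
    (hl : l ∈ P.visibleLift x σ) (hs : s ∈ P.visibleLift x σ)
    (hmax : ∀ s' ∈ P.visibleLift x σ, s' - ‖x - P.γ s'‖ / ν ≤ l - ‖x - P.γ l‖ / ν)
    (hsm : s ≤ m) (hml : m ≤ l) : s - ‖x - P.γ s‖ / ν ≤ m - ‖x - P.γ m‖ / ν := by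
  rcases hml.eq_or_lt with rfl | hml
  · exact hmax s hs
  rcases hsm.eq_or_lt with rfl | hsm
  · exact le_rfl
  have hm : m ∈ P.visibleLift x σ :=
    uIcc_subset_visibleLift hs hl (Icc_subset_uIcc ⟨hsm.le, hml.le⟩)
  obtain ⟨μ, h1, h2⟩ := exists_subgradient hσ hs hl hsm hml
  have h3 := hmax m hm
  have e : ∀ c : ℝ, c / ν * ν = c := fun c => div_mul_cancel₀ c hν.ne'
  have h4 : m * ν - ‖x - P.γ m‖ ≤ l * ν - ‖x - P.γ l‖ := by
    have := mul_le_mul_of_nonneg_right h3 hν.le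
    rwa [sub_mul, sub_mul, e, e] at this
  have h5 : μ ≤ ν := by
    by_contra! hc
    nlinarith
  have h6 : s * ν - ‖x - P.γ s‖ ≤ m * ν - ‖x - P.γ m‖ := by nlinarith
  have h7 : (s - ‖x - P.γ s‖ / ν) * ν ≤ (m - ‖x - P.γ m‖ / ν) * ν := by
    rwa [sub_mul, sub_mul, e, e]
  exact le_of_mul_le_mul_right h7 hν

end Perimeter
end

noncomputable section

namespace Perimeter

variable {P : Perimeter} {ν : ℝ}

/-! ### Arc lengths -/

theorem arc_eq {a b c : ℝ} (n : ℤ) (h : b - a = c + n * P.len) (h0 : 0 ≤ c) (h1 : c < P.len) :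
    P.arc a b = c := by
  rw [arc, toIcoMod_eq_iff]
  exact ⟨⟨h0, by simpa using h1⟩, n, by simpa using h⟩

theorem arc_nonneg (a b : ℝ) : 0 ≤ P.arc a b := (toIcoMod_mem_Ico' P.len_pos (b - a)).1

theorem arc_lt (a b : ℝ) : P.arc a b < P.len := (toIcoMod_mem_Ico' P.len_pos (b - a)).2

theorem exists_eq_add_arc (a b : ℝ) : ∃ n : ℤ, b = a + P.arc a b + n * P.len := by
  refine ⟨toIcoDiv P.len_pos 0 (b - a), ?_⟩
  have := toIcoMod_add_toIcoDiv_zsmul P.len_pos 0 (b - a)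
  rw [zsmul_eq_mul] at this
  simp only [arc]; linarith

theorem arc_of_le {a b : ℝ} (h0 : a ≤ b) (h1 : b < a + P.len) : P.arc a b = b - a :=
  arc_eq 0 (by simp) (by linarith) (by linarith)

@[simp] theorem arc_add_int_right (a b : ℝ) (n : ℤ) : P.arc a (b + n * P.len) = P.arc a b := by
  obtain ⟨k, hk⟩ := P.exists_eq_add_arc a b
  exact arc_eq (k + n) (by push_cast; linarith) (arc_nonneg _ _) (arc_lt _ _)

@[simp] theorem arc_add_int_left (a b : ℝ) (n : ℤ) : P.arc (a + n * P.len) b = P.arc a b := by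
  obtain ⟨k, hk⟩ := P.exists_eq_add_arc a b
  exact arc_eq (k - n) (by push_cast; linarith) (arc_nonneg _ _) (arc_lt _ _)

theorem arc_pos_of_ne {a b : ℝ} (h : P.γ a ≠ P.γ b) : 0 < P.arc a b := by
  refine lt_of_le_of_ne (arc_nonneg _ _) fun h0 => h ?_
  obtain ⟨n, hn⟩ := P.exists_eq_add_arc a b
  rw [← h0, add_zero] at hn
  exact P.γ_eq_iff.2 ⟨n, hn⟩

/-! ### The breaching points -/

/-- The visible interval is connected and avoids all lifts of an invisible point, so it fits
strictly between two consecutive ones. There arc lengths from and to the defender are plain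
differences. -/
theorem exists_window {x : Plane} {σ sD : ℝ} (hD : sD ∉ P.visible x) :
    ∃ e, (∃ n : ℤ, e = sD + n * P.len) ∧ ∀ s ∈ P.visibleLift x σ, e < s ∧ s < e + P.len := by
  obtain ⟨n, hn⟩ := P.exists_add_int_mem_Ico sD (σ - P.len)
  rw [sub_add_cancel] at hn
  have h1 : sD + n * P.len ∉ P.visible x := fun h => hD ((visible_congr (P.γ_add_int sD n)).1 h)
  have h2 : sD + n * P.len + P.len ∉ P.visible x := fun h =>
    h1 ((visible_congr (P.periodic _)).1 h)
  refine ⟨_, ⟨n, rfl⟩, fun s hs => ⟨?_, ?_⟩⟩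
  · by_contra! hle
    exact h1 (hs (mem_uIcc.2 (Or.inr ⟨hle, hn.2.le⟩)))
  · by_contra! hle
    exact h2 (hs (mem_uIcc.2 (Or.inl ⟨by linarith [hn.1], hle⟩)))

theorem JL_eq {x : Plane} {s sD b e : ℝ} {n k : ℤ} (hs : s = b + n * P.len)
    (he : e = sD + k * P.len) (h0 : e ≤ b) (h1 : b < e + P.len) :
    P.JL ν s sD x = b - e - ‖x - P.γ b‖ / ν := by
  rw [JL, hs, P.γ_add_int, norm_sub_rev, arc_add_int_right, ← arc_add_int_left sD b k, ← he,
    arc_of_le h0 h1]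

theorem JR_eq {x : Plane} {s sD b e : ℝ} {n k : ℤ} (hs : s = b + n * P.len)
    (he : e = sD + k * P.len) (h0 : b ≤ e) (h1 : e < b + P.len) :
    P.JR ν s sD x = e - b - ‖x - P.γ b‖ / ν := by
  rw [JR, hs, P.γ_add_int, norm_sub_rev, arc_add_int_left, ← arc_add_int_right b sD k, ← he,
    arc_of_le h0 h1]

theorem JL_window {x : Plane} {s sD b e : ℝ} {n k : ℤ} (hs : s = b + n * P.len)
    (he : e = sD + k * P.len) (h : e < b ∧ b < e + P.len) :
    P.JL ν s sD x = b - e - ‖x - P.γ b‖ / ν := JL_eq hs he h.1.le h.2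

theorem JR_window {x : Plane} {s sD b e : ℝ} {n k : ℤ} (hs : s = b + n * P.len)
    (he : e = sD + k * P.len) (h : e < b ∧ b < e + P.len) :
    P.JR ν s sD x = e + P.len - b - ‖x - P.γ b‖ / ν :=
  JR_eq (e := e + P.len) (k := k + 1) hs (by push_cast; linarith) h.2.le (by linarith [h.1])

theorem exists_eq_add_int_visibleLift {x : Plane} {s σ : ℝ} (hs : s ∈ P.visible x)
    (hσ : P.γ σ = P.foot x) : ∃ b ∈ P.visibleLift x σ, ∃ n : ℤ, s = b + n * P.len := by
  obtain ⟨n, hn⟩ := exists_add_int_mem_visibleLift hs hσ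
  exact ⟨_, hn, -n, by push_cast; ring⟩

/-- For an invisible defender, `J_L` is `s - d(s)/ν` up to a constant on the lifted visible
interval. A maximizer exists, so the choice in the definition is not vacuous, and whichever
maximizer is chosen has these properties; uniqueness is not needed. -/
theorem sL_spec {x : Plane} {σ : ℝ} (hν₀ : 0 < ν) (hν₁ : ν ≤ 1) (hx : x ∉ P.target)
    (hσ : P.γ σ = P.foot x) :
    ∃ l ∈ P.visibleLift x σ, (∀ s ∈ P.visibleLift x σ,
      s - ‖x - P.γ s‖ / ν ≤ l - ‖x - P.γ l‖ / ν) ∧ ∃ n : ℤ, P.sL ν x = l + n * P.len := by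
  obtain ⟨l, hl, hmax⟩ := exists_max_visibleLift hν₀ hν₁ hx hσ (f := id) fun a b => le_rfl
  obtain ⟨n, hn⟩ := P.exists_add_int_mem_Ico l 0
  rw [zero_add] at hn
  have hex : ∃ s, P.IsLeftBreach ν x s := by
    refine ⟨_, hn, (visible_congr (P.γ_add_int l n)).2 (mem_visible_of_lift hl),
      fun sD hD sB hB => ?_⟩
    obtain ⟨e, ⟨k, hk⟩, he⟩ := exists_window (σ := σ) hD
    obtain ⟨b, hb, j, hj⟩ := exists_eq_add_int_visibleLift hB hσ
    rw [JL_window hj hk (he b hb), JL_window rfl hk (he l hl)]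
    have := hmax b hb
    simp only [id] at this
    linarith
  obtain ⟨-, hvis, hbest⟩ := Classical.epsilon_spec hex
  obtain ⟨b, hb, j, hj⟩ := exists_eq_add_int_visibleLift hvis hσ
  refine ⟨b, hb, fun s hs => ?_, j, hj⟩
  obtain ⟨e₀, he₀⟩ := exists_notMem_visible hx
  obtain ⟨e, ⟨k, hk⟩, he⟩ := exists_window (σ := σ) he₀
  have := hbest e₀ he₀ s (mem_visible_of_lift hs)
  rw [JL_window (n := 0) (by simp) hk (he s hs), JL_window hj hk (he b hb)] at this
  linarith

theorem sR_spec {x : Plane} {σ : ℝ} (hν₀ : 0 < ν) (hν₁ : ν ≤ 1) (hx : x ∉ P.target)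
    (hσ : P.γ σ = P.foot x) :
    ∃ r ∈ P.visibleLift x σ, (∀ s ∈ P.visibleLift x σ,
      r + ‖x - P.γ r‖ / ν ≤ s + ‖x - P.γ s‖ / ν) ∧ ∃ n : ℤ, P.sR ν x = r + n * P.len := by
  obtain ⟨l, hl, hmax⟩ := exists_max_visibleLift hν₀ hν₁ hx hσ (f := fun s => -s) fun a b => by
    rw [show -a - -b = -(a - b) by ring, abs_neg]
  obtain ⟨n, hn⟩ := P.exists_add_int_mem_Ico l 0
  rw [zero_add] at hn
  have hex : ∃ s, P.IsRightBreach ν x s := by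
    refine ⟨_, hn, (visible_congr (P.γ_add_int l n)).2 (mem_visible_of_lift hl),
      fun sD hD sB hB => ?_⟩
    obtain ⟨e, ⟨k, hk⟩, he⟩ := exists_window (σ := σ) hD
    obtain ⟨b, hb, j, hj⟩ := exists_eq_add_int_visibleLift hB hσ
    rw [JR_window hj hk (he b hb), JR_window rfl hk (he l hl)]
    have := hmax b hb
    linarith
  obtain ⟨-, hvis, hbest⟩ := Classical.epsilon_spec hex
  obtain ⟨b, hb, j, hj⟩ := exists_eq_add_int_visibleLift hvis hσ
  refine ⟨b, hb, fun s hs => ?_, j, hj⟩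
  obtain ⟨e₀, he₀⟩ := exists_notMem_visible hx
  obtain ⟨e, ⟨k, hk⟩, he⟩ := exists_window (σ := σ) he₀
  have := hbest e₀ he₀ s (mem_visible_of_lift hs)
  rw [JR_window (n := 0) (by simp) hk (he s hs), JR_window hj hk (he b hb)] at this
  linarith

theorem norm_sub_foot_le (x : Plane) {z : Plane} (hz : z ∈ P.target) :
    ‖x - P.foot x‖ ≤ ‖x - z‖ := by
  have h1 := P.inner_foot_le x hz
  have h2 : inner ℝ (x - P.foot x) (x - z) =
      ‖x - P.foot x‖ ^ 2 - inner ℝ (x - P.foot x) (z - P.foot x) := by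
    rw [← real_inner_self_eq_norm_sq, ← inner_sub_right]; congr 1; abel
  have h3 := real_inner_le_norm (x - P.foot x) (x - z)
  by_contra! h
  nlinarith [norm_nonneg (x - z), norm_nonneg (x - P.foot x)]

variable (P ν) in
/-- Lifts to the line of the nearest point and the breaching points of `x`; the defender positions
`s` in the lift have `J_L^* = A - s` and `J_R^* = s - B`. -/
structure BreachLift (x : Plane) (σ l r A B : ℝ) : Prop where
  notMem : x ∉ P.target
  foot : P.γ σ = P.foot x
  l_mem : l ∈ P.visibleLift x σ
  r_mem : r ∈ P.visibleLift x σ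
  A_eq : A = l - ‖x - P.γ l‖ / ν
  B_eq : B = r + ‖x - P.γ r‖ / ν
  le_A : ∀ s ∈ P.visibleLift x σ, s - ‖x - P.γ s‖ / ν ≤ A
  B_le : ∀ s ∈ P.visibleLift x σ, B ≤ s + ‖x - P.γ s‖ / ν
  sL_eq : ∃ n : ℤ, P.sL ν x = l + n * P.len
  sR_eq : ∃ n : ℤ, P.sR ν x = r + n * P.len

theorem exists_breachLift {x : Plane} {σ : ℝ} (hν₀ : 0 < ν) (hν₁ : ν ≤ 1) (hx : x ∉ P.target)
    (hσ : P.γ σ = P.foot x) : ∃ l r A B, P.BreachLift ν x σ l r A B := by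
  obtain ⟨l, hl, hmax, hsL⟩ := sL_spec hν₀ hν₁ hx hσ
  obtain ⟨r, hr, hmin, hsR⟩ := sR_spec hν₀ hν₁ hx hσ
  exact ⟨l, r, _, _, hx, hσ, hl, hr, rfl, rfl, hmax, hmin, hsL, hsR⟩

theorem visibleLift_add_int {x : Plane} {σ s : ℝ} (hs : s ∈ P.visibleLift x σ) (n : ℤ) :
    s + n * P.len ∈ P.visibleLift x (σ + n * P.len) := by
  intro a ha
  have h1 : a - n * P.len ∈ uIcc σ s := by
    rw [mem_uIcc] at ha ⊢
    grind
  have h2 := hs h1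
  rwa [← visible_congr (P.γ_add_int _ n), sub_add_cancel] at h2

namespace BreachLift

variable {x : Plane} {σ l r A B : ℝ}

theorem add_int (h : P.BreachLift ν x σ l r A B) (n : ℤ) :
    P.BreachLift ν x (σ + n * P.len) (l + n * P.len) (r + n * P.len) (A + n * P.len)
      (B + n * P.len) := by
  have hback : ∀ s ∈ P.visibleLift x (σ + n * P.len), s - n * P.len ∈ P.visibleLift x σ ∧
      P.γ s = P.γ (s - n * P.len) := by
    intro s hs
    constructor
    · have := visibleLift_add_int hs (-n)
      push_cast at this
      rwa [show σ + n * P.len + -n * P.len = σ by ring,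
        show s + -n * P.len = s - n * P.len by ring] at this
    · rw [← P.γ_add_int (s - n * P.len) n, sub_add_cancel]
  obtain ⟨j, hj⟩ := h.sL_eq
  obtain ⟨k, hk⟩ := h.sR_eq
  refine ⟨h.notMem, by rw [P.γ_add_int, h.foot], visibleLift_add_int h.l_mem n,
    visibleLift_add_int h.r_mem n, by rw [P.γ_add_int, h.A_eq]; ring,
    by rw [P.γ_add_int, h.B_eq]; ring, fun s hs => ?_, fun s hs => ?_,
    ⟨j - n, by rw [hj]; push_cast; ring⟩, ⟨k - n, by rw [hk]; push_cast; ring⟩⟩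
  · rw [(hback s hs).2]; linarith [h.le_A _ (hback s hs).1]
  · rw [(hback s hs).2]; linarith [h.B_le _ (hback s hs).1]

variable (h : P.BreachLift ν x σ l r A B)
include h

theorem abs_sub_lt (hν₀ : 0 < ν) (hν₁ : ν ≤ 1) {s : ℝ} (hs : s ∈ P.visibleLift x σ) :
    |s - σ| < ‖x - P.γ s‖ / ν := by
  refine (abs_sub_lt_of_mem_visibleLift hs h.foot).trans_le ?_
  rw [le_div_iff₀ hν₀]; nlinarith [norm_nonneg (x - P.γ s)]

/-- A defender at the foot is strictly earlier at every visible point than the intruder. -/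
theorem A_lt (hν₀ : 0 < ν) (hν₁ : ν ≤ 1) : A < σ := by
  have := (abs_lt.1 (h.abs_sub_lt hν₀ hν₁ h.l_mem)).2
  rw [h.A_eq]; linarith

theorem lt_B (hν₀ : 0 < ν) (hν₁ : ν ≤ 1) : σ < B := by
  have := (abs_lt.1 (h.abs_sub_lt hν₀ hν₁ h.r_mem)).1
  rw [h.B_eq]; linarith

theorem le_l (hν₀ : 0 < ν) : σ ≤ l := by
  have h1 := h.le_A σ (self_mem_visibleLift h.notMem h.foot)
  have h2 := div_le_div_of_nonneg_right (norm_sub_foot_le x (P.γ_mem_target l)) hν₀.le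
  rw [h.A_eq, h.foot] at h1; linarith

theorem r_le (hν₀ : 0 < ν) : r ≤ σ := by
  have h1 := h.B_le σ (self_mem_visibleLift h.notMem h.foot)
  have h2 := div_le_div_of_nonneg_right (norm_sub_foot_le x (P.γ_mem_target r)) hν₀.le
  rw [h.B_eq, h.foot] at h1; linarith

/-- Add `r - d(r)/ν ≤ A` to `r + d(r)/ν = B`. -/
theorem r_le_center : r ≤ (A + B) / 2 := by
  have := h.le_A r h.r_mem
  have h1 := h.B_eq
  linarith

theorem center_le_l : (A + B) / 2 ≤ l := by
  have := h.B_le l h.l_mem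
  have h1 := h.A_eq
  linarith

theorem l_lt : l < r + P.len := by
  have := (abs_lt.1 (abs_sub_lt_of_visibleLift h.l_mem h.r_mem)).2
  linarith

theorem JLstar_eq {s e : ℝ} {k : ℤ} (he : e = s + k * P.len) (h0 : e ≤ l) (h1 : l < e + P.len) :
    P.JLstar ν s x = A - e := by
  obtain ⟨n, hn⟩ := h.sL_eq
  rw [JLstar, JL_eq hn he h0 h1, h.A_eq]; ring

theorem JRstar_eq {s e : ℝ} {k : ℤ} (he : e = s + k * P.len) (h0 : r ≤ e) (h1 : e < r + P.len) :
    P.JRstar ν s x = e - B := by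
  obtain ⟨n, hn⟩ := h.sR_eq
  rw [JRstar, JR_eq hn he h0 h1, h.B_eq]; ring

theorem arc_sL (a : ℝ) : P.arc a (P.sL ν x) = P.arc a l := by
  obtain ⟨n, hn⟩ := h.sL_eq
  rw [hn, arc_add_int_right]

theorem arc_sR (a : ℝ) : P.arc a (P.sR ν x) = P.arc a r := by
  obtain ⟨n, hn⟩ := h.sR_eq
  rw [hn, arc_add_int_right]

theorem sR_arc (a : ℝ) : P.arc (P.sR ν x) a = P.arc r a := by
  obtain ⟨n, hn⟩ := h.sR_eq
  rw [hn, arc_add_int_left]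

/-- For a lifted defender `e` in `[r, l]` the equation `J_L^* = J_R^*` reads `A - e = e - B`, and
its solution does lie in `[r, l]`. -/
theorem mem_afferent_iff {s : ℝ} :
    x ∈ P.afferent ν s ↔ ∃ n : ℤ, s = (A + B) / 2 + n * P.len := by
  have h1 := h.r_le_center
  have h2 := h.center_le_l
  have h3 := h.l_lt
  have hseg : s ∈ P.seg (P.sR ν x) (P.sL ν x) ↔ P.arc r s ≤ l - r := by
    rw [seg, mem_ofPred_eq, h.sR_arc, h.sR_arc, h.arc_sL, arc_of_le (by linarith) h3]
  have hJ : ∀ (e : ℝ) (k : ℤ), e = s + k * P.len → r ≤ e → e ≤ l →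
      P.JLstar ν s x = A - e ∧ P.JRstar ν s x = e - B := fun e k he hr hl =>
    ⟨h.JLstar_eq he hl (by linarith), h.JRstar_eq he hr (by linarith)⟩
  constructor
  · rintro ⟨-, hs, hJJ⟩
    rw [hseg] at hs
    obtain ⟨n, hn⟩ := P.exists_eq_add_arc r s
    obtain ⟨e1, e2⟩ := hJ (r + P.arc r s) (-n) (by push_cast; linarith)
      (by linarith [P.arc_nonneg r s]) (by linarith)
    exact ⟨n, by linarith⟩
  · rintro ⟨n, hn⟩
    refine ⟨h.notMem, ?_, ?_⟩
    · rw [hseg, hn, arc_add_int_right, arc_of_le h1 (by linarith)]; linarith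
    · obtain ⟨e1, e2⟩ := hJ ((A + B) / 2) (-n) (by push_cast; linarith) h1 h2
      linarith

theorem mem_sector_iff {a b : ℝ} : x ∈ P.sector ν a b ↔ P.arc a ((A + B) / 2) ≤ P.arc a b := by
  constructor
  · rintro ⟨s, hs, hx⟩
    obtain ⟨n, rfl⟩ := h.mem_afferent_iff.1 hx
    rwa [seg, mem_ofPred_eq, arc_add_int_right] at hs
  · exact fun hle => ⟨_, hle, h.mem_afferent_iff.2 ⟨0, by simp⟩⟩

/-- Both candidate values, `A - e` and `e - B`, are nonpositive, so it does not matter which case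
the definition selects. -/
theorem V_nonpos {s e : ℝ} {k : ℤ} (he : e = s + k * P.len) (hr : r ≤ e) (hl : e ≤ l)
    (hA : A ≤ e) (hB : e ≤ B) : P.V ν s x ≤ 0 := by
  have h3 := h.l_lt
  rw [V]
  split_ifs
  · rw [h.JLstar_eq he hl (by linarith)]; linarith
  · rw [h.JRstar_eq he hr (by linarith)]; linarith

end BreachLift

theorem mem_sector_or {a b : ℝ} {x : Plane} (hν₀ : 0 < ν) (hν₁ : ν ≤ 1) (hab : P.γ a ≠ P.γ b)
    (hx : x ∉ P.target) : x ∈ P.sector ν a b ∨ x ∈ P.sector ν b a := by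
  obtain ⟨σ, hσ⟩ := P.exists_γ_eq_foot (P.notMem_interior_of_notMem hx)
  obtain ⟨l, r, A, B, h⟩ := exists_breachLift hν₀ hν₁ hx hσ
  rw [h.mem_sector_iff, h.mem_sector_iff]
  set c := (A + B) / 2
  by_contra! hc
  obtain ⟨n, hn⟩ := P.exists_eq_add_arc a b
  obtain ⟨k, hk⟩ := P.exists_eq_add_arc a c
  have h0 := arc_pos_of_ne hab
  have h1 : P.arc b a = P.len - P.arc a b :=
    arc_eq (-n - 1) (by push_cast; linarith) (by linarith [P.arc_lt a b]) (by linarith)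
  have h2 : P.arc b c = P.arc a c - P.arc a b :=
    arc_eq (k - n) (by push_cast; linarith) (by linarith) (by linarith [P.arc_lt a c])
  linarith [P.arc_lt a c]

/-! ### Two defenders -/

variable (P ν) in
/-- Lifts for a state of the two vs. one game: the defenders are at `si` and
`si + arc si sj`. -/
structure PairLift (x : Plane) (si sj σ l r A B : ℝ) : Prop
    extends P.BreachLift ν x σ l r A B where
  arc_pos : 0 < P.arc si sj
  le_center : si ≤ (A + B) / 2
  center_le : (A + B) / 2 ≤ si + P.arc si sj

theorem exists_pairLift {x : Plane} {si sj : ℝ} (hν₀ : 0 < ν) (hν₁ : ν ≤ 1)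
    (hne : P.γ si ≠ P.γ sj) (hs : x ∈ P.sector ν si sj) :
    ∃ σ l r A B, P.PairLift ν x si sj σ l r A B := by
  have hx : x ∉ P.target := by obtain ⟨s, -, hs⟩ := hs; exact hs.1
  obtain ⟨σ, hσ⟩ := P.exists_γ_eq_foot (P.notMem_interior_of_notMem hx)
  obtain ⟨l, r, A, B, h⟩ := exists_breachLift hν₀ hν₁ hx hσ
  obtain ⟨n, hn⟩ := P.exists_add_int_mem_Ico ((A + B) / 2) si
  have h' := h.add_int n
  have hc : (A + n * P.len + (B + n * P.len)) / 2 = (A + B) / 2 + n * P.len := by ring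
  have hsec := h'.mem_sector_iff.1 hs
  rw [hc, arc_of_le hn.1 hn.2] at hsec
  exact ⟨_, _, _, _, _, ⟨h', arc_pos_of_ne hne, by rw [hc]; exact hn.1, by rw [hc]; linarith⟩⟩

theorem mid_eq (si sj : ℝ) : P.mid si sj = si + P.arc si sj / 2 := rfl

namespace PairLift

variable {x : Plane} {si sj σ l r A B : ℝ} (h : P.PairLift ν x si sj σ l r A B)
include h

theorem le_l' : si ≤ l := h.le_center.trans h.center_le_l

theorem arc_mid : P.arc si (P.mid si sj) = P.arc si sj / 2 := by
  have := h.arc_pos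
  rw [arc_of_le] <;> rw [mid_eq] <;> linarith [P.arc_lt si sj]

theorem arc_mid' : P.arc (P.mid si sj) sj = P.arc si sj / 2 := by
  have := h.arc_pos
  obtain ⟨n, hn⟩ := P.exists_eq_add_arc si sj
  refine arc_eq n ?_ (by linarith) (by linarith [P.arc_lt si sj])
  rw [mid_eq]; linarith

/-- The sector condition only excludes `l ≥ si + len`, where the arc length from `si` to `s_L` wraps
around and would be misleadingly small. -/
theorem mem_regionI_iff : x ∈ P.regionI ν si sj ↔ l < P.mid si sj := by
  have h1 := h.le_center
  have h2 := h.center_le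
  have h3 := h.center_le_l
  have h4 := h.r_le_center
  have h5 := h.l_lt
  have h6 := P.arc_lt si sj
  have h7 := h.arc_pos
  have hc : P.arc si ((A + B) / 2) = (A + B) / 2 - si := arc_of_le h1 (by linarith)
  rw [regionI, mem_ofPred_eq, h.mem_sector_iff, h.arc_sL, h.arc_mid, mid_eq, hc]
  rcases lt_or_ge l (si + P.len) with hl | hl
  · rw [arc_of_le h.le_l' hl]
    constructor
    · rintro ⟨h8, -⟩; linarith
    · intro h8; constructor <;> linarith
  · rw [arc_eq (c := l - si - P.len) 1 (by push_cast; ring) (by linarith) (by linarith)]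
    constructor
    · rintro ⟨h8, h9⟩; linarith
    · intro h8; linarith

theorem mem_regionJ_iff : x ∈ P.regionJ ν si sj ↔ P.mid si sj < r := by
  have h1 := h.le_center
  have h2 := h.center_le
  have h3 := h.center_le_l
  have h4 := h.r_le_center
  have h5 := h.l_lt
  have h6 := P.arc_lt si sj
  have h7 := h.arc_pos
  obtain ⟨n, hn⟩ := P.exists_eq_add_arc si sj
  have hc : P.arc r ((A + B) / 2) = (A + B) / 2 - r := arc_of_le h4 (by linarith)
  rw [regionJ, mem_ofPred_eq, h.mem_sector_iff, h.sR_arc, h.sR_arc, h.arc_mid', mid_eq,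
    hc]
  rcases lt_or_ge (si + P.arc si sj) (r + P.len) with hl | hl
  · rw [arc_eq (c := si + P.arc si sj - r) n (by linarith) (by linarith) (by linarith)]
    constructor
    · rintro ⟨h8, -⟩; linarith
    · intro h8; constructor <;> linarith
  · rw [arc_eq (c := si + P.arc si sj - r - P.len) (n + 1) (by push_cast; linarith) (by linarith)
      (by linarith)]
    constructor
    · rintro ⟨h8, h9⟩; linarith
    · intro h8; linarith

theorem JLstar_si (hl : l < P.mid si sj) : P.JLstar ν si x = A - si := by
  have h6 := P.arc_lt si sj
  have h7 := h.arc_pos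
  rw [mid_eq] at hl
  exact h.JLstar_eq (k := 0) (by simp) h.le_l' (by linarith)

theorem JRstar_sj (hr : P.mid si sj < r) : P.JRstar ν sj x = si + P.arc si sj - B := by
  have h6 := P.arc_lt si sj
  have h7 := h.arc_pos
  have h4 := h.r_le_center
  have h2 := h.center_le
  obtain ⟨n, hn⟩ := P.exists_eq_add_arc si sj
  rw [mid_eq] at hr
  exact h.JRstar_eq (k := -n) (by push_cast; linarith) (by linarith) (by linarith)

theorem Vij_of_lt (hl : l < P.mid si sj) : P.Vij ν si sj x = A - si := by
  rw [Vij, if_pos (h.mem_regionI_iff.2 hl), h.JLstar_si hl]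

theorem Vij_of_gt (hr : P.mid si sj < r) : P.Vij ν si sj x = si + P.arc si sj - B := by
  have hl : ¬ l < P.mid si sj := by linarith [h.r_le_center, h.center_le_l]
  rw [Vij, if_neg (fun hc => hl (h.mem_regionI_iff.1 hc)), if_pos (h.mem_regionJ_iff.2 hr),
    h.JRstar_sj hr]

theorem Vij_of_mid (hl : P.mid si sj ≤ l) (hr : r ≤ P.mid si sj) :
    P.Vij ν si sj x = P.arc si sj / 2 - ‖x - P.γ (P.mid si sj)‖ / ν := by
  rw [Vij, if_neg (fun hc => not_lt.2 hl (h.mem_regionI_iff.1 hc)),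
    if_neg (fun hc => not_lt.2 hr (h.mem_regionJ_iff.1 hc)), Jmid, norm_sub_rev]

/-- As `s_L` is in `S_L`, `V` can fail to be `J_L^*` by definition only if `s_R` is in `S_R` and
`J_L^* ≤ J_R^*`. Then `r ≤ si`, and `si ≤ (A + B)/2` gives the reverse inequality, so the two values
coincide. -/
theorem V_si (hν₀ : 0 < ν) (hν₁ : ν ≤ 1) (hl : l < P.mid si sj) : P.V ν si x = A - si := by
  have h6 := P.arc_lt si sj
  have h7 := h.arc_pos
  have h1 := h.le_center
  have hAB : A < B := (h.A_lt hν₀ hν₁).trans (h.lt_B hν₀ hν₁)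
  have hl' := hl
  rw [mid_eq] at hl'
  have hrl : r ≤ l := h.r_le_center.trans h.center_le_l
  have hopp : P.arc si (P.opp si) = P.len / 2 := by
    rw [arc_of_le] <;> simp only [opp] <;> linarith [P.len_pos]
  have hopp' : P.arc (P.opp si) si = P.len / 2 :=
    arc_eq (-1) (by simp only [opp]; push_cast; ring) (by linarith [P.len_pos])
      (by linarith [P.len_pos])
  have hSL : P.sL ν x ∈ P.seg si (P.opp si) := by
    rw [seg, mem_ofPred_eq, h.arc_sL, hopp, arc_of_le h.le_l' (by linarith)]; linarith
  have hJL := h.JLstar_si hl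
  rw [V]
  split_ifs with hreg
  · exact hJL
  · have hSR : P.sR ν x ∈ P.seg (P.opp si) si := by
      by_contra hc
      exact hreg (Or.inl (Or.inr ⟨hSL, hc⟩))
    have hJ : P.JLstar ν si x ≤ P.JRstar ν si x := by
      by_contra! hc
      exact hreg (Or.inl (Or.inl ⟨hSL, hSR, hc⟩))
    have hr : r ≤ si := by
      by_contra! hc
      rw [seg, mem_ofPred_eq, h.arc_sR, hopp', arc_eq (c := r - si + P.len / 2) (-1)
        (by simp only [opp]; push_cast; ring) (by linarith) (by linarith)] at hSR
      linarith
    have hJR := h.JRstar_eq (s := si) (e := si) (k := 0) (by simp) hr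
      (by linarith [h.l_lt, h.le_l'])
    linarith

/-- As `s_R` is in `S_R`, only `s_L` in `S_L` with `J_R^* < J_L^*` could select the other value.
Either `l` is too close to `D_j` on the cw side to be in `S_L`, or `(A + B)/2` not exceeding the
lift of `sj` contradicts the strict inequality. -/
theorem V_sj (hr : P.mid si sj < r) : P.V ν sj x = si + P.arc si sj - B := by
  have h6 := P.arc_lt si sj
  have h7 := h.arc_pos
  have h1 := h.center_le
  have h4 := h.r_le_center
  have h3 := h.center_le_l
  obtain ⟨n, hn⟩ := P.exists_eq_add_arc si sj
  have hr' := hr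
  rw [mid_eq] at hr'
  have hopp : P.arc sj (P.opp sj) = P.len / 2 := by
    rw [arc_of_le] <;> simp only [opp] <;> linarith [P.len_pos]
  have hopp' : P.arc (P.opp sj) sj = P.len / 2 :=
    arc_eq (-1) (by simp only [opp]; push_cast; ring) (by linarith [P.len_pos])
      (by linarith [P.len_pos])
  have hSR : P.sR ν x ∈ P.seg (P.opp sj) sj := by
    rw [seg, mem_ofPred_eq, h.arc_sR, hopp', arc_eq (c := r - (si + P.arc si sj) + P.len / 2)
      (-n - 1) (by simp only [opp]; push_cast; linarith) (by linarith) (by linarith)]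
    linarith
  have hJR := h.JRstar_sj hr
  rw [V]
  split_ifs with hreg
  · have hreg' : P.sL ν x ∈ P.seg sj (P.opp sj) ∧ P.JRstar ν sj x < P.JLstar ν sj x := by
      rcases hreg with (⟨h8, -, h9⟩ | ⟨-, h9⟩) | ⟨-, h9, -⟩
      · exact ⟨h8, h9⟩
      · exact absurd hSR h9
      · exact absurd hSR h9
    obtain ⟨h8, h9⟩ := hreg'
    exfalso
    rcases lt_or_ge l (si + P.arc si sj) with hl | hl
    · rw [seg, mem_ofPred_eq, h.arc_sL, hopp, arc_eq (c := l - (si + P.arc si sj) + P.len)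
        (-n - 1) (by push_cast; linarith) (by linarith) (by linarith)] at h8
      linarith
    · have hJL := h.JLstar_eq (s := sj) (e := si + P.arc si sj) (k := -n)
        (by push_cast; linarith) hl (by linarith [h.l_lt])
      linarith
  · exact hJR

/-- If the value is not positive, every visible point is covered by one of the defenders. -/
theorem covered (hν₀ : 0 < ν) {s : ℝ} (hs : s ∈ P.visibleLift x σ) :
    |s - si| + min (-P.Vij ν si sj x) ((B - A) / 2) ≤ ‖x - P.γ s‖ / ν ∨
      |s - (si + P.arc si sj)| + min (-P.Vij ν si sj x) ((B - A) / 2) ≤ ‖x - P.γ s‖ / ν := by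
  have h1 := h.le_center
  have h2 := h.center_le
  have hA := h.le_A s hs
  have hB := h.B_le s hs
  have m1 := min_le_left (-P.Vij ν si sj x) ((B - A) / 2)
  have m2 := min_le_right (-P.Vij ν si sj x) ((B - A) / 2)
  -- In `R_i` the defender `D_i` covers everything: ccw of `si` by `s - d/ν ≤ A` with margin `-V_ij
  -- = si - A`, cw of `si` by `B ≤ s + d/ν` and `si ≤ (A + B)/2` with margin `(B - A)/2`. `R_j` is
  -- the mirror image.
  rcases lt_or_ge l (P.mid si sj) with hl | hl
  · left
    rw [h.Vij_of_lt hl] at m1 ⊢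
    have : |s - si| ≤ ‖x - P.γ s‖ / ν - min (-(A - si)) ((B - A) / 2) :=
      abs_le.2 ⟨by linarith, by linarith⟩
    linarith
  rcases lt_or_ge (P.mid si sj) r with hr | hr
  · right
    rw [h.Vij_of_gt hr] at m1 ⊢
    have : |s - (si + P.arc si sj)| ≤
        ‖x - P.γ s‖ / ν - min (-(si + P.arc si sj - B)) ((B - A) / 2) :=
      abs_le.2 ⟨by linarith, by linarith⟩
    linarith
  -- In the middle region the defenders share the work: points ccw of the midpoint go to `D_j`, the
  -- others to `D_i`. Monotonicity away from `r`, respectively towards `l`, reduces them to the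
  -- midpoint itself.
  rw [h.Vij_of_mid hl hr] at m1 m2 ⊢
  have hm := mid_eq (P := P) si sj
  rcases le_total (P.mid si sj) s with hms | hms
  · right
    have h3 := add_div_le_of_min hν₀ h.foot h.r_mem hs
      (fun s' hs' => h.B_eq ▸ h.B_le s' hs') hr hms
    generalize min (-(P.arc si sj / 2 - ‖x - P.γ (P.mid si sj)‖ / ν)) ((B - A) / 2) = ε at *
    have : |s - (si + P.arc si sj)| ≤ ‖x - P.γ s‖ / ν - ε :=
      abs_le.2 ⟨by linarith, by linarith⟩
    linarith
  · left
    have h3 := sub_div_le_of_max hν₀ h.foot h.l_mem hs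
      (fun s' hs' => h.A_eq ▸ h.le_A s' hs') hms hl
    generalize min (-(P.arc si sj / 2 - ‖x - P.γ (P.mid si sj)‖ / ν)) ((B - A) / 2) = ε at *
    have : |s - si| ≤ ‖x - P.γ s‖ / ν - ε :=
      abs_le.2 ⟨by linarith, by linarith⟩
    linarith

/-- If the value is `v`, the intruder reaches the optimal breaching point at least `v` before the
defenders. -/
theorem sOpt_spec : ∃ s ∈ P.visibleLift x σ, P.γ (P.sOpt ν si sj x) = P.γ s ∧
    ‖x - P.γ s‖ / ν + P.Vij ν si sj x ≤ s - si ∧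
      ‖x - P.γ s‖ / ν + P.Vij ν si sj x ≤ si + P.arc si sj - s := by
  have hm := mid_eq (P := P) si sj
  rcases lt_or_ge l (P.mid si sj) with hl | hl
  · obtain ⟨n, hn⟩ := h.sL_eq
    have := h.A_eq
    refine ⟨l, h.l_mem, ?_, ?_, ?_⟩
    · rw [sOpt, if_pos (h.mem_regionI_iff.2 hl), hn, P.γ_add_int]
    all_goals rw [h.Vij_of_lt hl]; linarith
  have hI : x ∉ P.regionI ν si sj := fun hc => not_lt.2 hl (h.mem_regionI_iff.1 hc)
  rcases lt_or_ge (P.mid si sj) r with hr | hr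
  · obtain ⟨n, hn⟩ := h.sR_eq
    have := h.B_eq
    refine ⟨r, h.r_mem, ?_, ?_, ?_⟩
    · rw [sOpt, if_neg hI, if_pos (h.mem_regionJ_iff.2 hr), hn, P.γ_add_int]
    all_goals rw [h.Vij_of_gt hr]; linarith
  have hJ : x ∉ P.regionJ ν si sj := fun hc => not_lt.2 hr (h.mem_regionJ_iff.1 hc)
  refine ⟨P.mid si sj, uIcc_subset_visibleLift h.r_mem h.l_mem (Icc_subset_uIcc ⟨hr, hl⟩),
    ?_, ?_, ?_⟩
  · rw [sOpt, if_neg hI, if_neg hJ]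
  all_goals rw [h.Vij_of_mid hl hr]; linarith

theorem Vij_eq_zero_iff (hν₀ : 0 < ν) (hν₁ : ν ≤ 1) : P.Vij ν si sj x = 0 ↔
    (x ∈ P.regionI ν si sj ∧ P.V ν si x = 0) ∨ (x ∈ P.regionJ ν si sj ∧ P.V ν sj x = 0) ∨
      (x ∉ P.regionI ν si sj ∧ x ∉ P.regionJ ν si sj ∧
        ‖x - P.γ (P.mid si sj)‖ = 1 / 2 * ν * P.arc si sj) := by
  rw [h.mem_regionI_iff, h.mem_regionJ_iff]
  have hrl := h.r_le_center.trans h.center_le_l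
  rcases lt_or_ge l (P.mid si sj) with hl | hl
  · have hr : ¬ P.mid si sj < r := by linarith
    rw [h.Vij_of_lt hl, h.V_si hν₀ hν₁ hl]
    simp [hl, hr]
  rcases lt_or_ge (P.mid si sj) r with hr | hr
  · rw [h.Vij_of_gt hr, h.V_sj hr]
    simp [hl.not_gt, hr]
  · rw [h.Vij_of_mid hl hr]
    simp only [hl.not_gt, hr.not_gt, false_and, false_or, not_false_eq_true, true_and]
    rw [sub_eq_zero, eq_div_iff hν₀.ne']
    constructor <;> intro h1 <;> linarith

end PairLift

end Perimeter
end

noncomputable section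

namespace Perimeter

variable {P : Perimeter} {ν : ℝ}

/-! ### Motions of the intruder -/

theorem IsIntruderMotion.continuousOn {x : Plane} {y : ℝ → Plane} (hy : IsIntruderMotion ν x y) :
    ContinuousOn y (Ici 0) := by
  refine (LipschitzOnWith.of_dist_le_mul (K := ν.toNNReal) fun a ha b hb => ?_).continuousOn
  rw [dist_eq_norm, Real.dist_eq]
  exact (hy.2 a b ha hb).trans
    (mul_le_mul_of_nonneg_right (Real.le_coe_toNNReal ν) (abs_nonneg _))

theorem IsIntruderMotion.continuousOn_Icc {x : Plane} {y : ℝ → Plane}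
    (hy : IsIntruderMotion ν x y) (t : ℝ) : ContinuousOn y (Icc 0 t) :=
  hy.continuousOn.mono Icc_subset_Ici_self

theorem isIntruderMotion_const (hν₀ : 0 < ν) (x : Plane) : IsIntruderMotion ν x fun _ => x :=
  ⟨rfl, fun t t' _ _ => by simpa using mul_nonneg hν₀.le (abs_nonneg _)⟩

theorem IsIntruderMotion.shift {x : Plane} {y : ℝ → Plane} (hy : IsIntruderMotion ν x y) {τ : ℝ}
    (hτ : 0 ≤ τ) : IsIntruderMotion ν (y τ) fun t => y (τ + t) :=
  ⟨by simp, fun t t' ht ht' => by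
    have := hy.2 (τ + t) (τ + t') (by linarith) (by linarith)
    rwa [add_sub_add_left_eq_sub] at this⟩

/-- The motion `y`, continued with `y'` from the time `τ` on. -/
def continueWith {E : Type} (τ : ℝ) (y y' : ℝ → E) (t : ℝ) : E := if t ≤ τ then y t else y' (t - τ)

theorem continueWith_of_le {E : Type} {τ t : ℝ} (y y' : ℝ → E) (h : t ≤ τ) :
    continueWith τ y y' t = y t := if_pos h

theorem continueWith_of_ge {E : Type} {τ t : ℝ} {y y' : ℝ → E} (h0 : y' 0 = y τ) (h : τ ≤ t) :
    continueWith τ y y' t = y' (t - τ) := by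
  rcases h.eq_or_lt with rfl | h
  · rw [continueWith_of_le _ _ le_rfl, sub_self, h0]
  · exact if_neg (not_le.2 h)

theorem IsIntruderMotion.continueWith {x : Plane} {y y' : ℝ → Plane} {τ : ℝ}
    (hy : IsIntruderMotion ν x y) (hτ : 0 ≤ τ) (hy' : IsIntruderMotion ν (y τ) y') :
    IsIntruderMotion ν x (continueWith τ y y') := by
  refine ⟨by rw [continueWith_of_le _ _ hτ, hy.1], fun t t' ht ht' => ?_⟩
  wlog h : t ≤ t' generalizing t t'
  · rw [norm_sub_rev, abs_sub_comm]; exact this t' t ht' ht (le_of_not_ge h)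
  rcases le_total t' τ with h1 | h1
  · rw [continueWith_of_le _ _ h1, continueWith_of_le _ _ (h.trans h1)]
    exact hy.2 t t' ht ht'
  rcases le_total τ t with h2 | h2
  · rw [continueWith_of_ge hy'.1 h1, continueWith_of_ge hy'.1 h2]
    have := hy'.2 (t - τ) (t' - τ) (by linarith) (by linarith)
    rwa [sub_sub_sub_cancel_right] at this
  · rw [continueWith_of_ge hy'.1 h1, continueWith_of_le _ _ h2]
    have e1 := hy.2 t τ ht hτ
    have e2 := hy'.2 0 (t' - τ) le_rfl (by linarith)
    rw [hy'.1, zero_sub, abs_neg, abs_of_nonneg (by linarith)] at e2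
    rw [abs_of_nonpos (by linarith)] at e1 ⊢
    have e3 := norm_sub_le_norm_sub_add_norm_sub (y t) (y τ) (y' (t' - τ))
    linarith

theorem IsLift.continueWith {y y' : ℝ → Plane} {τ t : ℝ} {g g' : ℝ → ℝ} (hτ : 0 ≤ τ) (ht : 0 ≤ t)
    (h : P.IsLift y τ g) (h' : P.IsLift y' t g') (hy0 : y' 0 = y τ) (hg0 : g' 0 = g τ) :
    P.IsLift (continueWith τ y y') (τ + t) (continueWith τ g g') := by
  constructor
  · rw [← Icc_union_Icc_eq_Icc hτ (show τ ≤ τ + t by linarith)]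
    refine ContinuousOn.union_of_isClosed ?_ ?_ isClosed_Icc isClosed_Icc
    · exact h.1.congr fun a ha => continueWith_of_le _ _ ha.2
    · have hc : ContinuousOn (fun a => g' (a - τ)) (Icc τ (τ + t)) :=
        h'.1.comp (by fun_prop) fun a ha => ⟨by linarith [ha.1], by linarith [ha.2]⟩
      exact hc.congr fun a ha => continueWith_of_ge hg0 ha.1
  · intro a ha
    rcases le_total a τ with h1 | h1
    · rw [continueWith_of_le _ _ h1, continueWith_of_le _ _ h1, h.2 a ⟨ha.1, h1⟩]
    · rw [continueWith_of_ge hg0 h1, continueWith_of_ge hy0 h1,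
        h'.2 _ ⟨by linarith, by linarith [ha.2]⟩]

theorem IsLift.shift {y : ℝ → Plane} {τ t : ℝ} {g : ℝ → ℝ} (hτ : 0 ≤ τ)
    (h : P.IsLift y (τ + t) g) : P.IsLift (fun a => y (τ + a)) t fun a => g (τ + a) := by
  have hm : MapsTo (fun a => τ + a) (Icc 0 t) (Icc 0 (τ + t)) := fun a ha =>
    ⟨by linarith [ha.1], by linarith [ha.2]⟩
  exact ⟨h.1.comp (by fun_prop) hm, fun a ha => h.2 _ (hm ha)⟩

theorem IsLift.abs_sub_le_motion {x : Plane} {y : ℝ → Plane} {t : ℝ} {g : ℝ → ℝ}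
    (h : P.IsLift y t g) (hy : IsIntruderMotion ν x y) {a b : ℝ} (ha : a ∈ Icc 0 t)
    (hb : b ∈ Icc 0 t) : |g a - g b| ≤ ν * |a - b| :=
  h.abs_sub_le (fun a ha b hb => hy.2 a b ha.1 hb.1) ha hb

/-- The straight run, with arrival time. -/
theorem isIntruderMotion_straightRun (hν₀ : 0 < ν) {x z : Plane} :
    IsIntruderMotion ν x (straightRun ν x z) := by
  refine ⟨by simp [straightRun], fun t t' ht ht' => ?_⟩
  rw [straightRun, straightRun, norm_lineMap_sub_lineMap]
  rcases eq_or_ne x z with rfl | hne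
  · simpa using mul_nonneg hν₀.le (abs_nonneg _)
  have hpos : 0 < ‖z - x‖ := norm_pos_iff.2 (sub_ne_zero.2 hne.symm)
  have h1 := abs_min_sub_min_le_max 1 (ν * t / ‖z - x‖) 1 (ν * t' / ‖z - x‖)
  rw [sub_self, abs_zero, max_eq_right (abs_nonneg _)] at h1
  have h2 : ν * t / ‖z - x‖ - ν * t' / ‖z - x‖ = ν * (t - t') / ‖z - x‖ := by ring
  rw [h2, abs_div, abs_norm, abs_mul, abs_of_pos hν₀, le_div_iff₀ hpos] at h1
  rw [norm_sub_rev x z, mul_comm]; exact h1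

theorem straightRun_of_le {x z : Plane} {t : ℝ} (hxz : x ≠ z) (ht : ν * t ≤ ‖z - x‖) :
    straightRun ν x z t = AffineMap.lineMap x z (ν * t / ‖z - x‖) := by
  rw [straightRun, min_eq_right]
  exact (div_le_one (norm_pos_iff.2 (sub_ne_zero.2 hxz.symm))).2 ht

theorem straightRun_arrival (hν₀ : 0 < ν) {x z : Plane} (hxz : x ≠ z) :
    straightRun ν x z (‖x - z‖ / ν) = z := by
  have hpos : ‖z - x‖ ≠ 0 := norm_ne_zero_iff.2 (sub_ne_zero.2 hxz.symm)
  have e : ν * (‖x - z‖ / ν) = ‖z - x‖ := by rw [mul_div_cancel₀ _ hν₀.ne', norm_sub_rev]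
  rw [straightRun_of_le hxz e.le, e, div_self hpos, AffineMap.lineMap_apply_one]

theorem straightRun_notMem (hν₀ : 0 < ν) {x : Plane} {s t : ℝ} (hs : s ∈ P.visible x)
    (ht : t ∈ Ico 0 (‖x - P.γ s‖ / ν)) : straightRun ν x (P.γ s) t ∉ P.target := by
  have hne : x ≠ P.γ s := fun h => notMem_of_mem_visible hs (h ▸ P.γ_mem_target s)
  have hpos : 0 < ‖P.γ s - x‖ := norm_pos_iff.2 (sub_ne_zero.2 hne.symm)
  have h1 : ν * t < ‖P.γ s - x‖ := by
    have := (lt_div_iff₀ hν₀).1 ht.2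
    rw [norm_sub_rev, mul_comm]; exact this
  rw [straightRun_of_le hne h1.le]
  exact hs _ ⟨div_nonneg (mul_nonneg hν₀.le ht.1) hpos.le, (div_lt_one hpos).2 h1⟩

/-! ### Runs that beat all defenders -/

/-- Defenders stay on the perimeter, so capture is impossible before the intruder arrives; on
arrival, no lift of a defender can have come as far as `s`. -/
theorem scores_of_beats {ι : Type} {a : ι → ℝ} {y : ℝ → Plane} {s t : ℝ} (ht : 0 ≤ t)
    (hy : ∀ τ ∈ Ico 0 t, y τ ∉ P.target) (hyt : y t = P.γ s)
    (hbeat : ∀ k, ∀ n : ℤ, t < |a k + n * P.len - s|) {d : ι → ℝ → ℝ}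
    (hd : IsDefenderMotion a d) : P.Scores y d := by
  refine ⟨t, ht, hyt ▸ P.γ_mem_frontier s, fun τ hτ k hc => ?_⟩
  rcases hτ.2.eq_or_lt with rfl | hlt
  · rw [hyt] at hc
    obtain ⟨n, hn⟩ := P.γ_eq_iff.1 hc
    have h1 := (hd k).2 0 τ le_rfl ht
    rw [(hd k).1, hn, zero_sub, abs_neg, abs_of_nonneg ht] at h1
    have h2 := hbeat k (-n)
    push_cast at h2
    rw [show a k + -(n : ℝ) * P.len - s = a k - (s + n * P.len) by ring] at h2
    linarith
  · exact hy τ ⟨hτ.1, hlt⟩ (hc ▸ P.γ_mem_target _)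

theorem intruderWins_of_scores {ι : Type} {a : ι → ℝ} {x : Plane} {y : ℝ → Plane}
    (hy : IsIntruderMotion ν x y) (h : ∀ d, IsDefenderMotion a d → P.Scores y d) :
    P.IntruderWins ν a x :=
  ⟨fun _ => y, fun _ _ => hy, fun _ _ _ _ _ _ _ _ => rfl, h⟩

theorem not_defendersWin_of_scores {ι : Type} {a : ι → ℝ} {x : Plane} {y : ℝ → Plane}
    (hy : IsIntruderMotion ν x y) (h : ∀ d, IsDefenderMotion a d → P.Scores y d) :
    ¬ P.DefendersWin ν a x := fun ⟨_, hβ, _, hw⟩ => hw y hy (h _ (hβ y hy))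

theorem lt_abs_add_int {a s t : ℝ} (n : ℤ) (h1 : t < s - a) (h2 : t < a + P.len - s) :
    t < |a + n * P.len - s| := by
  have hL := P.len_pos
  rcases le_or_gt n 0 with hn | hn
  · have : (n : ℝ) * P.len ≤ 0 :=
      mul_nonpos_of_nonpos_of_nonneg (by exact_mod_cast hn) hL.le
    exact lt_of_lt_of_le (by linarith) (neg_le_abs _)
  · have h3 : (1 : ℝ) ≤ n := by exact_mod_cast hn
    have : P.len ≤ n * P.len := by nlinarith
    exact lt_of_lt_of_le (by linarith) (le_abs_self _)

/-! ### Lifts of defender positions -/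

theorem IsDefenderMotion.add_int {ι : Type} {a : ι → ℝ} {d : ι → ℝ → ℝ}
    (hd : IsDefenderMotion a d) (c : ι → ℝ) :
    IsDefenderMotion (fun k => a k + c k) fun k t => d k t + c k :=
  fun k => ⟨by simp [(hd k).1], fun t t' ht ht' => by
    rw [add_sub_add_right_eq_sub]; exact (hd k).2 t t' ht ht'⟩

theorem Scores.add_int {ι : Type} {y : ℝ → Plane} {d : ι → ℝ → ℝ} (h : P.Scores y d)
    (n : ι → ℤ) : P.Scores y fun k t => d k t + n k * P.len := by
  obtain ⟨t, h1, h2, h3⟩ := h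
  exact ⟨t, h1, h2, fun τ hτ k => by rw [P.γ_add_int]; exact h3 τ hτ k⟩

theorem DefendersWin.add_int {ι : Type} {a : ι → ℝ} {x : Plane} (h : P.DefendersWin ν a x)
    (n : ι → ℤ) : P.DefendersWin ν (fun k => a k + n k * P.len) x := by
  obtain ⟨β, h1, h2, h3⟩ := h
  refine ⟨fun y k t => β y k t + n k * P.len, fun y hy => (h1 y hy).add_int _,
    fun y y' hy hy' t₁ he t ht k => by simp only [h2 y y' hy hy' t₁ he t ht k],
    fun y hy hs => ?_⟩
  refine h3 y hy ?_
  have := hs.add_int fun k => -n k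
  simpa using this

theorem IntruderWins.add_int {ι : Type} {a : ι → ℝ} {x : Plane} (h : P.IntruderWins ν a x)
    (n : ι → ℤ) : P.IntruderWins ν (fun k => a k + n k * P.len) x := by
  obtain ⟨α, h1, h2, h3⟩ := h
  have hback : ∀ d, IsDefenderMotion (fun k => a k + n k * P.len) d →
      IsDefenderMotion a fun k t => d k t + -(n k * P.len) := fun d hd => by
    simpa using hd.add_int fun k => -(n k * P.len)
  refine ⟨fun d => α fun k t => d k t + -(n k * P.len), fun d hd => h1 _ (hback d hd),
    fun d d' hd hd' t₁ he t ht => h2 _ _ (hback d hd) (hback d' hd') t₁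
      (fun t ht k => by rw [he t ht k]) t ht, fun d hd => ?_⟩
  simpa using (h3 _ (hback d hd)).add_int n

/-! ### Positions covered by the defenders -/

variable (P ν) in
/-- Every path of the intruder through the exterior to the perimeter ends, at the time `t`, at a
point that some defender reaches by the time `t - ε`. Positions are lifted to the line. -/
def Covered {ι : Type} (a : ι → ℝ) (x : Plane) (σ ε : ℝ) : Prop :=
  ∀ (y : ℝ → Plane) (t : ℝ) (g : ℝ → ℝ), IsIntruderMotion ν x y → 0 ≤ t → y t ∈ P.target →
    P.IsLift y t g → g 0 = σ → ∃ k, |g t - a k| + ε ≤ t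

theorem exists_visibleLift_of_motion {x : Plane} {y : ℝ → Plane} {t : ℝ} {g : ℝ → ℝ} (hν₀ : 0 < ν)
    (hν₁ : ν ≤ 1) (hx : x ∉ P.target) (hy : IsIntruderMotion ν x y) (ht : 0 ≤ t)
    (hyt : y t ∈ P.target) (hg : P.IsLift y t g) :
    ∃ s ∈ P.visibleLift x (g 0), |g t - s| + ‖x - P.γ s‖ / ν ≤ t := by
  obtain ⟨s, hs, h⟩ := hg.exists_visibleLift_of_path hx ht hy.1
    (fun a ha b hb => hy.2 a b ha.1 hb.1) hyt
  refine ⟨s, hs, ?_⟩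
  have h1 : |g t - s| ≤ |g t - s| / ν := by
    rw [le_div_iff₀ hν₀]; nlinarith [abs_nonneg (g t - s)]
  have h2 : (|g t - s| + ‖x - P.γ s‖) / ν ≤ t := by
    rw [div_le_iff₀ hν₀]; linarith
  rw [add_div] at h2
  linarith

/-- Only straight runs to visible points need checking: any other path loses at least the time in
which a defender walks from that visible point to the actual arrival point. -/
theorem covered_of_visibleLift {ι : Type} {a : ι → ℝ} {x : Plane} {σ ε : ℝ} (hν₀ : 0 < ν)
    (hν₁ : ν ≤ 1) (hx : x ∉ P.target)
    (h : ∀ s ∈ P.visibleLift x σ, ∃ k, |s - a k| + ε ≤ ‖x - P.γ s‖ / ν) :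
    P.Covered ν a x σ ε := by
  rintro y t g hy ht hyt hg rfl
  obtain ⟨s, hs, h1⟩ := exists_visibleLift_of_motion hν₀ hν₁ hx hy ht hyt hg
  obtain ⟨k, hk⟩ := h s hs
  exact ⟨k, by linarith [_root_.abs_sub_le (g t) s (a k)]⟩

/-- The lifted foot is no faster than the intruder, hence no faster than a defender. -/
theorem covered_self {x : Plane} {σ : ℝ} (hν₁ : ν ≤ 1) :
    P.Covered ν ![σ] x σ 0 := by
  rintro y t g hy ht hyt hg rfl
  refine ⟨0, ?_⟩
  have := hg.abs_sub_le_motion hy (a := t) (b := 0) ⟨ht, le_rfl⟩ ⟨le_rfl, ht⟩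
  rw [sub_zero, abs_of_nonneg ht] at this
  simp only [Matrix.cons_val_fin_one, add_zero]
  nlinarith

/-- Prepend the motion up to `τ`. The bound refers to the original defender positions and so allows
the extra time `τ`. -/
theorem Covered.along {ι : Type} {a : ι → ℝ} {x : Plane} {σ ε : ℝ} (h : P.Covered ν a x σ ε)
    {y : ℝ → Plane} {τ : ℝ} {g : ℝ → ℝ} (hy : IsIntruderMotion ν x y) (hτ : 0 ≤ τ)
    (hg : P.IsLift y τ g) (hg0 : g 0 = σ) {y' : ℝ → Plane} {t : ℝ} {g' : ℝ → ℝ}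
    (hy' : IsIntruderMotion ν (y τ) y') (ht : 0 ≤ t) (hyt : y' t ∈ P.target)
    (hg' : P.IsLift y' t g') (hg0' : g' 0 = g τ) : ∃ k, |g' t - a k| + ε ≤ τ + t := by
  obtain ⟨k, hk⟩ := h (continueWith τ y y') (τ + t) (continueWith τ g g')
    (hy.continueWith hτ hy') (by linarith)
    (by rwa [continueWith_of_ge hy'.1 (by linarith), add_sub_cancel_left])
    (hg.continueWith hτ ht hg' hy'.1 hg0') (by rw [continueWith_of_le _ _ hτ, hg0])
  rw [continueWith_of_ge hg0' (by linarith), add_sub_cancel_left] at hk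
  exact ⟨k, hk⟩

theorem Covered.captured {ι : Type} {a : ι → ℝ} {x : Plane} {σ : ℝ} (hν₀ : 0 < ν)
    (h : P.Covered ν a x σ 0) (hx : x ∈ P.target) (hσ : P.γ σ = P.foot x) :
    ∃ k, x = P.γ (a k) := by
  obtain ⟨k, hk⟩ := h (fun _ => x) 0 (fun _ => σ) (isIntruderMotion_const hν₀ x) le_rfl hx
    ⟨continuousOn_const, fun _ _ => hσ⟩ rfl
  rw [add_zero] at hk
  have : σ = a k := sub_eq_zero.1 (abs_nonpos_iff.1 hk)
  exact ⟨k, by rw [← this, hσ, P.foot_eq_self hx]⟩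

/-! ### The lift of the motion of the intruder up to the time of arrival -/

variable (P) in
/-- The time, stopped when `y` first reaches the target. -/
def clock (y : ℝ → Plane) (t : ℝ) : ℝ := sSup {τ | τ ∈ Icc 0 t ∧ ∀ τ' ∈ Ico 0 τ, y τ' ∉ P.target}

section clock

variable {y : ℝ → Plane} {t : ℝ}

theorem clock_isLUB (ht : 0 ≤ t) : IsLUB {τ | τ ∈ Icc 0 t ∧ ∀ τ' ∈ Ico 0 τ, y τ' ∉ P.target}
    (P.clock y t) :=
  isLUB_csSup ⟨0, ⟨le_rfl, ht⟩, fun _ hτ' => absurd hτ'.1 (not_le.2 hτ'.2)⟩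
    ⟨t, fun _ hτ => hτ.1.2⟩

theorem clock_le (ht : 0 ≤ t) : P.clock y t ≤ t := (clock_isLUB ht).2 fun _ hτ => hτ.1.2

theorem clock_nonneg (ht : 0 ≤ t) : 0 ≤ P.clock y t :=
  (clock_isLUB ht).1 ⟨⟨le_rfl, ht⟩, fun _ hτ' => absurd hτ'.1 (not_le.2 hτ'.2)⟩

theorem notMem_of_lt_clock (ht : 0 ≤ t) {τ : ℝ} (hτ : τ ∈ Ico 0 (P.clock y t)) :
    y τ ∉ P.target := by
  obtain ⟨τ', hτ', h1, -⟩ := (clock_isLUB ht).exists_between hτ.2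
  exact hτ'.2 τ ⟨hτ.1, h1⟩

theorem le_clock {τ : ℝ} (hτ : τ ∈ Icc 0 t) (h : ∀ τ' ∈ Ico 0 τ, y τ' ∉ P.target) :
    τ ≤ P.clock y t := (clock_isLUB (hτ.1.trans hτ.2)).1 ⟨hτ, h⟩

theorem clock_eq (ht : 0 ≤ t) (h : ∀ τ' ∈ Ico 0 t, y τ' ∉ P.target) : P.clock y t = t :=
  le_antisymm (clock_le ht) (le_clock ⟨ht, le_rfl⟩ h)

theorem abs_clock_sub_le {t' : ℝ} (ht : 0 ≤ t) (ht' : 0 ≤ t') :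
    |P.clock y t - P.clock y t'| ≤ |t - t'| := by
  wlog h : t' ≤ t generalizing t t'
  · rw [abs_sub_comm, abs_sub_comm t]; exact this ht' ht (le_of_not_ge h)
  have h1 := clock_nonneg (P := P) (y := y) ht
  have h2 : P.clock y t' ≤ P.clock y t :=
    le_clock ⟨clock_nonneg ht', (clock_le ht').trans h⟩ fun τ' hτ' => notMem_of_lt_clock ht' hτ'
  have h3 : P.clock y t ≤ P.clock y t' + (t - t') := by
    rcases le_total (P.clock y t) t' with h4 | h4
    · have := le_clock (P := P) (y := y) ⟨h1, h4⟩ fun τ' hτ' => notMem_of_lt_clock ht hτ'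
      linarith
    · have := clock_eq (P := P) (y := y) ht' fun τ' hτ' =>
        notMem_of_lt_clock ht ⟨hτ'.1, hτ'.2.trans_le h4⟩
      have := clock_le (P := P) (y := y) ht
      linarith
  rw [abs_of_nonneg (by linarith), abs_of_nonneg (by linarith)]
  linarith

theorem clock_congr {y' : ℝ → Plane} (h : ∀ τ ∈ Icc 0 t, y τ = y' τ) :
    P.clock y t = P.clock y' t := by
  unfold clock
  congr 1
  ext τ
  refine and_congr_right fun hτ => forall₂_congr fun τ' hτ' => ?_
  rw [h τ' ⟨hτ'.1, hτ'.2.le.trans hτ.2⟩]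

theorem clock_mem_target (hy : ContinuousOn y (Ici 0)) {τ : ℝ} (hτ : τ ∈ Icc 0 t)
    (h : y τ ∈ P.target) : y (P.clock y t) ∈ P.target := by
  have ht := hτ.1.trans hτ.2
  by_contra hc
  have h0 := clock_nonneg (P := P) (y := y) ht
  have h1 : ∀ᶠ a in nhdsWithin (P.clock y t) (Ici 0), y a ∉ P.target :=
    (hy _ h0).eventually (P.isClosed_target.isOpen_compl.mem_nhds hc)
  obtain ⟨δ, hδ, h2⟩ := Metric.mem_nhdsWithin_iff.1 h1
  have h3 : ∀ a ∈ Ico 0 (P.clock y t + δ), y a ∉ P.target := by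
    intro a ha
    rcases lt_or_ge a (P.clock y t) with h4 | h4
    · exact notMem_of_lt_clock ht ⟨ha.1, h4⟩
    · exact h2 ⟨by rw [Metric.mem_ball, Real.dist_eq, abs_of_nonneg (by linarith)]; linarith [ha.2],
        ha.1⟩
  have h4 : min t (P.clock y t + δ) ≤ P.clock y t :=
    le_clock ⟨le_min ht (by linarith), min_le_left _ _⟩ fun a ha =>
      h3 a ⟨ha.1, ha.2.trans_le (min_le_right _ _)⟩
  have h5 : t ≤ P.clock y t := by
    rcases min_le_iff.1 h4 with h | h
    · exact h
    · linarith
  exact h3 τ ⟨hτ.1, by linarith [hτ.2]⟩ h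

end clock

variable (P) in
/-- The lift of the nearest points of `y`, up to the time of arrival. -/
def stoppedLift (y : ℝ → Plane) (σ : ℝ) : ℝ → ℝ :=
  Classical.epsilon fun g => g 0 = σ ∧ ∀ t, 0 ≤ t → P.IsLift (fun τ => y (P.clock y τ)) t g

section stoppedLift

variable {x : Plane} {y : ℝ → Plane} {σ : ℝ}

theorem isIntruderMotion_stopped (hν₀ : 0 < ν) (hy : IsIntruderMotion ν x y) :
    IsIntruderMotion ν x fun τ => y (P.clock y τ) := by
  refine ⟨?_, fun t t' ht ht' => ?_⟩
  · have : P.clock y 0 = 0 := le_antisymm (clock_le le_rfl) (clock_nonneg le_rfl)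
    simp only [this, hy.1]
  · exact (hy.2 _ _ (clock_nonneg ht) (clock_nonneg ht')).trans
      (mul_le_mul_of_nonneg_left (abs_clock_sub_le ht ht') hν₀.le)

theorem notMem_interior_stopped (hx : x ∉ interior P.target) (hy : IsIntruderMotion ν x y) {t : ℝ}
    (ht : 0 ≤ t) : y (P.clock y t) ∉ interior P.target := by
  rcases (clock_nonneg (P := P) (y := y) ht).eq_or_lt with h0 | h0
  · rw [← h0, hy.1]; exact hx
  · have := notMem_interior_of_limit (P := P) (x := x) h0 (hy.continuousOn_Icc _) (u := 1)
      fun τ hτ => by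
        rw [AffineMap.lineMap_apply_one]
        exact P.notMem_interior_of_notMem (notMem_of_lt_clock ht hτ)
    rwa [AffineMap.lineMap_apply_one] at this

theorem stoppedLift_spec (hν₀ : 0 < ν) (hx : x ∉ interior P.target) (hσ : P.γ σ = P.foot x)
    (hy : IsIntruderMotion ν x y) : P.stoppedLift y σ 0 = σ ∧
      ∀ t, 0 ≤ t → P.IsLift (fun τ => y (P.clock y τ)) t (P.stoppedLift y σ) := by
  have hm := isIntruderMotion_stopped (P := P) hν₀ hy
  have hc : Continuous fun t => y (P.clock y (max t 0)) :=
    hm.continuousOn.comp_continuous (by fun_prop) fun t => le_max_right t 0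
  obtain ⟨g, hgc, hg0, hg⟩ := P.exists_lift hc
    (fun t => notMem_interior_stopped hx hy (le_max_right t 0)) 0 (σ := σ)
    (by simpa [hm.1] using hσ)
  refine Classical.epsilon_spec
    (p := fun g => g 0 = σ ∧ ∀ t, 0 ≤ t → P.IsLift (fun τ => y (P.clock y τ)) t g)
    ⟨g, hg0, fun t _ => ⟨hgc.continuousOn, fun τ hτ => ?_⟩⟩
  rw [hg, max_eq_left hτ.1]

/-- The nonanticipativity of the defender strategy rests on this. -/
theorem stoppedLift_congr {y' : ℝ → Plane} (hν₀ : 0 < ν) (hx : x ∉ interior P.target)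
    (hσ : P.γ σ = P.foot x) (hy : IsIntruderMotion ν x y) (hy' : IsIntruderMotion ν x y')
    {t : ℝ} (h : ∀ τ ∈ Icc 0 t, y τ = y' τ) {τ : ℝ} (hτ : τ ∈ Icc 0 t) :
    P.stoppedLift y σ τ = P.stoppedLift y' σ τ := by
  have ht := hτ.1.trans hτ.2
  obtain ⟨h1, h2⟩ := stoppedLift_spec hν₀ hx hσ hy
  obtain ⟨h1', h2'⟩ := stoppedLift_spec hν₀ hx hσ hy'
  refine ((h2 t ht).congr fun a ha => ?_).eqOn (h2' t ht) ht (h1.trans h1'.symm) hτ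
  have e : P.clock y a = P.clock y' a := clock_congr fun b hb => h b ⟨hb.1, hb.2.trans ha.2⟩
  simp only [e]
  exact h _ ⟨clock_nonneg ha.1, (clock_le ha.1).trans ha.2⟩

theorem abs_stoppedLift_sub_le (hν₀ : 0 < ν) (hν₁ : ν ≤ 1) (hx : x ∉ interior P.target)
    (hσ : P.γ σ = P.foot x) (hy : IsIntruderMotion ν x y) {t t' : ℝ} (ht : 0 ≤ t) (ht' : 0 ≤ t') :
    |P.stoppedLift y σ t - P.stoppedLift y σ t'| ≤ |t - t'| := by
  have h := (stoppedLift_spec hν₀ hx hσ hy).2 (max t t') (le_max_of_le_left ht)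
  have h1 := h.abs_sub_le_motion (isIntruderMotion_stopped hν₀ hy) ⟨ht, le_max_left t t'⟩
    ⟨ht', le_max_right t t'⟩
  nlinarith [abs_nonneg (t - t')]

theorem isLift_stoppedLift (hν₀ : 0 < ν) (hx : x ∉ interior P.target) (hσ : P.γ σ = P.foot x)
    (hy : IsIntruderMotion ν x y) {t : ℝ} (ht : 0 ≤ t) (h : ∀ τ ∈ Ico 0 t, y τ ∉ P.target) :
    P.IsLift y t (P.stoppedLift y σ) :=
  ((stoppedLift_spec hν₀ hx hσ hy).2 t ht).congr fun a ha => by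
    simp only [clock_eq (P := P) (y := y) ha.1 fun τ hτ => h τ ⟨hτ.1, hτ.2.trans_le ha.2⟩]

end stoppedLift

/-! ### The strategy of the defenders -/

/-- Defenders that cover all paths of the intruder win: each runs towards the lift of the nearest
point and then follows it. -/
theorem defendersWin_of_covered {ι : Type} {a : ι → ℝ} {x : Plane} {σ : ℝ} (hν₀ : 0 < ν)
    (hν₁ : ν ≤ 1) (hx : x ∉ interior P.target) (hσ : P.γ σ = P.foot x)
    (h : P.Covered ν a x σ 0) : P.DefendersWin ν a x := by
  -- The lifted foot is clamped to the interval `[a k - t, a k + t]` reachable by time `t`. At the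
  -- time of arrival the clamp is inactive for the covering defender, which is then at the
  -- intruder's position.
  refine ⟨fun y k t => max (a k - t) (min (a k + t) (P.stoppedLift y σ t)), fun y hy k =>
    ⟨?_, fun t t' ht ht' => ?_⟩, fun y y' hy hy' t₁ he t ht k => ?_, fun y hy hs => ?_⟩
  · simp
  · refine (abs_max_sub_max_le_max _ _ _ _).trans (max_le ?_
      ((abs_min_sub_min_le_max _ _ _ _).trans (max_le ?_ ?_)))
    · rw [sub_sub_sub_cancel_left, abs_sub_comm]
    · rw [add_sub_add_left_eq_sub]
    · exact abs_stoppedLift_sub_le hν₀ hν₁ hx hσ hy ht ht'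
  · simp only [stoppedLift_congr hν₀ hx hσ hy hy' he ht]
  · obtain ⟨t, ht, hyt, hnot⟩ := hs
    have h1 := clock_mem_target hy.continuousOn (t := t) ⟨ht, le_rfl⟩
      (P.isClosed_target.frontier_subset hyt)
    have h0 := clock_nonneg (P := P) (y := y) ht
    have hl := isLift_stoppedLift hν₀ hx hσ hy h0 fun τ hτ => notMem_of_lt_clock ht hτ
    obtain ⟨k, hk⟩ := h y _ _ hy h0 h1 hl (stoppedLift_spec hν₀ hx hσ hy).1
    rw [add_zero] at hk
    obtain ⟨h2, h3⟩ := abs_le.1 hk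
    refine hnot _ ⟨h0, clock_le ht⟩ k ?_
    have h4 := hl.2 _ ⟨h0, le_rfl⟩
    rw [P.foot_eq_self h1] at h4
    simp only
    rw [min_eq_right (by linarith), max_eq_right (by linarith), h4]

end Perimeter
end

noncomputable section

namespace Perimeter

variable {P : Perimeter} {ν : ℝ}

/-! ### The intruder does not win from covered positions -/

/-- Coverage at `τ < T` gives coverage at `T` up to `2 (T - τ)`: once for the time that the intruder
still spends, once for the movement of the defender. With finitely many defenders the slack vanishes
in the limit. -/
theorem Covered.of_forall_lt {ι : Type} [Finite ι] {a : ι → ℝ} {d : ι → ℝ → ℝ} {x : Plane}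
    {y : ℝ → Plane} {g : ℝ → ℝ} {T : ℝ} (hT : 0 < T) (hd : IsDefenderMotion a d)
    (hy : IsIntruderMotion ν x y) (hg : P.IsLift y T g)
    (h : ∀ τ ∈ Ico 0 T, P.Covered ν (fun k => d k τ) (y τ) (g τ) 0) :
    P.Covered ν (fun k => d k T) (y T) (g T) 0 := by
  intro y' t g' hy' ht hyt hg' hg0
  have key : ∀ τ ∈ Ico 0 T, ∃ k, |g' t - d k T| ≤ 2 * (T - τ) + t := by
    intro τ hτ
    have e : τ + (T - τ) = T := by ring
    obtain ⟨k, hk⟩ := (h τ hτ).along (hy.shift hτ.1) (τ := T - τ) (by linarith [hτ.2])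
      (IsLift.shift hτ.1 (by rwa [e])) (by simp) (by rwa [e]) ht hyt hg' (by rw [hg0, e])
    refine ⟨k, ?_⟩
    have h1 := (hd k).2 τ T hτ.1 hT.le
    rw [abs_sub_comm τ, abs_of_pos (by linarith [hτ.2] : 0 < T - τ)] at h1
    have h2 := _root_.abs_sub_le (g' t) (d k τ) (d k T)
    linarith
  by_contra! hc
  simp only [add_zero] at hc
  have hev : ∀ᶠ τ in nhdsWithin T (Iio T), ∀ k, 2 * (T - τ) + t < |g' t - d k T| := by
    refine Filter.eventually_all.2 fun k => ?_
    have : Continuous fun τ : ℝ => 2 * (T - τ) + t := by fun_prop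
    refine nhdsWithin_le_nhds ((this.tendsto T).eventually (gt_mem_nhds ?_))
    simpa using hc k
  obtain ⟨τ, h1, h2⟩ := (hev.and (Ico_mem_nhdsLT hT)).exists
  obtain ⟨k, hk⟩ := key τ h2
  exact absurd (h1 k) (not_lt.2 hk)

/-- A velocity with which a defender keeps up with the intruder for a short time. -/
theorem exists_velocity {σ A : ℝ} (hA : A < σ) (e : ℝ) : ∃ δ > 0, ∃ w : ℝ, |w| ≤ 1 ∧
    ∀ τ ∈ Icc 0 δ, ∀ t b c : ℝ, |b - e| ≤ τ + t → |b - c| ≤ t → |c - σ| ≤ τ → b ≤ A + τ + t →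
      |b - (e + τ * w)| ≤ t := by
  rcases lt_trichotomy e σ with h | rfl | h
  · refine ⟨(σ - e) / 2, by linarith, 1, by simp, fun τ hτ t b c h1 h2 h3 h4 => ?_⟩
    rw [abs_le] at *
    constructor <;> linarith [hτ.1, hτ.2]
  -- A defender exactly at the lifted foot has no preferred direction. Running cw is safe for a
  -- while, because every arrival point `b` satisfies `b ≤ A + τ + t` and `A < σ`.
  · refine ⟨(e - A) / 2, by linarith, -1, by simp, fun τ hτ t b c h1 h2 h3 h4 => ?_⟩
    rw [abs_le] at *
    constructor <;> linarith [hτ.1, hτ.2]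
  · refine ⟨(e - σ) / 2, by linarith, -1, by simp, fun τ hτ t b c h1 h2 h3 h4 => ?_⟩
    rw [abs_le] at *
    constructor <;> linarith [hτ.1, hτ.2]

/-- The velocities depend on the present state only and work against every motion of the intruder.
So the defenders can commit to them for a time `δ` before the response of an intruder strategy is
known. -/
theorem Covered.exists_velocity {a : Fin 2 → ℝ} {x : Plane} {σ : ℝ} (hν₀ : 0 < ν) (hν₁ : ν ≤ 1)
    (hx : x ∉ P.target) (hσ : P.γ σ = P.foot x) (h : P.Covered ν a x σ 0) :
    ∃ δ > 0, ∃ w : Fin 2 → ℝ, (∀ k, |w k| ≤ 1) ∧ ∀ y, IsIntruderMotion ν x y → ∀ τ ∈ Icc 0 δ,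
      ∀ g, P.IsLift y τ g → g 0 = σ → P.Covered ν (fun k => a k + τ * w k) (y τ) (g τ) 0 := by
  obtain ⟨l, r, A, B, hb⟩ := P.exists_breachLift hν₀ hν₁ hx hσ
  choose δ hδ w hw hcov using fun k => Perimeter.exists_velocity (hb.A_lt hν₀ hν₁) (a k)
  refine ⟨min (δ 0) (δ 1), lt_min (hδ 0) (hδ 1), w, hw, ?_⟩
  intro y hy τ hτ g hg hg0 y' t g' hy' ht hyt hg' hg0'
  obtain ⟨k, hk⟩ := h.along hy hτ.1 hg hg0 hy' ht hyt hg' hg0'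
  refine ⟨k, ?_⟩
  rw [add_zero] at hk ⊢
  have hτk : τ ≤ δ k := by
    fin_cases k
    · exact hτ.2.trans (min_le_left _ _)
    · exact hτ.2.trans (min_le_right _ _)
  refine hcov k τ ⟨hτ.1, hτk⟩ t _ (g τ) hk ?_ ?_ ?_
  · have := hg'.abs_sub_le_motion hy' (a := t) (b := 0) ⟨ht, le_rfl⟩ ⟨le_rfl, ht⟩
    rw [sub_zero, abs_of_nonneg ht, hg0'] at this
    nlinarith
  · have := hg.abs_sub_le_motion hy (a := τ) (b := 0) ⟨hτ.1, le_rfl⟩ ⟨le_rfl, hτ.1⟩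
    rw [sub_zero, abs_of_nonneg hτ.1, hg0] at this
    nlinarith [hτ.1]
  · obtain ⟨s, hs, h1⟩ := exists_visibleLift_of_motion hν₀ hν₁ hx (hy.continueWith hτ.1 hy')
      (t := τ + t) (by linarith [hτ.1])
      (by rwa [continueWith_of_ge hy'.1 (by linarith), add_sub_cancel_left])
      (hg.continueWith hτ.1 ht hg' hy'.1 hg0')
    rw [continueWith_of_ge hg0' (by linarith), add_sub_cancel_left] at h1
    rw [continueWith_of_le _ _ hτ.1, hg0] at hs
    have h2 := hb.le_A s hs
    have h3 := le_abs_self (g' t - s)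
    linarith

variable (P ν) in
/-- Up to the time `p.1`, the motion `p.2` of the defenders keeps covering the responses of the
intruder. -/
def HoldsOut (α : (Fin 2 → ℝ → ℝ) → ℝ → Plane) (a : Fin 2 → ℝ) (σ : ℝ)
    (p : ℝ × (Fin 2 → ℝ → ℝ)) : Prop :=
  0 ≤ p.1 ∧ IsDefenderMotion a p.2 ∧ ∀ τ ∈ Icc 0 p.1, P.Covered ν (fun k => p.2 k τ)
    (α p.2 (P.clock (α p.2) τ)) (P.stoppedLift (α p.2) σ τ) 0

theorem notMem_of_scores_of_covered {x : Plane} {y : ℝ → Plane} {σ T : ℝ} {ι : Type}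
    {d : ι → ℝ → ℝ} (hν₀ : 0 < ν) (hx : x ∉ interior P.target) (hσ : P.γ σ = P.foot x)
    (hy : IsIntruderMotion ν x y) (hs : P.Scores y d) (hT : 0 ≤ T)
    (h : ∀ τ ∈ Icc 0 T, P.Covered ν (fun k => d k τ) (y (P.clock y τ)) (P.stoppedLift y σ τ) 0) :
    y (P.clock y T) ∉ P.target := by
  intro hc
  have h0 := clock_nonneg (P := P) (y := y) hT
  have e : P.clock y (P.clock y T) = P.clock y T := clock_eq h0 fun τ hτ => notMem_of_lt_clock hT hτ
  have h1 := h _ ⟨h0, clock_le hT⟩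
  have h2 := ((stoppedLift_spec hν₀ hx hσ hy).2 _ h0).2 _ ⟨h0, le_rfl⟩
  simp only [e] at h1 h2
  obtain ⟨k, hk⟩ := h1.captured hν₀ hc h2
  obtain ⟨t, ht, hyt, hnot⟩ := hs
  rcases le_or_gt (P.clock y T) t with h3 | h3
  · exact hnot _ ⟨h0, h3⟩ k hk
  · exact notMem_of_lt_clock hT ⟨ht, h3⟩ (P.isClosed_target.frontier_subset hyt)

end Perimeter
end

noncomputable section

namespace Perimeter

/-! ### Building a defender motion against an intruder strategy -/

variable {P : Perimeter} {ν : ℝ}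

/-- Motions that agree on overlaps glue to a 1-Lipschitz function on the union of their time
intervals, which extends to all times. -/
theorem exists_common_motion {ι : Type} {a : ι → ℝ} {c : Set (ℝ × (ι → ℝ → ℝ))} (hne : c.Nonempty)
    (h0 : ∀ p ∈ c, 0 ≤ p.1) (hd : ∀ p ∈ c, IsDefenderMotion a p.2)
    (hc : ∀ p ∈ c, ∀ q ∈ c, p.1 ≤ q.1 → ∀ t ∈ Icc 0 p.1, ∀ k, p.2 k t = q.2 k t) :
    ∃ d, IsDefenderMotion a d ∧ ∀ p ∈ c, ∀ t ∈ Icc 0 p.1, ∀ k, p.2 k t = d k t := by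
  have hagree : ∀ p ∈ c, ∀ q ∈ c, ∀ t, 0 ≤ t → t ≤ p.1 → t ≤ q.1 → ∀ k, p.2 k t = q.2 k t := by
    intro p hp q hq t ht h1 h2 k
    rcases le_total p.1 q.1 with h | h
    · exact hc p hp q hq h t ⟨ht, h1⟩ k
    · exact (hc q hq p hp h t ⟨ht, h2⟩ k).symm
  set S : Set ℝ := {t | 0 ≤ t ∧ ∃ p ∈ c, t ≤ p.1}
  choose! q hq using fun t (ht : t ∈ S) => ht.2
  have hlip : ∀ k, LipschitzOnWith 1 (fun t => (q t).2 k t) S := by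
    intro k
    refine LipschitzOnWith.of_dist_le_mul fun t ht t' ht' => ?_
    rw [NNReal.coe_one, one_mul, Real.dist_eq, Real.dist_eq]
    rcases le_total t t' with h | h
    · rw [hagree _ (hq t ht).1 _ (hq t' ht').1 t ht.1 (hq t ht).2 (h.trans (hq t' ht').2) k]
      exact (hd _ (hq t' ht').1 k).2 t t' ht.1 ht'.1
    · rw [hagree _ (hq t' ht').1 _ (hq t ht).1 t' ht'.1 (hq t' ht').2 (h.trans (hq t ht).2) k]
      exact (hd _ (hq t ht).1 k).2 t t' ht.1 ht'.1
  choose d hdl hde using fun k => (hlip k).extend_real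
  have hpd : ∀ p ∈ c, ∀ t ∈ Icc 0 p.1, ∀ k, p.2 k t = d k t := by
    intro p hp t ht k
    have hS : t ∈ S := ⟨ht.1, p, hp, ht.2⟩
    rw [← hde k hS]
    exact hagree p hp _ (hq t hS).1 t ht.1 ht.2 (hq t hS).2 k
  refine ⟨d, fun k => ⟨?_, fun t t' _ _ => ?_⟩, hpd⟩
  · obtain ⟨p, hp⟩ := hne
    rw [← hpd p hp 0 ⟨le_rfl, h0 p hp⟩ k, (hd p hp k).1]
  · have := (hdl k).dist_le_mul t t'
    rwa [NNReal.coe_one, one_mul, Real.dist_eq, Real.dist_eq] at this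

theorem stopped_congr {y y' : ℝ → Plane} {t τ : ℝ} (h : ∀ τ ∈ Icc 0 t, y τ = y' τ)
    (hτ : τ ∈ Icc 0 t) : y (P.clock y τ) = y' (P.clock y' τ) := by
  rw [clock_congr (P := P) fun b hb => h b ⟨hb.1, hb.2.trans hτ.2⟩]
  exact h _ ⟨clock_nonneg hτ.1, (clock_le hτ.1).trans hτ.2⟩

section

variable {α : (Fin 2 → ℝ → ℝ) → ℝ → Plane} {a : Fin 2 → ℝ} {x : Plane} {σ : ℝ}

theorem HoldsOut.covered (hν₀ : 0 < ν) (hx : x ∉ interior P.target) (hσ : P.γ σ = P.foot x)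
    (hα : ∀ s, IsDefenderMotion a s → IsIntruderMotion ν x (α s))
    (hna : ∀ s s', IsDefenderMotion a s → IsDefenderMotion a s' → ∀ t₁ : ℝ,
      (∀ t ∈ Icc 0 t₁, ∀ k, s k t = s' k t) → ∀ t ∈ Icc 0 t₁, α s t = α s' t)
    {p : ℝ × (Fin 2 → ℝ → ℝ)} (hp : P.HoldsOut ν α a σ p) {d : Fin 2 → ℝ → ℝ}
    (hd : IsDefenderMotion a d) (h : ∀ t ∈ Icc 0 p.1, ∀ k, p.2 k t = d k t) {τ : ℝ}
    (hτ : τ ∈ Icc 0 p.1) :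
    P.Covered ν (fun k => d k τ) (α d (P.clock (α d) τ)) (P.stoppedLift (α d) σ τ) 0 := by
  have h1 := hna p.2 d hp.2.1 hd p.1 h
  rw [← stopped_congr h1 hτ, ← stoppedLift_congr hν₀ hx hσ (hα _ hp.2.1) (hα d hd) h1 hτ]
  simpa only [h τ hτ] using hp.2.2 τ hτ

/-- A chain of motions of the defenders that hold out has an upper bound. -/
theorem HoldsOut.exists_common (hν₀ : 0 < ν) (hx : x ∉ interior P.target)
    (hσ : P.γ σ = P.foot x) (hα : ∀ s, IsDefenderMotion a s → IsIntruderMotion ν x (α s))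
    (hna : ∀ s s', IsDefenderMotion a s → IsDefenderMotion a s' → ∀ t₁ : ℝ,
      (∀ t ∈ Icc 0 t₁, ∀ k, s k t = s' k t) → ∀ t ∈ Icc 0 t₁, α s t = α s' t)
    (hsc : ∀ s, IsDefenderMotion a s → P.Scores (α s) s) {c : Set (ℝ × (Fin 2 → ℝ → ℝ))}
    (hne : c.Nonempty) (hc : ∀ p ∈ c, P.HoldsOut ν α a σ p)
    (hch : ∀ p ∈ c, ∀ q ∈ c, p.1 ≤ q.1 → ∀ t ∈ Icc 0 p.1, ∀ k, p.2 k t = q.2 k t) :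
    ∃ q, P.HoldsOut ν α a σ q ∧ ∀ p ∈ c, p.1 ≤ q.1 ∧ ∀ t ∈ Icc 0 p.1, ∀ k, p.2 k t = q.2 k t := by
  obtain ⟨d, hd, hpd⟩ := exists_common_motion hne (fun p hp => (hc p hp).1)
    (fun p hp => (hc p hp).2.1) hch
  have hcov : ∀ p ∈ c, ∀ τ ∈ Icc 0 p.1,
      P.Covered ν (fun k => d k τ) (α d (P.clock (α d) τ)) (P.stoppedLift (α d) σ τ) 0 :=
    fun p hp τ hτ => (hc p hp).covered hν₀ hx hσ hα hna hd (hpd p hp) hτ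
  obtain ⟨t₀, ht₀, hyt, -⟩ := hsc d hd
  -- Against the common motion the strategy scores at some time `t₀`. No member of the chain
  -- outlasts `t₀`, since arriving in a covered state means being captured.
  have hbdd : BddAbove (Prod.fst '' c) := by
    refine ⟨t₀, ?_⟩
    rintro _ ⟨p, hp, rfl⟩
    by_contra! h
    exact notMem_of_scores_of_covered hν₀ hx hσ (hα d hd) (hsc d hd) (hc p hp).1 (hcov p hp)
      (clock_mem_target (hα d hd).continuousOn ⟨ht₀, h.le⟩ (P.isClosed_target.frontier_subset hyt))
  have hle : ∀ p ∈ c, p.1 ≤ sSup (Prod.fst '' c) := fun p hp => le_csSup hbdd ⟨p, hp, rfl⟩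
  have h0 : 0 ≤ sSup (Prod.fst '' c) := by
    obtain ⟨p, hp⟩ := hne
    exact (hc p hp).1.trans (hle p hp)
  have hlt : ∀ τ ∈ Ico 0 (sSup (Prod.fst '' c)),
      P.Covered ν (fun k => d k τ) (α d (P.clock (α d) τ)) (P.stoppedLift (α d) σ τ) 0 := by
    intro τ hτ
    obtain ⟨_, ⟨p, hp, rfl⟩, h⟩ := exists_lt_of_lt_csSup (hne.image _) hτ.2
    exact hcov p hp τ ⟨hτ.1, h.le⟩
  refine ⟨(sSup (Prod.fst '' c), d), ⟨h0, hd, fun τ hτ => ?_⟩, fun p hp => ⟨hle p hp, hpd p hp⟩⟩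
  rcases hτ.2.lt_or_eq with h | rfl
  · exact hlt τ ⟨hτ.1, h⟩
  rcases h0.eq_or_lt with h | h
  · obtain ⟨p, hp⟩ := hne
    simp only
    rw [← h]
    exact hcov p hp 0 ⟨le_rfl, (hc p hp).1⟩
  · exact Covered.of_forall_lt h hd (isIntruderMotion_stopped hν₀ (hα d hd))
      ((stoppedLift_spec hν₀ hx hσ (hα d hd)).2 _ h0) hlt

theorem IsDefenderMotion.continueWith {ι : Type} {a w : ι → ℝ} {s : ι → ℝ → ℝ} {T : ℝ}
    (hs : IsDefenderMotion a s) (hT : 0 ≤ T) (hw : ∀ k, |w k| ≤ 1) :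
    IsDefenderMotion a fun k => continueWith T (s k) fun t => s k T + t * w k := by
  refine fun k => ⟨by simp only; rw [continueWith_of_le _ _ hT, (hs k).1], fun t t' ht ht' => ?_⟩
  have hmul : ∀ b b' : ℝ, |b * w k - b' * w k| ≤ |b - b'| := fun b b' => by
    rw [← sub_mul, abs_mul]
    exact mul_le_of_le_one_right (abs_nonneg _) (hw k)
  have h0 : s k T + 0 * w k = s k T := by rw [zero_mul, add_zero]
  simp only
  wlog h : t ≤ t' generalizing t t'
  · rw [abs_sub_comm, abs_sub_comm t]; exact this t' t ht' ht (le_of_not_ge h)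
  rcases le_total t' T with h1 | h1
  · rw [continueWith_of_le _ _ h1, continueWith_of_le _ _ (h.trans h1)]
    exact (hs k).2 t t' ht ht'
  rw [continueWith_of_ge h0 h1]
  rcases le_total T t with h2 | h2
  · rw [continueWith_of_ge h0 h2, add_sub_add_left_eq_sub]
    exact (hmul _ _).trans_eq (by rw [sub_sub_sub_cancel_right])
  · rw [continueWith_of_le _ _ h2]
    have e1 := (hs k).2 t T ht hT
    have e2 := hmul 0 (t' - T)
    rw [zero_mul, zero_sub, zero_sub, abs_neg, abs_neg,
      abs_of_nonneg (sub_nonneg.2 h1 : 0 ≤ t' - T)] at e2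
    rw [abs_of_nonpos (sub_nonpos.2 h2 : t - T ≤ 0)] at e1
    rw [abs_of_nonpos (sub_nonpos.2 h)]
    rw [abs_le] at *
    constructor <;> linarith

/-- Defenders that hold out for a time can hold out longer. -/
theorem HoldsOut.exists_longer (hν₀ : 0 < ν) (hν₁ : ν ≤ 1) (hx : x ∉ interior P.target)
    (hσ : P.γ σ = P.foot x) (hα : ∀ s, IsDefenderMotion a s → IsIntruderMotion ν x (α s))
    (hna : ∀ s s', IsDefenderMotion a s → IsDefenderMotion a s' → ∀ t₁ : ℝ,
      (∀ t ∈ Icc 0 t₁, ∀ k, s k t = s' k t) → ∀ t ∈ Icc 0 t₁, α s t = α s' t)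
    (hsc : ∀ s, IsDefenderMotion a s → P.Scores (α s) s) {p : ℝ × (Fin 2 → ℝ → ℝ)}
    (hp : P.HoldsOut ν α a σ p) :
    ∃ q, P.HoldsOut ν α a σ q ∧ p.1 < q.1 ∧ ∀ t ∈ Icc 0 p.1, ∀ k, p.2 k t = q.2 k t := by
  obtain ⟨T, s⟩ := p
  obtain ⟨hT, hs, hcov⟩ := id hp
  simp only at hT hs hcov
  have hT1 := hcov T ⟨hT, le_rfl⟩
  have hnot := notMem_of_scores_of_covered hν₀ hx hσ (hα s hs) (hsc s hs) hT hcov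
  have hfoot := ((stoppedLift_spec hν₀ hx hσ (hα s hs)).2 T hT).2 T ⟨hT, le_rfl⟩
  obtain ⟨δ, hδ, w, hw, hstep⟩ := hT1.exists_velocity hν₀ hν₁ hnot hfoot
  obtain ⟨d, hd, hsd, hd2⟩ : ∃ d, IsDefenderMotion a d ∧ (∀ t ∈ Icc 0 T, ∀ k, s k t = d k t) ∧
      ∀ k, ∀ t, T ≤ t → d k t = s k T + (t - T) * w k :=
    ⟨_, hs.continueWith hT hw, fun t ht k => (continueWith_of_le _ _ ht.2).symm,
      fun k t ht => continueWith_of_ge (by simp) ht⟩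
  have hz := isIntruderMotion_stopped (P := P) hν₀ (hα d hd)
  have hl := (stoppedLift_spec hν₀ hx hσ (hα d hd)).2
  have hagree := hna s d hs hd T hsd
  refine ⟨(T + δ, d), ⟨by simp only; linarith, hd, fun τ hτ => ?_⟩, by simp only; linarith, hsd⟩
  rcases le_total τ T with h | h
  · exact hp.covered hν₀ hx hσ hα hna hd hsd ⟨hτ.1, h⟩
  have e : T + (τ - T) = τ := by ring
  have h1 := hz.shift hT
  have h2 : P.IsLift (fun t => α d (P.clock (α d) (T + t))) (τ - T)
      fun t => P.stoppedLift (α d) σ (T + t) :=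
    IsLift.shift (y := fun t => α d (P.clock (α d) t)) hT (by rw [e]; exact hl τ hτ.1)
  have h3 : IsIntruderMotion ν (α s (P.clock (α s) T)) fun t => α d (P.clock (α d) (T + t)) := by
    rw [stopped_congr hagree ⟨hT, le_rfl⟩]; exact h1
  have h4 : P.stoppedLift (α d) σ (T + 0) = P.stoppedLift (α s) σ T := by
    rw [add_zero, stoppedLift_congr hν₀ hx hσ (hα s hs) (hα d hd) hagree ⟨hT, le_rfl⟩]
  have h5 := hstep _ h3 (τ - T) ⟨by linarith, by simp only at hτ; linarith [hτ.2]⟩ _ h2 h4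
  simp only [e] at h5
  have h6 : (fun k => d k τ) = fun k => s k T + (τ - T) * w k := funext fun k => hd2 k τ h
  simp only
  rw [h6]
  exact h5

end

/-- The defender feedback cannot simply be played against a strategy `α`, as each would wait for the
other. Instead, take a defender motion that holds out maximally against `α`, ordered by
continuation: it could still be prolonged by a short step with constant velocities. -/
theorem not_intruderWins {a : Fin 2 → ℝ} {x : Plane} {σ : ℝ} (hν₀ : 0 < ν) (hν₁ : ν ≤ 1)
    (hx : x ∉ P.target) (hσ : P.γ σ = P.foot x) (h : P.Covered ν a x σ 0) :
    ¬ P.IntruderWins ν a x := by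
  rintro ⟨α, hα, hna, hsc⟩
  have hx' := P.notMem_interior_of_notMem hx
  have h0 : P.HoldsOut ν α a σ (0, fun k _ => a k) := by
    have hd : IsDefenderMotion a fun k _ => a k := fun k =>
      ⟨rfl, fun t t' _ _ => by simp⟩
    refine ⟨le_rfl, hd, fun τ hτ => ?_⟩
    obtain rfl : τ = 0 := le_antisymm hτ.2 hτ.1
    have hc : P.clock (α fun k _ => a k) 0 = 0 :=
      le_antisymm (clock_le le_rfl) (clock_nonneg le_rfl)
    rw [hc, (hα _ hd).1, (stoppedLift_spec hν₀ hx' hσ (hα _ hd)).1]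
    exact h
  obtain ⟨⟨m, hm⟩, hmax⟩ := exists_maximal_of_chains_bounded
    (α := {p // P.HoldsOut ν α a σ p})
    (r := fun p q => p.1.1 ≤ q.1.1 ∧ ∀ t ∈ Icc 0 p.1.1, ∀ k, p.1.2 k t = q.1.2 k t)
    (fun c hc => by
      rcases c.eq_empty_or_nonempty with rfl | hne
      · exact ⟨⟨_, h0⟩, fun p hp => absurd hp (notMem_empty p)⟩
      obtain ⟨q, hq, hub⟩ := HoldsOut.exists_common hν₀ hx' hσ hα hna hsc
        (c := Subtype.val '' c) (hne.image _) (by rintro _ ⟨p, -, rfl⟩; exact p.2) (by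
          rintro _ ⟨p, hp, rfl⟩ _ ⟨q, hq, rfl⟩ hle t ht k
          rcases eq_or_ne p q with rfl | hpq
          · rfl
          rcases hc hp hq hpq with h | h
          · exact h.2 t ht k
          · exact (h.2 t ⟨ht.1, ht.2.trans hle⟩ k).symm)
      exact ⟨⟨q, hq⟩, fun p hp => hub p.1 ⟨p, hp, rfl⟩⟩)
    (fun {p q r} h1 h2 => ⟨h1.1.trans h2.1, fun t ht k =>
      (h1.2 t ht k).trans (h2.2 t ⟨ht.1, ht.2.trans h1.1⟩ k)⟩)
  obtain ⟨q, hq, hlt, hag⟩ := hm.exists_longer hν₀ hν₁ hx' hσ hα hna hsc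
  exact absurd (hmax ⟨q, hq⟩ ⟨hlt.le, hag⟩).1 (not_le.2 hlt)

end Perimeter
end

noncomputable section

namespace Perimeter

variable {P : Perimeter} {ν : ℝ}

/-! ### One defender opposite to the intruder -/

theorem mem_defenderRegion_of_foot {e : ℝ} {x : Plane} (hν₀ : 0 < ν) (hν₁ : ν ≤ 1)
    (h : P.γ e = P.foot x) : x ∈ P.defenderRegion ν e := by
  by_cases hx : x ∈ P.target
  · exact Or.inl (by rw [h, P.foot_eq_self hx])
  · obtain ⟨l, r, A, B, hb⟩ := exists_breachLift hν₀ hν₁ hx h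
    exact Or.inr ⟨hx, not_lt.2 (hb.V_nonpos (e := e) (k := 0) (by simp) (hb.r_le hν₀) (hb.le_l hν₀)
      (hb.A_lt hν₀ hν₁).le (hb.lt_B hν₀ hν₁).le)⟩

theorem defendersWin_of_foot {e : ℝ} {x : Plane} (hν₀ : 0 < ν) (hν₁ : ν ≤ 1)
    (hx : x ∉ interior P.target) (h : P.γ e = P.foot x) : P.DefendersWin ν ![e] x :=
  defendersWin_of_covered hν₀ hν₁ hx h (covered_self hν₁)

theorem Covered.mono {ι : Type} {a : ι → ℝ} {x : Plane} {σ ε ε' : ℝ} (h : P.Covered ν a x σ ε)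
    (hε : ε' ≤ ε) : P.Covered ν a x σ ε' := fun y t g hy ht hyt hg hg0 =>
  (h y t g hy ht hyt hg hg0).imp fun _ hk => by linarith

theorem exists_motion_to (hν₀ : 0 < ν) (x z : Plane) : ∃ y, IsIntruderMotion ν x y ∧
    y (‖x - z‖ / ν) = z ∧ ∀ τ ∈ Icc 0 (‖x - z‖ / ν), ‖y τ - z‖ ≤ ‖x - z‖ := by
  have harr : straightRun ν x z (‖x - z‖ / ν) = z := by
    rcases eq_or_ne x z with rfl | h
    · simp [straightRun]
    · exact straightRun_arrival hν₀ h
  have hm := isIntruderMotion_straightRun hν₀ (x := x) (z := z)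
  refine ⟨_, hm, harr, fun τ hτ => ?_⟩
  have h1 := hm.2 τ _ hτ.1 (hτ.1.trans hτ.2)
  rw [harr, abs_sub_comm, abs_of_nonneg (sub_nonneg.2 hτ.2)] at h1
  refine h1.trans ?_
  have h2 : ν * (‖x - z‖ / ν) = ‖x - z‖ := by rw [mul_div_cancel₀ _ hν₀.ne']
  nlinarith [hτ.1]

theorem exists_ball_notMem {x : Plane} (hx : x ∉ P.target) :
    ∃ ρ > 0, ∀ z, ‖z - x‖ < ρ → z ∉ P.target := by
  obtain ⟨ρ, hρ, h⟩ := Metric.isOpen_iff.1 P.isClosed_target.isOpen_compl x hx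
  exact ⟨ρ, hρ, fun z hz => h (by rwa [Metric.mem_ball, dist_eq_norm])⟩

theorem visible_lineMap {x : Plane} {s u : ℝ} (hs : s ∈ P.visible x) (hu : u ∈ Ico (0 : ℝ) 1) :
    s ∈ P.visible (AffineMap.lineMap x (P.γ s) u) := by
  intro t ht
  rw [show (AffineMap.lineMap (AffineMap.lineMap x (P.γ s) u : Plane) (P.γ s) t : Plane) =
    AffineMap.lineMap x (P.γ s) (u + (1 - u) * t) by
      simp only [AffineMap.lineMap_apply_module]; module]
  exact hs _ ⟨by nlinarith [hu.1, hu.2, ht.1], by nlinarith [hu.1, hu.2, ht.2]⟩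

theorem pair_add_int {si sj e : ℝ} {n : ℤ} (h : sj = e + n * P.len) (k : Fin 2) :
    ![si, e] k + (![0, n] k : ℤ) * P.len = ![si, sj] k := by
  revert k
  exact Fin.forall_fin_two.2 ⟨by simp, by simp [h]⟩

theorem lt_abs_pair_add_int {si sj s t : ℝ} (h1 : t < s - si) (h2 : t < si + P.arc si sj - s)
    (k : Fin 2) (n : ℤ) :
    t < |![si, sj] k + n * P.len - s| := by
  have h3 := P.arc_lt si sj
  obtain ⟨m, hm⟩ := P.exists_eq_add_arc si sj
  revert k
  refine Fin.forall_fin_two.2 ⟨lt_abs_add_int n h1 ?_, ?_⟩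
  · rw [Matrix.cons_val_zero]; linarith
  · have h4 := lt_abs_add_int (P := P) (a := si + P.arc si sj - P.len) (n + m + 1)
      (show t < s - _ by linarith) (by linarith)
    have e : sj + n * P.len - s =
        si + P.arc si sj - P.len + ((n + m + 1 : ℤ) : ℝ) * P.len - s := by
      push_cast; linear_combination hm
    rw [Matrix.cons_val_one, Matrix.cons_val_fin_one, e]
    exact h4

namespace PairLift

variable {x : Plane} {si sj σ l r A B : ℝ} (h : P.PairLift ν x si sj σ l r A B)
include h

theorem covered_min (hν₀ : 0 < ν) (hν₁ : ν ≤ 1) : P.Covered ν ![si, si + P.arc si sj] x σ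
    (min (-P.Vij ν si sj x) ((B - A) / 2)) := by
  refine covered_of_visibleLift hν₀ hν₁ h.notMem fun s hs => ?_
  rcases h.covered hν₀ hs with hc | hc
  · exact ⟨0, hc⟩
  · exact ⟨1, hc⟩

theorem A_lt_B (hν₀ : 0 < ν) (hν₁ : ν ≤ 1) : A < B := (h.A_lt hν₀ hν₁).trans (h.lt_B hν₀ hν₁)

theorem covered_zero (hν₀ : 0 < ν) (hν₁ : ν ≤ 1) (hV : P.Vij ν si sj x ≤ 0) :
    P.Covered ν ![si, si + P.arc si sj] x σ 0 :=
  (h.covered_min hν₀ hν₁).mono (le_min (by linarith) (by linarith [h.A_lt_B hν₀ hν₁]))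

theorem notMem_interior : x ∉ interior P.target := P.notMem_interior_of_notMem h.notMem

theorem defendersWin (hν₀ : 0 < ν) (hν₁ : ν ≤ 1) (hV : P.Vij ν si sj x ≤ 0) :
    P.DefendersWin ν ![si, sj] x := by
  obtain ⟨n, hn⟩ := P.exists_eq_add_arc si sj
  have hw := (defendersWin_of_covered hν₀ hν₁ h.notMem_interior h.foot
    (h.covered_zero hν₀ hν₁ hV)).add_int ![0, n]
  convert hw using 1
  funext k
  exact (pair_add_int hn k).symm

theorem scores_straightRun (hν₀ : 0 < ν) (hV : 0 < P.Vij ν si sj x) {d : Fin 2 → ℝ → ℝ}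
    (hd : IsDefenderMotion ![si, sj] d) :
    P.Scores (straightRun ν x (P.γ (P.sOpt ν si sj x))) d := by
  obtain ⟨s, hs, hopt, h1, h2⟩ := h.sOpt_spec
  have hvis := mem_visible_of_lift hs
  rw [hopt]
  have hne : x ≠ P.γ s := fun hc => h.notMem (hc ▸ P.γ_mem_target s)
  exact scores_of_beats (div_nonneg (norm_nonneg _) hν₀.le)
    (fun τ hτ => straightRun_notMem hν₀ hvis hτ) (straightRun_arrival hν₀ hne)
    (lt_abs_pair_add_int (by linarith) (by linarith)) hd

theorem intruderWins_iff (hν₀ : 0 < ν) (hν₁ : ν ≤ 1) :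
    P.IntruderWins ν ![si, sj] x ↔ 0 < P.Vij ν si sj x := by
  refine ⟨fun hw => ?_, fun hV => intruderWins_of_scores (isIntruderMotion_straightRun hν₀)
    fun d hd => h.scores_straightRun hν₀ hV hd⟩
  by_contra! hV
  obtain ⟨n, hn⟩ := P.exists_eq_add_arc si sj
  refine not_intruderWins hν₀ hν₁ h.notMem h.foot (h.covered_zero hν₀ hν₁ hV) ?_
  convert hw.add_int ![0, -n] using 1
  funext k
  exact (pair_add_int (by push_cast; linarith) k).symm

theorem defendersWin_iff (hν₀ : 0 < ν) (hν₁ : ν ≤ 1) :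
    P.DefendersWin ν ![si, sj] x ↔ P.Vij ν si sj x ≤ 0 := by
  refine ⟨fun hw => ?_, h.defendersWin hν₀ hν₁⟩
  by_contra! hV
  exact not_defendersWin_of_scores (isIntruderMotion_straightRun hν₀)
    (fun d hd => h.scores_straightRun hν₀ hV hd) hw

/-! ### The barrier -/

theorem mem_states (hne : P.γ si ≠ P.γ sj) : (![si, sj], x) ∈ P.states := ⟨hne, h.notMem⟩

/-- At value zero the intruder ties at `s_opt`. Starting slightly further along its own straight
run, it arrives strictly earlier than the defenders. -/
theorem mem_closure_intruderWins (hν₀ : 0 < ν) (hne : P.γ si ≠ P.γ sj)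
    (hV : P.Vij ν si sj x = 0) :
    (![si, sj], x) ∈ closure {p | p ∈ P.states ∧ P.IntruderWins ν p.1 p.2} := by
  obtain ⟨s, hs, -, h1, h2⟩ := h.sOpt_spec
  rw [hV, add_zero] at h1 h2
  have hvis := mem_visible_of_lift hs
  have hxs : x ≠ P.γ s := fun hc => h.notMem (hc ▸ P.γ_mem_target s)
  have hpos : 0 < ‖x - P.γ s‖ / ν := div_pos (norm_pos_iff.2 (sub_ne_zero.2 hxs)) hν₀
  have hcont : Continuous fun u : ℝ =>
      ((![si, sj] : Fin 2 → ℝ), (AffineMap.lineMap x (P.γ s) u : Plane)) :=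
    continuous_const.prodMk AffineMap.lineMap_continuous
  have htend := (hcont.tendsto 0).mono_left (nhdsWithin_le_nhds (s := Ioi 0))
  simp only [AffineMap.lineMap_apply_zero] at htend
  refine mem_closure_of_tendsto htend ?_
  filter_upwards [Ioo_mem_nhdsGT (zero_lt_one' ℝ)] with u hu
  have hvis' := visible_lineMap hvis ⟨hu.1.le, hu.2⟩
  have hnot := notMem_of_mem_visible hvis'
  refine ⟨⟨hne, hnot⟩, intruderWins_of_scores (isIntruderMotion_straightRun hν₀) fun d hd =>
    scores_of_beats (s := s) (div_nonneg (norm_nonneg _) hν₀.le)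
    (fun τ hτ => straightRun_notMem hν₀ hvis' hτ)
    (straightRun_arrival hν₀ fun hc => hnot (by rw [hc]; exact P.γ_mem_target s)) ?_ hd⟩
  have hlt : ‖(AffineMap.lineMap x (P.γ s) u : Plane) - P.γ s‖ / ν < ‖x - P.γ s‖ / ν := by
    have : (AffineMap.lineMap x (P.γ s) u : Plane) - P.γ s = (1 - u) • (x - P.γ s) := by
      simp only [AffineMap.lineMap_apply_module]; module
    rw [this, norm_smul, Real.norm_eq_abs, abs_of_pos (sub_pos.2 hu.2), mul_div_assoc]
    nlinarith [hu.1]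
  exact lt_abs_pair_add_int (by linarith) (by linarith)

/-- From a nearby state the intruder first runs to `x` and then makes the winning run; its lead
survives the detour. -/
theorem notMem_closure_defendersWin (hν₀ : 0 < ν) (hV : 0 < P.Vij ν si sj x) :
    (![si, sj], x) ∉ closure {p | p ∈ P.states ∧ P.DefendersWin ν p.1 p.2} := by
  intro hcl
  obtain ⟨s, hs, -, h1, h2⟩ := h.sOpt_spec
  have hvis := mem_visible_of_lift hs
  have hxs : x ≠ P.γ s := fun hc => h.notMem (hc ▸ P.γ_mem_target s)
  obtain ⟨ρ, hρ, hball⟩ := exists_ball_notMem h.notMem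
  set v := P.Vij ν si sj x
  -- The lead is `v`. The detour costs less than `v / 4` and each defender is displaced by less than
  -- `v / 4`, while a lead of `v / 2` is used below.
  obtain ⟨⟨a', x'⟩, ⟨-, hw⟩, hdist⟩ := Metric.mem_closure_iff.1 hcl
    (min ρ (min (v / 4) (ν * (v / 4)))) (by positivity)
  rw [Prod.dist_eq, max_lt_iff, dist_pi_lt_iff (by positivity), dist_eq_norm] at hdist
  obtain ⟨ha, hx⟩ := hdist
  simp only [Real.dist_eq, lt_min_iff] at ha hx
  rw [norm_sub_rev] at hx
  obtain ⟨y, hy, hyx, hyb⟩ := exists_motion_to hν₀ x' x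
  have hT : 0 ≤ ‖x' - x‖ / ν := div_nonneg (norm_nonneg _) hν₀.le
  have hT' : 0 ≤ ‖x - P.γ s‖ / ν := div_nonneg (norm_nonneg _) hν₀.le
  have hTv : ‖x' - x‖ / ν < v / 4 := by rw [div_lt_iff₀ hν₀]; linarith [hx.2.2]
  have hr : IsIntruderMotion ν (y (‖x' - x‖ / ν)) (straightRun ν x (P.γ s)) := by
    rw [hyx]; exact isIntruderMotion_straightRun hν₀
  refine not_defendersWin_of_scores (hy.continueWith hT hr) (fun d hd =>
    scores_of_beats (s := s) (t := ‖x' - x‖ / ν + ‖x - P.γ s‖ / ν) (add_nonneg hT hT')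
      (fun τ hτ => ?_) ?_ (fun k n => ?_) hd) hw
  · rcases le_total τ (‖x' - x‖ / ν) with h3 | h3
    · rw [continueWith_of_le _ _ h3]
      exact hball _ ((hyb τ ⟨hτ.1, h3⟩).trans_lt hx.1)
    · rw [continueWith_of_ge hr.1 h3]
      exact straightRun_notMem hν₀ hvis ⟨by linarith, by linarith [hτ.2]⟩
  · rw [continueWith_of_ge hr.1 (by linarith), add_sub_cancel_left, straightRun_arrival hν₀ hxs]
  · have h3 := lt_abs_pair_add_int (P := P) (si := si) (sj := sj) (s := s)
      (t := ‖x - P.γ s‖ / ν + v / 2) (by linarith) (by linarith) k n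
    have h4 := (ha k).2.1
    have h5 := _root_.abs_sub_le (![si, sj] k + n * P.len - s) (a' k + n * P.len - s) 0
    rw [sub_zero, sub_zero, sub_sub_sub_cancel_right, add_sub_add_right_eq_sub] at h5
    linarith

/-- A negative value gives coverage with a margin `ε > 0`. Passing to a nearby state spends less
than `ε / 2` on running from `x` to `x'` and less than `ε / 2` on the displacement of the defenders,
so that state is still covered. -/
theorem notMem_closure_intruderWins (hν₀ : 0 < ν) (hν₁ : ν ≤ 1) (hV : P.Vij ν si sj x < 0) :
    (![si, sj], x) ∉ closure {p | p ∈ P.states ∧ P.IntruderWins ν p.1 p.2} := by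
  intro hcl
  obtain ⟨ρ, hρ, hball⟩ := exists_ball_notMem h.notMem
  obtain ⟨ε, hε, hcov⟩ : ∃ ε > 0, P.Covered ν ![si, si + P.arc si sj] x σ ε :=
    ⟨_, lt_min (by linarith) (by linarith [h.A_lt_B hν₀ hν₁]), h.covered_min hν₀ hν₁⟩
  obtain ⟨⟨a', x'⟩, ⟨⟨-, hx'⟩, hw⟩, hdist⟩ := Metric.mem_closure_iff.1 hcl
    (min ρ (min (ε / 2) (ν * (ε / 2)))) (by positivity)
  rw [Prod.dist_eq, max_lt_iff, dist_pi_lt_iff (by positivity), dist_eq_norm] at hdist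
  obtain ⟨ha, hx⟩ := hdist
  simp only [Real.dist_eq, lt_min_iff] at ha hx
  obtain ⟨y, hy, hyx, -⟩ := exists_motion_to hν₀ x x'
  have hT : 0 ≤ ‖x - x'‖ / ν := div_nonneg (norm_nonneg _) hν₀.le
  have hTv : ‖x - x'‖ / ν < ε / 2 := by rw [div_lt_iff₀ hν₀]; linarith [hx.2.2]
  have hyb : ∀ τ ∈ Icc 0 (‖x - x'‖ / ν), y τ ∉ interior P.target := by
    intro τ hτ
    refine P.notMem_interior_of_notMem (hball _ (lt_of_le_of_lt ?_ hx.1))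
    have h1 := hy.2 τ 0 hτ.1 le_rfl
    rw [hy.1, sub_zero, abs_of_nonneg hτ.1] at h1
    have h2 := (le_div_iff₀ hν₀).1 hτ.2
    linarith
  obtain ⟨g, hg, hg0⟩ := P.exists_isLift hT (hy.continuousOn_Icc _) hyb
    (by rw [hy.1]; exact h.foot)
  obtain ⟨n, hn⟩ := P.exists_eq_add_arc si sj
  refine not_intruderWins (σ := g (‖x - x'‖ / ν)) hν₀ hν₁ hx'
    (by rw [hg.2 _ ⟨hT, le_rfl⟩, hyx]) ?_ (hw.add_int ![0, -n])
  intro y' t g' hy' ht hyt hg' hg0'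
  obtain ⟨k, hk⟩ := hcov.along hy hT hg hg0 (by rwa [hyx]) ht hyt hg' hg0'
  refine ⟨k, ?_⟩
  have h1 : |![si, si + P.arc si sj] k - (a' k + (![0, -n] k : ℤ) * P.len)| < ε / 2 := by
    have := (ha k).2.1
    rwa [← pair_add_int (n := -n) (sj := si + P.arc si sj) (e := sj) (by push_cast; linarith) k,
      add_sub_add_right_eq_sub]
  have h2 := _root_.abs_sub_le (g' t) (![si, si + P.arc si sj] k)
    (a' k + (![0, -n] k : ℤ) * P.len)
  linarith

theorem mem_barrier_iff (hν₀ : 0 < ν) (hν₁ : ν ≤ 1) (hne : P.γ si ≠ P.γ sj) :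
    (![si, sj], x) ∈ P.barrier ν ↔ P.Vij ν si sj x = 0 := by
  constructor
  · rintro ⟨⟨-, hI⟩, hD⟩
    rcases lt_trichotomy (P.Vij ν si sj x) 0 with hV | hV | hV
    · exact absurd hI (h.notMem_closure_intruderWins hν₀ hν₁ hV)
    · exact hV
    · exact absurd hD (h.notMem_closure_defendersWin hν₀ hV)
  · intro hV
    exact ⟨⟨h.mem_states hne, h.mem_closure_intruderWins hν₀ hne hV⟩,
      subset_closure ⟨h.mem_states hne, h.defendersWin hν₀ hν₁ hV.le⟩⟩

/-! ### The pincer maneuver -/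

/-- If the foot were on the far side of `D_i`, then `si` would lie in `[r, l]` and in `[A, B]`,
making the one-vs-one value nonpositive. -/
theorem lt_foot (hν₀ : 0 < ν) (hν₁ : ν ≤ 1) (hV : 0 < P.V ν si x) : si < σ := by
  by_contra! hc
  have h1 := h.le_center
  have h2 := h.A_lt_B hν₀ hν₁
  exact hV.not_ge (h.V_nonpos (e := si) (k := 0) (by simp) ((h.r_le hν₀).trans hc) h.le_l'
    ((h.A_lt hν₀ hν₁).le.trans hc) (by linarith))

theorem foot_lt (hν₀ : 0 < ν) (hν₁ : ν ≤ 1) (hV : 0 < P.V ν sj x) : σ < si + P.arc si sj := by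
  by_contra! hc
  have h1 := h.center_le
  have h2 := h.A_lt_B hν₀ hν₁
  obtain ⟨n, hn⟩ := P.exists_eq_add_arc si sj
  exact hV.not_ge (h.V_nonpos (e := si + P.arc si sj) (k := -n) (by push_cast; linarith)
    (h.r_le_center.trans h1) (hc.trans (h.le_l hν₀)) (by linarith)
    (hc.trans (h.lt_B hν₀ hν₁).le))

theorem pincer (hν₀ : 0 < ν) (hν₁ : ν ≤ 1) (hx : x ∈ P.pairedRegion ν si sj) {y : ℝ → Plane}
    (hy : IsIntruderMotion ν x y) : ∃ t : ℝ, 0 ≤ t ∧ (∀ τ ∈ Ico 0 t, y τ ∉ P.target) ∧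
      (P.γ (si + t) = P.foot (y t) ∨ P.γ (sj - t) = P.foot (y t)) := by
  obtain ⟨hVi, hVj, hVij⟩ := hx
  have hσi := h.lt_foot hν₀ hν₁ hVi
  have hσj := h.foot_lt hν₀ hν₁ hVj
  have hcov := h.covered_zero hν₀ hν₁ (not_lt.1 hVij)
  have harc := h.arc_pos
  have hx' := h.notMem_interior
  set G := P.stoppedLift y σ
  obtain ⟨hG0, hG⟩ := stoppedLift_spec hν₀ hx' h.foot hy
  -- `f t < 0` says that the lifted foot is strictly between the approaching defenders. They would
  -- meet at time `arc / 2`, so `f` has a zero by then; at the first one a defender stands at the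
  -- foot.
  set f : ℝ → ℝ := fun t => max (si + t - G t) (G t - (si + P.arc si sj - t))
  have hf : ContinuousOn f (Icc 0 (P.arc si sj / 2)) := by
    have := (hG (P.arc si sj / 2) (by linarith)).1
    fun_prop
  have hf0 : f 0 < 0 := by
    simp only [f, G, hG0]
    exact max_lt (by linarith) (by linarith)
  have hf1 : 0 ≤ f (P.arc si sj / 2) := by
    simp only [f, le_max_iff]
    by_contra! hc
    linarith [hc.1, hc.2]
  have hzero : ∀ b ∈ Icc 0 (P.arc si sj / 2), 0 ≤ f b → ∃ t ∈ Icc 0 b, f t = 0 :=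
    fun b hb hfb => intermediate_value_Icc hb.1 (hf.mono (Icc_subset_Icc_right hb.2))
      ⟨hf0.le, hfb⟩
  have hK : IsCompact (Icc 0 (P.arc si sj / 2) ∩ f ⁻¹' {0}) :=
    isCompact_Icc.of_isClosed_subset (hf.preimage_isClosed_of_isClosed isClosed_Icc
      isClosed_singleton) inter_subset_left
  obtain ⟨t, ⟨ht, hft⟩, hleast⟩ := hK.exists_isLeast (by
    obtain ⟨t, ht, h0⟩ := hzero _ ⟨by linarith, le_rfl⟩ hf1
    exact ⟨t, ht, h0⟩)
  have hneg : ∀ τ ∈ Ico 0 t, f τ < 0 := by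
    intro τ hτ
    by_contra! hc
    obtain ⟨τ', h1, h2⟩ := hzero τ ⟨hτ.1, hτ.2.le.trans ht.2⟩ hc
    have := hleast ⟨⟨h1.1, h1.2.trans (hτ.2.le.trans ht.2)⟩, h2⟩
    linarith [h1.2, hτ.2]
  -- If the intruder arrived earlier, coverage would place its arrival point within the elapsed time
  -- of some initial position, that is, not strictly between the pincers at that time.
  have hfree : ∀ τ ∈ Ico 0 t, y τ ∉ P.target := by
    intro τ hτ hmem
    have h0 := clock_nonneg (P := P) (y := y) hτ.1
    have h1 := clock_le (P := P) (y := y) hτ.1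
    obtain ⟨k, hk⟩ := hcov y _ _ hy h0 (clock_mem_target hy.continuousOn ⟨hτ.1, le_rfl⟩ hmem)
      (isLift_stoppedLift hν₀ hx' h.foot hy h0 fun τ' hτ' => notMem_of_lt_clock hτ.1 hτ') hG0
    have h2 := hneg _ ⟨h0, h1.trans_lt hτ.2⟩
    rw [add_zero] at hk
    obtain ⟨h3, h4⟩ := max_lt_iff.1 h2
    obtain ⟨h5, h6⟩ := abs_le.1 hk
    fin_cases k
    · simp only [Fin.zero_eta, Matrix.cons_val_zero] at h5 h6; linarith
    · simp only [Fin.mk_one, Matrix.cons_val_one, Matrix.cons_val_fin_one] at h5 h6; linarith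
  have hfoot := (isLift_stoppedLift hν₀ hx' h.foot hy ht.1 hfree).2 t ⟨ht.1, le_rfl⟩
  refine ⟨t, ht.1, hfree, ?_⟩
  have hft' : max (si + t - G t) (G t - (si + P.arc si sj - t)) = 0 := hft
  rcases max_choice (si + t - G t) (G t - (si + P.arc si sj - t)) with h1 | h1
  · left
    rw [← hfoot, show si + t = G t by linarith]
  · right
    obtain ⟨n, hn⟩ := P.exists_eq_add_arc si sj
    rw [← hfoot, show sj - t = G t + n * P.len by linarith, P.γ_add_int]

end PairLift

end Perimeter

/-! ### The theorem -/

theorem mainTheorem4 (P : Perimeter) (ν : ℝ) (hν₀ : 0 < ν) (hν₁ : ν ≤ 1) :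
    -- the two afferent surfaces divide the game space into two parts
    (∀ (a b : ℝ) (x : Plane), P.γ a ≠ P.γ b → x ∉ P.target →
      x ∈ P.sector ν a b ∨ x ∈ P.sector ν b a) ∧
    -- `D_i` and `D_j` bound, on the cw and on the ccw side, the part that contains the intruder
    ∀ (si sj : ℝ) (x : Plane), P.γ si ≠ P.γ sj → x ∈ P.sector ν si sj →
      -- the zero level set is the barrier
      ((![si, sj], x) ∈ P.barrier ν ↔ P.Vij ν si sj x = 0) ∧
      -- the zero level set: two one vs. one barriers and a circle around the midpoint
      (P.Vij ν si sj x = 0 ↔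
        (x ∈ P.regionI ν si sj ∧ P.V ν si x = 0) ∨
        (x ∈ P.regionJ ν si sj ∧ P.V ν sj x = 0) ∨
        (x ∉ P.regionI ν si sj ∧ x ∉ P.regionJ ν si sj ∧
          ‖x - P.γ (P.mid si sj)‖ = 1 / 2 * ν * P.arc si sj)) ∧
      -- the outcome of the game of kind
      (P.IntruderWins ν ![si, sj] x ↔ 0 < P.Vij ν si sj x) ∧
      (P.DefendersWin ν ![si, sj] x ↔ P.Vij ν si sj x ≤ 0) ∧
      -- the straight run to `s_opt` wins for the intruder, whatever the defenders do
      (0 < P.Vij ν si sj x → ∀ s : Fin 2 → ℝ → ℝ, Perimeter.IsDefenderMotion ![si, sj] s →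
        P.Scores (Perimeter.straightRun ν x (P.γ (P.sOpt ν si sj x))) s) ∧
      -- the pincer maneuver in the paired-defense region
      (x ∈ P.pairedRegion ν si sj → ∀ y : ℝ → Plane, Perimeter.IsIntruderMotion ν x y →
        ∃ t : ℝ, 0 ≤ t ∧ (∀ τ ∈ Set.Ico 0 t, y τ ∉ P.target) ∧
          ((y t ∈ P.defenderRegion ν (si + t) ∧ P.DefendersWin ν ![si + t] (y t)) ∨
           (y t ∈ P.defenderRegion ν (sj - t) ∧ P.DefendersWin ν ![sj - t] (y t)))) := by
  refine ⟨fun a b x hab hx => Perimeter.mem_sector_or hν₀ hν₁ hab hx, fun si sj x hne hs => ?_⟩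
  obtain ⟨σ, l, r, A, B, h⟩ := Perimeter.exists_pairLift hν₀ hν₁ hne hs
  refine ⟨h.mem_barrier_iff hν₀ hν₁ hne, h.Vij_eq_zero_iff hν₀ hν₁, h.intruderWins_iff hν₀ hν₁,
    h.defendersWin_iff hν₀ hν₁, fun hV d hd => h.scores_straightRun hν₀ hV hd, fun hx y hy => ?_⟩
  obtain ⟨t, ht, hfree, hfoot⟩ := h.pincer hν₀ hν₁ hx hy
  have hint : y t ∉ interior P.target := by
    have := Perimeter.notMem_interior_stopped h.notMem_interior hy ht
    rwa [Perimeter.clock_eq ht hfree] at this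
  exact ⟨t, ht, hfree, hfoot.imp
    (fun hf => ⟨Perimeter.mem_defenderRegion_of_foot hν₀ hν₁ hf,
      Perimeter.defendersWin_of_foot hν₀ hν₁ hint hf⟩)
    (fun hf => ⟨Perimeter.mem_defenderRegion_of_foot hν₀ hν₁ hf,
      Perimeter.defendersWin_of_foot hν₀ hν₁ hint hf⟩)⟩

end
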